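/- For each $n\in\mathbb N=\{1,2,\dots\}$ let $W_n=(w_{ij})_{i,j=1}^n$ (the entries depend on $n$) be a random $n\times n$ Hermitian complex matrix whose entries $w_{ij}$, $i\le j$, on and above the diagonal are independent. Assume that $$\mathbb E\,w_{ij}=0\quad\text{and}\quad |w_{ij}|\le \varepsilon_n \text{ almost surely}\qquad\text{for all } n\in\mathbb N,\ i,j=1,\dots,n,$$ where $1\ge\varepsilon_1\ge\varepsilon_2\ge\cdots$ are real numbers with $\varepsilon_n\to0$, and that $$\frac1n\sum_{i\in J_n}\sum_{j=1}^n\mathbb E|w_{ij}|^2\to0\qquad\text{for every choice of } J_n\subset\{1,\dots,n\},\ n\in\mathbb N,\text{ with } \frac{|J_n|}{n}\to0 .$$ Let $\mu_{W_n}=\frac1n\sum_{i=1}^n\delta_{\lambda_i(W_n)}$ be the empirical distribution of the eigenvalues $\lambda_1(W_n),\dots,\lambda_n(W_n)$ of $W_n$, counted with multiplicity, let $\mathbb E\mu_{W_n}$ be its mean, that is, the probability measure $B\mapsto\mathbb E[\mu_{W_n}(B)]$ on the Borel sets of $\mathbb R$, and let $\mu_{\mathrm{sc}}(dx)=\frac1{2\pi}\sqrt{\max(4-x^2,0)}\,dx$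 be the semicircle distribution. Then $\mathbb E\mu_{W_n}\to\mu_{\mathrm{sc}}$ weakly as $n\to\infty$ if and only if $$\frac1n\sum_{i=1}^n\Bigl|\sum_{j=1}^n\mathbb E|w_{ij}|^2-1\Bigr|\to0 .$$ Moreover, the Lindeberg condition holds under these hypotheses: $$\frac1n\sum_{i,j=1}^n\mathbb E\bigl[|w_{ij}|^2;\,|w_{ij}|>\delta\bigr]\to0\qquad\text{for every } \delta>0 .$$ -/

import Mathlib

open MeasureTheory ProbabilityTheory Filter Topology
open scoped ENNReal NNReal Polynomial

namespace SemicircleLaw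

/-- The empirical spectral distribution `(1/n) ∑ᵢ δ_{λᵢ(A)}` of an `n × n` Hermitian matrix, with the
eigenvalues counted with multiplicity (it is the zero measure for `n = 0`). -/
noncomputable def empiricalSpectral {n : ℕ} {A : Matrix (Fin n) (Fin n) ℂ} (hA : A.IsHermitian) :
    Measure ℝ :=
  (n : ℝ≥0∞)⁻¹ • ∑ i : Fin n, Measure.dirac (hA.eigenvalues i)

theorem isProbabilityMeasure_empiricalSpectral {n : ℕ} (hn : n ≠ 0)
    {A : Matrix (Fin n) (Fin n) ℂ} (hA : A.IsHermitian) :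
    IsProbabilityMeasure (empiricalSpectral hA) := by
  refine ⟨?_⟩
  simp only [empiricalSpectral, Measure.smul_apply, Measure.finsetSum_apply, measure_univ,
    Finset.sum_const, Finset.card_univ, Fintype.card_fin, nsmul_eq_mul, mul_one, smul_eq_mul]
  exact ENNReal.inv_mul_cancel (by exact_mod_cast hn) (ENNReal.natCast_ne_top n)

theorem empiricalSpectral_univ_le {n : ℕ} {A : Matrix (Fin n) (Fin n) ℂ} (hA : A.IsHermitian) :
    empiricalSpectral hA Set.univ ≤ 1 := by
  rcases Nat.eq_zero_or_pos n with rfl | hn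
  · simp [empiricalSpectral]
  · have := isProbabilityMeasure_empiricalSpectral hn.ne' hA
    exact prob_le_one

theorem sum_eigenvalues_pow {n : ℕ} {A : Matrix (Fin n) (Fin n) ℂ} (hA : A.IsHermitian) (m : ℕ) :
    ∑ i, hA.eigenvalues i ^ m = ((A ^ m).trace).re := by
  have h : (A ^ m).trace = ∑ i, ((hA.eigenvalues i ^ m : ℝ) : ℂ) := by
    conv_lhs => rw [hA.spectral_theorem, ← map_pow, Unitary.conjStarAlgAut_apply,
      Matrix.trace_mul_comm, ← mul_assoc]
    simp [Matrix.diagonal_pow, Matrix.trace]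
  rw [h, ← Complex.ofReal_sum, Complex.ofReal_re]

theorem exists_polynomial_tendsto_indicator (x : ℝ) :
    ∃ p : ℕ → ℝ[X], ∀ t : ℝ,
      Tendsto (fun k => (p k).eval t) atTop (𝓝 ((Set.Iic x).indicator 1 t)) := by
  let f : ℕ → ℝ → ℝ := fun k t => max 0 (1 - k * max 0 (t - x))
  have hf : ∀ k, Continuous (f k) := fun k => by fun_prop
  have hp : ∀ k : ℕ, ∃ p : ℝ[X], ∀ t ∈ Set.Icc (-(k : ℝ)) k,
      |p.eval t - f k t| < 1 / ((k : ℝ) + 1) := fun k =>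
    exists_polynomial_near_of_continuousOn _ _ (f k) (hf k).continuousOn _ (by positivity)
  choose p hp using hp
  refine ⟨p, fun t => ?_⟩
  have h1 : Tendsto (fun k => (p k).eval t - f k t) atTop (𝓝 0) := by
    refine squeeze_zero_norm' ?_ tendsto_one_div_add_atTop_nhds_zero_nat
    filter_upwards [eventually_ge_atTop ⌈|t|⌉₊] with k hk
    have hk' : |t| ≤ k := (Nat.le_ceil _).trans (by exact_mod_cast hk)
    exact (hp k t (abs_le.mp hk')).le
  have h2 : Tendsto (fun k => f k t) atTop (𝓝 ((Set.Iic x).indicator 1 t)) := by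
    by_cases ht : t ≤ x
    · have : ∀ k, f k t = 1 := fun k => by
        simp [f, max_eq_left (sub_nonpos.mpr ht)]
      simp [this, ht]
    · have ht' : 0 < t - x := by linarith [not_le.mp ht]
      have hz : (Set.Iic x).indicator (1 : ℝ → ℝ) t = 0 := by simp [not_le.mp ht]
      rw [hz]
      refine tendsto_const_nhds.congr' ?_
      filter_upwards [eventually_ge_atTop ⌈1 / (t - x)⌉₊] with k hk
      have hk' : 1 / (t - x) ≤ k := (Nat.le_ceil _).trans (by exact_mod_cast hk)
      rw [div_le_iff₀ ht'] at hk'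
      simp only [f, max_eq_right ht'.le]
      exact (max_eq_left (by linarith)).symm
  simpa using h1.add h2

theorem measurable_matrix_pow_apply {Ω : Type*} [MeasurableSpace Ω] {n : ℕ}
    {X : Ω → Matrix (Fin n) (Fin n) ℂ} (hX : ∀ i j, Measurable fun ω => X ω i j) (m : ℕ) :
    ∀ i j, Measurable fun ω => (X ω ^ m) i j := by
  induction m with
  | zero => intro i j; simp
  | succ m ih =>
    intro i j
    simp only [pow_succ, Matrix.mul_apply]
    exact Finset.measurable_fun_sum _ fun l _ => (ih i l).mul (hX l j)

/-- The empirical spectral distribution of a random Hermitian matrix is a random measure. -/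
theorem measurable_empiricalSpectral {Ω : Type*} [MeasurableSpace Ω] {n : ℕ}
    {X : Ω → Matrix (Fin n) (Fin n) ℂ} (hX : ∀ i j, Measurable fun ω => X ω i j)
    (hH : ∀ ω, (X ω).IsHermitian) : Measurable fun ω => empiricalSpectral (hH ω) := by
  rcases Nat.eq_zero_or_pos n with rfl | hn
  · simp [empiricalSpectral]
  have := fun ω => isProbabilityMeasure_empiricalSpectral hn.ne' (hH ω)
  refine .measure_of_isPiSystem_of_isProbabilityMeasure (borel_eq_generateFrom_Iic ℝ ▸
    (BorelSpace.measurable_eq (α := ℝ))) isPiSystem_Iic ?_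
  rintro _ ⟨x, rfl⟩
  obtain ⟨p, hp⟩ := exists_polynomial_tendsto_indicator x
  have h1 : ∀ k, Measurable fun ω => ∑ i, (p k).eval ((hH ω).eigenvalues i) := fun k => by
    simp only [Polynomial.eval_eq_sum_range]
    have : ∀ ω, ∑ i, ∑ m ∈ Finset.range ((p k).natDegree + 1),
        (p k).coeff m * (hH ω).eigenvalues i ^ m
        = ∑ m ∈ Finset.range ((p k).natDegree + 1), (p k).coeff m * ((X ω ^ m).trace).re := by
      intro ω
      rw [Finset.sum_comm]
      simp only [← Finset.mul_sum, sum_eigenvalues_pow]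
    simp only [this]
    refine Finset.measurable_fun_sum _ fun m _ => Measurable.const_mul ?_ _
    refine Complex.measurable_re.comp ?_
    simp only [Matrix.trace, Matrix.diag]
    exact Finset.measurable_fun_sum _ fun i _ => measurable_matrix_pow_apply hX m i i
  have h2 : Measurable fun ω => ∑ i, (Set.Iic x).indicator (1 : ℝ → ℝ) ((hH ω).eigenvalues i) := by
    refine measurable_of_tendsto_metrizable h1 (tendsto_pi_nhds.mpr fun ω => ?_)
    exact tendsto_finsetSum _ fun i _ => hp _
  have h3 : ∀ ω, empiricalSpectral (hH ω) (Set.Iic x) = (n : ℝ≥0∞)⁻¹ *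
      ENNReal.ofReal (∑ i, (Set.Iic x).indicator (1 : ℝ → ℝ) ((hH ω).eigenvalues i)) := by
    intro ω
    rw [ENNReal.ofReal_sum_of_nonneg fun i _ => Set.indicator_nonneg (by simp) _]
    simp only [empiricalSpectral, Measure.smul_apply, Measure.finsetSum_apply, smul_eq_mul]
    congr 1
    refine Finset.sum_congr rfl fun i _ => ?_
    rw [Measure.dirac_apply' _ measurableSet_Iic]
    by_cases h : (hH ω).eigenvalues i ≤ x <;> simp [h]
  simp only [h3]
  exact h2.ennreal_ofReal.const_mul _

/-- The mean `E μ_X` of the empirical spectral distribution of a random `n × n` Hermitian matrix `X`: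
the measure `B ↦ E[μ_X(B)]` on `ℝ` (see `meanSpectral_apply`). -/
noncomputable def meanSpectral {Ω : Type*} [MeasurableSpace Ω] (P : Measure Ω)
    [IsProbabilityMeasure P] {n : ℕ} (X : Ω → Matrix (Fin n) (Fin n) ℂ)
    (hH : ∀ ω, (X ω).IsHermitian) : FiniteMeasure ℝ :=
  ⟨P.bind fun ω => empiricalSpectral (hH ω), ⟨by
    refine (Measure.bind_apply_le _ MeasurableSet.univ).trans_lt ?_
    calc ∫⁻ ω, empiricalSpectral (hH ω) Set.univ ∂P ≤ ∫⁻ _, 1 ∂P :=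
          lintegral_mono fun ω => empiricalSpectral_univ_le _
      _ < ∞ := by simp⟩⟩

theorem meanSpectral_apply {Ω : Type*} [MeasurableSpace Ω] (P : Measure Ω)
    [IsProbabilityMeasure P] {n : ℕ} {X : Ω → Matrix (Fin n) (Fin n) ℂ}
    (hX : ∀ i j, Measurable fun ω => X ω i j) (hH : ∀ ω, (X ω).IsHermitian)
    {B : Set ℝ} (hB : MeasurableSet B) :
    (meanSpectral P X hH : Measure ℝ) B = ∫⁻ ω, empiricalSpectral (hH ω) B ∂P :=
  Measure.bind_apply hB (measurable_empiricalSpectral hX hH).aemeasurable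

/-- The density `√((4 - x²)₊) / (2π)` of the standard semicircle distribution. -/
noncomputable def semicircleDensity (x : ℝ) : ℝ := √(max (4 - x ^ 2) 0) / (2 * Real.pi)

theorem lintegral_semicircleDensity : ∫⁻ x, ENNReal.ofReal (semicircleDensity x) = 1 := by
  have hc : Continuous semicircleDensity := by unfold semicircleDensity; fun_prop
  have h0 : ∀ x, 0 ≤ semicircleDensity x := fun x => by unfold semicircleDensity; positivity
  have hz : ∀ x ∉ Set.Ioc (-2 : ℝ) 2, semicircleDensity x = 0 := fun x hx => by
    have : 4 - x ^ 2 ≤ 0 := by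
      by_contra! h
      exact hx ⟨by nlinarith, by nlinarith⟩
    simp [semicircleDensity, this]
  have hi : IntegrableOn semicircleDensity (Set.Ioc (-2 : ℝ) 2) :=
    (hc.integrableOn_Icc (a := -2) (b := 2)).mono_set Set.Ioc_subset_Icc_self
  have hI : Integrable semicircleDensity :=
    (integrableOn_iff_integrable_of_support_subset fun x hx => by
      by_contra h
      exact hx (hz x h)).mp hi
  rw [← ofReal_integral_eq_lintegral_ofReal hI (ae_of_all _ h0),
    ← setIntegral_eq_integral_of_forall_compl_eq_zero (s := Set.Ioc (-2 : ℝ) 2) hz,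
    ← intervalIntegral.integral_of_le (by norm_num)]
  have hs : ∫ x in (-2 : ℝ)..2, semicircleDensity x = 1 := by
    have h := intervalIntegral.mul_integral_comp_mul_left (f := semicircleDensity)
      (a := -1) (b := 1) (2 : ℝ)
    rw [show (2 : ℝ) * -1 = -2 by norm_num, show (2 : ℝ) * 1 = 2 by norm_num] at h
    rw [← h]
    have he : ∫ x in (-1 : ℝ)..1, semicircleDensity (2 * x)
        = ∫ x in (-1 : ℝ)..1, (1 / Real.pi) * √(1 - x ^ 2) := by
      refine intervalIntegral.integral_congr fun x hx => ?_
      rw [Set.uIcc_of_le (by norm_num)] at hx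
      have h1 : 0 ≤ 1 - x ^ 2 := by nlinarith [hx.1, hx.2]
      have h2 : max (4 - (2 * x) ^ 2) 0 = 2 ^ 2 * (1 - x ^ 2) := by
        rw [max_eq_left (by nlinarith)]; ring
      simp only [semicircleDensity]
      rw [h2, Real.sqrt_mul (by norm_num), Real.sqrt_sq (by norm_num)]
      field_simp
    rw [he, intervalIntegral.integral_const_mul, integral_sqrt_one_sub_sq]
    field_simp
  rw [hs, ENNReal.ofReal_one]

/-- The standard semicircle distribution `(2π)⁻¹ √((4 - x²)₊) dx`, a probability measure on `ℝ`. -/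
noncomputable def semicircle : ProbabilityMeasure ℝ :=
  ⟨volume.withDensity fun x => ENNReal.ofReal (semicircleDensity x), ⟨by
    rw [withDensity_apply _ MeasurableSet.univ, Measure.restrict_univ,
      lintegral_semicircleDensity]⟩⟩

/-- A Hermitian Wigner ensemble: for each `n`, `W n` is a random `n × n` Hermitian matrix, defined on
a probability space `Ω n`, whose entries on and above the diagonal are independent. -/
structure IsHermitianWignerEnsemble {Ω : ℕ → Type*} [∀ n, MeasurableSpace (Ω n)]
    (P : ∀ n, Measure (Ω n)) (W : ∀ n, Ω n → Matrix (Fin n) (Fin n) ℂ) : Prop where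
  measurable : ∀ n i j, Measurable fun ω => W n ω i j
  isHermitian : ∀ n ω, (W n ω).IsHermitian
  indep : ∀ n, iIndepFun
    (fun (p : {p : Fin n × Fin n // p.1 ≤ p.2}) ω => W n ω p.1.1 p.1.2) (P n)

/-- The sum `∑ⱼ E|w_ij|²` over the `i`-th row of a random matrix. -/
noncomputable def rowSum {Ω : Type*} [MeasurableSpace Ω] (P : Measure Ω) {n : ℕ}
    (X : Ω → Matrix (Fin n) (Fin n) ℂ) (i : Fin n) : ℝ :=
  ∑ j, ∫ ω, ‖X ω i j‖ ^ 2 ∂P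

/-- `(1/n) ∑_{i ∈ J_n} ∑ⱼ E|w_ij|² → 0` for all `J_n ⊆ {1, …, n}` with `|J_n| / n → 0`. -/
def MarginCondition {Ω : ℕ → Type*} [∀ n, MeasurableSpace (Ω n)]
    (P : ∀ n, Measure (Ω n)) (W : ∀ n, Ω n → Matrix (Fin n) (Fin n) ℂ) : Prop :=
  ∀ J : ∀ n, Finset (Fin n),
    Tendsto (fun n : ℕ => ((J n).card : ℝ) / n) atTop (𝓝 0) →
    Tendsto (fun n : ℕ => (1 / (n : ℝ)) * ∑ i ∈ J n, rowSum (P n) (W n) i) atTop (𝓝 0)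

/-- `(1/n) ∑ᵢ |∑ⱼ E|w_ij|² - 1| → 0`. -/
def RowCondition {Ω : ℕ → Type*} [∀ n, MeasurableSpace (Ω n)]
    (P : ∀ n, Measure (Ω n)) (W : ∀ n, Ω n → Matrix (Fin n) (Fin n) ℂ) : Prop :=
  Tendsto (fun n : ℕ => (1 / (n : ℝ)) * ∑ i, |rowSum (P n) (W n) i - 1|) atTop (𝓝 0)

/-- The Lindeberg condition: `(1/n) ∑_{i,j} E[|w_ij|²; |w_ij| > δ] → 0` for all `δ > 0`. -/
def LindebergCondition {Ω : ℕ → Type*} [∀ n, MeasurableSpace (Ω n)]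
    (P : ∀ n, Measure (Ω n)) (W : ∀ n, Ω n → Matrix (Fin n) (Fin n) ℂ) : Prop :=
  ∀ δ : ℝ, 0 < δ → Tendsto
    (fun n : ℕ => (1 / (n : ℝ)) * ∑ i, ∑ j, ∫ ω in {ω | δ < ‖W n ω i j‖}, ‖W n ω i j‖ ^ 2 ∂(P n))
    atTop (𝓝 0)

end SemicircleLaw

/-! Write `G = (W - iη)⁻¹`, `a_i = -iη G_ii`, `θ = η⁻²`, `σ_ij = E|w_ij|²` and `s_i = ∑ⱼ σ_ij`. Then
`|a_i| ≤ 1`, `Re a_i ≥ 0`, and the average of the `a_i` is the integral of the Cauchy kernel `-iη/(x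
- iη)` against the empirical spectral distribution. Convergence of these integrals in mean for all
`η ≥ 2` already gives weak convergence (`tendsto_of_tendsto_cauchyKernel`). For the semicircle law
the integral is the root `A` of `A = 1 - θA²`.

The probabilistic input is the self-consistent equation `a_i = 1 - θ a_i ∑ⱼ σ_ij a_j - e_i`, valid
for every variance profile with `E|e_i| ≤ 6ε(1 + s_i)` (`integral_norm_selfConsistencyError_le`). It
comes from the Schur complement formula and an orthogonality argument for the quadratic form of a
row in the resolvent of the remaining matrix. Everything else is deterministic analysis of this
equation.

Sufficiency: if the `s_i` are close to 1 on average, subtracting `A = 1 - θA²` gives a contraction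
in `ℓ¹` for `θ ≤ 1/4`, so the `a_i` are close to `A` on average (`sum_norm_sub_le`).

Necessity: summing the equation gives `∑ σ_ij Re(1 - a_i a_j) = ∑ s_i - θ⁻¹(n - Re ∑ a_i - Re ∑
e_i)`. If the mean spectral distribution converges, the right side divided by `n` is in expectation
close to `m - A²`, where `m` is the average of the `s_i`; moreover `A² → 1` as `η → ∞`. The left
side is nonnegative and at most of order `θ` apart from rows with large `s_i`, which the margin
condition makes negligible; hence `m → 1`. To next order `1 - a_i ≈ θ s_i`, so the left side is
about `2θ ∑ s_i²`, while `1 - A² ≤ 2θ`. So the average of the squares of the truncated row sums is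
asymptotically at most 1. First moment 1 and second moment at most 1 leave no room for fluctuation:
the average of `(s_i - 1)²`, after truncation, tends to 0.

The Lindeberg condition is immediate, since the entries are eventually smaller than any fixed `δ`.
-/

namespace SemicircleLaw

/-! ### Resolvent bounds on the imaginary axis. -/

/-- The matrix `A - iη`. -/
noncomputable def shifted {n : ℕ} (η : ℝ) (A : Matrix (Fin n) (Fin n) ℂ) :
    Matrix (Fin n) (Fin n) ℂ :=
  A - (η * Complex.I : ℂ) • 1

/-- The resolvent `(A - iη)⁻¹`. -/
noncomputable def resolvent {n : ℕ} (η : ℝ) (A : Matrix (Fin n) (Fin n) ℂ) :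
    Matrix (Fin n) (Fin n) ℂ :=
  (shifted η A)⁻¹

/-- The quadratic form of a Hermitian matrix is real, so only the shift contributes. Invertibility,
the bound `1/η` and the sign of `Im G_ii` all follow from this identity. -/
theorem star_dotProduct_shifted_mulVec {n : ℕ} (η : ℝ) {A : Matrix (Fin n) (Fin n) ℂ}
    (hA : A.IsHermitian) (v : Fin n → ℂ) :
    (star v ⬝ᵥ (shifted η A).mulVec v).im = -(η * ∑ i, ‖v i‖ ^ 2) := by
  have h1 : star v ⬝ᵥ v = ((∑ i, ‖v i‖ ^ 2 : ℝ) : ℂ) := by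
    simp [dotProduct, Complex.conj_mul']
  have h2 := hA.im_star_dotProduct_mulVec_self v
  simp only [RCLike.im_to_complex] at h2
  rw [shifted, Matrix.sub_mulVec, Matrix.smul_mulVec, Matrix.one_mulVec, dotProduct_sub,
    dotProduct_smul, Complex.sub_im, h2, h1, smul_eq_mul, Complex.im_mul_ofReal]
  simp

theorem sum_norm_sq_le_of_shifted_mulVec {n : ℕ} {η : ℝ} (hη : 0 < η)
    {A : Matrix (Fin n) (Fin n) ℂ} (hA : A.IsHermitian) {v u : Fin n → ℂ}
    (h : (shifted η A).mulVec v = u) :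
    η ^ 2 * ∑ i, ‖v i‖ ^ 2 ≤ ∑ i, ‖u i‖ ^ 2 := by
  have h1 := star_dotProduct_shifted_mulVec η hA v
  rw [h] at h1
  have h2 : η * ∑ i, ‖v i‖ ^ 2 ≤ ∑ i, ‖v i‖ * ‖u i‖ := by
    calc η * ∑ i, ‖v i‖ ^ 2 ≤ ‖star v ⬝ᵥ u‖ := by
          have := Complex.abs_im_le_norm (star v ⬝ᵥ u)
          rw [h1, abs_neg] at this
          exact (le_abs_self _).trans this
      _ ≤ ∑ i, ‖v i‖ * ‖u i‖ := by
          refine (norm_sum_le _ _).trans_eq ?_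
          simp
  have h3 : 2 * η * ∑ i, ‖v i‖ * ‖u i‖ ≤ η ^ 2 * ∑ i, ‖v i‖ ^ 2 + ∑ i, ‖u i‖ ^ 2 := by
    rw [Finset.mul_sum, Finset.mul_sum, ← Finset.sum_add_distrib]
    exact Finset.sum_le_sum fun i _ => by nlinarith [sq_nonneg (η * ‖v i‖ - ‖u i‖)]
  nlinarith

theorem isUnit_shifted {n : ℕ} {η : ℝ} (hη : 0 < η)
    {A : Matrix (Fin n) (Fin n) ℂ} (hA : A.IsHermitian) : IsUnit (shifted η A) := by
  rw [← Matrix.mulVec_injective_iff_isUnit]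
  intro v w hvw
  have h0 : (shifted η A).mulVec (v - w) = 0 := by
    rw [Matrix.mulVec_sub, sub_eq_zero]; exact hvw
  have h1 := sum_norm_sq_le_of_shifted_mulVec hη hA h0
  simp only [Pi.zero_apply, norm_zero, ne_eq, OfNat.ofNat_ne_zero, not_false_eq_true, zero_pow,
    Finset.sum_const_zero] at h1
  have h2 : ∑ i, ‖(v - w) i‖ ^ 2 = 0 :=
    le_antisymm (by nlinarith [sq_pos_of_pos hη]) (Finset.sum_nonneg fun i _ => by positivity)
  ext i
  have h3 := (Finset.sum_eq_zero_iff_of_nonneg fun i _ => by positivity).mp h2 i (Finset.mem_univ i)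
  have h4 : ‖(v - w) i‖ = 0 := by simpa using h3
  exact sub_eq_zero.mp (norm_eq_zero.mp h4)

theorem shifted_mul_resolvent {n : ℕ} {η : ℝ} (hη : 0 < η)
    {A : Matrix (Fin n) (Fin n) ℂ} (hA : A.IsHermitian) : shifted η A * resolvent η A = 1 :=
  Matrix.mul_nonsing_inv _ ((Matrix.isUnit_iff_isUnit_det _).mp (isUnit_shifted hη hA))

theorem resolvent_mul_shifted {n : ℕ} {η : ℝ} (hη : 0 < η)
    {A : Matrix (Fin n) (Fin n) ℂ} (hA : A.IsHermitian) : resolvent η A * shifted η A = 1 :=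
  Matrix.nonsing_inv_mul _ ((Matrix.isUnit_iff_isUnit_det _).mp (isUnit_shifted hη hA))

theorem shifted_mulVec_resolvent_col {n : ℕ} {η : ℝ} (hη : 0 < η)
    {A : Matrix (Fin n) (Fin n) ℂ} (hA : A.IsHermitian) (i : Fin n) :
    (shifted η A).mulVec (fun j => resolvent η A j i) = Pi.single i 1 := by
  ext j
  have := congrFun (congrFun (shifted_mul_resolvent hη hA) j) i
  rw [Matrix.mul_apply, Matrix.one_apply] at this
  rw [Matrix.mulVec, dotProduct, this, Pi.single_apply]

theorem eq_resolvent_mulVec {n : ℕ} {η : ℝ} (hη : 0 < η)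
    {A : Matrix (Fin n) (Fin n) ℂ} (hA : A.IsHermitian) {v u : Fin n → ℂ}
    (h : (shifted η A).mulVec v = u) : v = (resolvent η A).mulVec u := by
  rw [← h, Matrix.mulVec_mulVec, resolvent_mul_shifted hη hA, Matrix.one_mulVec]

theorem sum_norm_sq_resolvent_mulVec_le {n : ℕ} {η : ℝ} (hη : 0 < η)
    {A : Matrix (Fin n) (Fin n) ℂ} (hA : A.IsHermitian) (u : Fin n → ℂ) :
    η ^ 2 * ∑ i, ‖(resolvent η A).mulVec u i‖ ^ 2 ≤ ∑ i, ‖u i‖ ^ 2 :=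
  sum_norm_sq_le_of_shifted_mulVec hη hA (by
    rw [Matrix.mulVec_mulVec, shifted_mul_resolvent hη hA, Matrix.one_mulVec])

theorem sum_norm_sq_resolvent_col_le {n : ℕ} {η : ℝ} (hη : 0 < η)
    {A : Matrix (Fin n) (Fin n) ℂ} (hA : A.IsHermitian) (i : Fin n) :
    η ^ 2 * ∑ j, ‖resolvent η A j i‖ ^ 2 ≤ 1 := by
  refine (sum_norm_sq_le_of_shifted_mulVec hη hA
    (shifted_mulVec_resolvent_col hη hA i)).trans_eq ?_
  rw [Finset.sum_eq_single i] <;> simp +contextual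

theorem resolvent_transpose {n : ℕ} (η : ℝ) (A : Matrix (Fin n) (Fin n) ℂ) :
    resolvent η A.transpose = (resolvent η A).transpose := by
  rw [resolvent, resolvent, Matrix.transpose_nonsing_inv, shifted, shifted, Matrix.transpose_sub,
    Matrix.transpose_smul, Matrix.transpose_one]

theorem sum_norm_sq_resolvent_row_le {n : ℕ} {η : ℝ} (hη : 0 < η)
    {A : Matrix (Fin n) (Fin n) ℂ} (hA : A.IsHermitian) (i : Fin n) :
    η ^ 2 * ∑ j, ‖resolvent η A i j‖ ^ 2 ≤ 1 := by
  have := sum_norm_sq_resolvent_col_le hη hA.transpose i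
  simpa only [resolvent_transpose, Matrix.transpose_apply] using this

theorem norm_resolvent_apply_le {n : ℕ} {η : ℝ} (hη : 0 < η)
    {A : Matrix (Fin n) (Fin n) ℂ} (hA : A.IsHermitian) (j i : Fin n) :
    η * ‖resolvent η A j i‖ ≤ 1 := by
  have h1 := sum_norm_sq_resolvent_col_le hη hA i
  have h2 : ‖resolvent η A j i‖ ^ 2 ≤ ∑ j, ‖resolvent η A j i‖ ^ 2 :=
    Finset.single_le_sum (f := fun j => ‖resolvent η A j i‖ ^ 2) (fun _ _ => by positivity)
      (Finset.mem_univ j)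
  refine (sq_le_sq₀ (by positivity) zero_le_one).mp ?_
  rw [mul_pow, one_pow]
  exact (mul_le_mul_of_nonneg_left h2 (by positivity)).trans h1

theorem resolvent_apply_self_im_nonneg {n : ℕ} {η : ℝ} (hη : 0 < η)
    {A : Matrix (Fin n) (Fin n) ℂ} (hA : A.IsHermitian) (i : Fin n) :
    0 ≤ (resolvent η A i i).im := by
  have h := star_dotProduct_shifted_mulVec η hA (fun j => resolvent η A j i)
  rw [shifted_mulVec_resolvent_col hη hA i, dotProduct_single, mul_one, Pi.star_apply,
    RCLike.star_def, Complex.conj_im, neg_inj] at h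
  rw [h]
  positivity

/-- The diagonal entries `-iη ((A - iη)⁻¹)ᵢᵢ` of the normalized resolvent. -/
noncomputable def diagResolvent {n : ℕ} (η : ℝ) (A : Matrix (Fin n) (Fin n) ℂ) (i : Fin n) : ℂ :=
  -(η * Complex.I) * resolvent η A i i

theorem norm_diagResolvent_le {n : ℕ} {η : ℝ} (hη : 0 < η)
    {A : Matrix (Fin n) (Fin n) ℂ} (hA : A.IsHermitian) (i : Fin n) :
    ‖diagResolvent η A i‖ ≤ 1 := by
  simpa [diagResolvent, abs_of_pos hη] using norm_resolvent_apply_le hη hA i i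

theorem diagResolvent_re_nonneg {n : ℕ} {η : ℝ} (hη : 0 < η)
    {A : Matrix (Fin n) (Fin n) ℂ} (hA : A.IsHermitian) (i : Fin n) :
    0 ≤ (diagResolvent η A i).re := by
  simpa [diagResolvent] using mul_nonneg hη.le (resolvent_apply_self_im_nonneg hη hA i)

theorem sum_diagResolvent {n : ℕ} {η : ℝ} (hη : 0 < η)
    {A : Matrix (Fin n) (Fin n) ℂ} (hA : A.IsHermitian) :
    ∑ i, diagResolvent η A i
      = ∑ i, -(η * Complex.I) / ((hA.eigenvalues i : ℂ) - η * Complex.I) := by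
  have hne : ∀ i, (hA.eigenvalues i : ℂ) - η * Complex.I ≠ 0 := fun i h => by
    have := congrArg Complex.im h
    simp at this
    exact hη.ne' this
  let D : Matrix (Fin n) (Fin n) ℂ :=
    Matrix.diagonal fun i => ((hA.eigenvalues i : ℂ) - η * Complex.I)⁻¹
  let E : Matrix (Fin n) (Fin n) ℂ :=
    Matrix.diagonal fun i => (hA.eigenvalues i : ℂ) - η * Complex.I
  let U := hA.eigenvectorUnitary
  have hE : shifted η A = Unitary.conjStarAlgAut ℂ _ U E := by
    have : E = Matrix.diagonal (RCLike.ofReal ∘ hA.eigenvalues) - (η * Complex.I : ℂ) • 1 := by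
      ext i j
      by_cases h : i = j <;> simp [E, h]
    rw [this, map_sub, ← hA.spectral_theorem, map_smul, map_one, shifted]
  have hinv : resolvent η A = Unitary.conjStarAlgAut ℂ _ U D := by
    refine Matrix.inv_eq_right_inv ?_
    rw [hE, ← map_mul]
    have : E * D = 1 := by
      rw [Matrix.diagonal_mul_diagonal, ← Matrix.diagonal_one]
      congr 1; ext i; exact mul_inv_cancel₀ (hne i)
    rw [this, map_one]
  have htr : (resolvent η A).trace = ∑ i, ((hA.eigenvalues i : ℂ) - η * Complex.I)⁻¹ := by
    rw [hinv, Unitary.conjStarAlgAut_apply, Matrix.trace_mul_comm, ← mul_assoc]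
    simp [D, Matrix.trace]
  simp only [diagResolvent, div_eq_mul_inv, ← Finset.mul_sum]
  rw [← htr]; rfl

/-! ### Schur complement and the self-consistent equation. -/

/-- The matrix `A` with its `i`-th row and column replaced by zero. -/
def removeRow {n : ℕ} (A : Matrix (Fin n) (Fin n) ℂ) (i : Fin n) : Matrix (Fin n) (Fin n) ℂ :=
  Matrix.of fun j k => if j = i ∨ k = i then 0 else A j k

theorem isHermitian_removeRow {n : ℕ} {A : Matrix (Fin n) (Fin n) ℂ} (hA : A.IsHermitian)
    (i : Fin n) : (removeRow A i).IsHermitian := by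
  ext j k
  simp only [removeRow, Matrix.conjTranspose_apply, Matrix.of_apply, or_comm (a := k = i)]
  split_ifs
  · simp
  · exact hA.apply j k

/-- The `i`-th row of `A` without its diagonal entry. -/
def offRow {n : ℕ} (A : Matrix (Fin n) (Fin n) ℂ) (i j : Fin n) : ℂ :=
  if j = i then 0 else A i j

theorem shifted_removeRow_mulVec {n : ℕ} (η : ℝ) {A : Matrix (Fin n) (Fin n) ℂ}
    (hA : A.IsHermitian) (i : Fin n) (u : Fin n → ℂ) (k : Fin n) :
    (shifted η (removeRow A i)).mulVec u k
      = (if k = i then 0 else (shifted η A).mulVec u k) - u i * star (offRow A i k)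
        - if k = i then η * Complex.I * u i else 0 := by
  simp only [shifted, Matrix.sub_mulVec, Matrix.smul_mulVec, Matrix.one_mulVec, Pi.sub_apply,
    Pi.smul_apply, smul_eq_mul, offRow]
  by_cases hk : k = i
  · subst hk
    simp [Matrix.mulVec, dotProduct, removeRow]
  · simp only [hk, if_false, sub_zero]
    have h1 : ∀ l, removeRow A i k l * u l = A k l * u l - if l = i then A k i * u i else 0 := by
      intro l
      by_cases hl : l = i
      · subst hl; simp [removeRow]
      · simp [removeRow, hl, hk]
    have h2 : star (A i k) = A k i := hA.apply k i
    simp only [Matrix.mulVec, dotProduct, h1, Finset.sum_sub_distrib, Finset.sum_ite_eq',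
      Finset.mem_univ, if_true, h2]
    ring

/-- Zeroing the row and column, instead of deleting them, keeps the size `n`; the index `i`
decouples and carries the scalar block `-iη`. -/
theorem resolvent_removeRow_col {n : ℕ} {η : ℝ} (hη : 0 < η) {A : Matrix (Fin n) (Fin n) ℂ}
    (hA : A.IsHermitian) (i : Fin n) :
    (resolvent η (removeRow A i)).mulVec (Pi.single i (-(η * Complex.I))) = Pi.single i 1 := by
  refine (eq_resolvent_mulVec hη (isHermitian_removeRow hA i) ?_).symm
  ext k
  rw [shifted_removeRow_mulVec η hA]
  by_cases hk : k = i
  · subst hk; simp [offRow]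
  · simp [hk, shifted, offRow, hA.apply k i]

/-- Rank-two perturbation formula: apply the shifted reduced matrix to a column of the full
resolvent and invert. For `j = i` it yields the Schur complement, for `k = j ≠ i` the price of
replacing the reduced diagonal entry by the full one. -/
theorem resolvent_col_eq {n : ℕ} {η : ℝ} (hη : 0 < η) {A : Matrix (Fin n) (Fin n) ℂ}
    (hA : A.IsHermitian) (i j k : Fin n) :
    resolvent η A k j = (if j = i then 0 else resolvent η (removeRow A i) k j)
      - resolvent η A i j *
        (resolvent η (removeRow A i)).mulVec (fun l => star (offRow A i l)) k
      + if k = i then resolvent η A i j else 0 := by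
  have h : (shifted η (removeRow A i)).mulVec (fun k => resolvent η A k j)
      = (if j = i then 0 else Pi.single j 1) - resolvent η A i j • (fun l => star (offRow A i l))
        + resolvent η A i j • Pi.single i (-(η * Complex.I)) := by
    ext k
    rw [shifted_removeRow_mulVec η hA, shifted_mulVec_resolvent_col hη hA]
    by_cases hj : j = i <;> by_cases hk : k = i
    · simp [hj, hk]; ring
    · simp [hj, hk]
    · subst hk; simp [hj, Ne.symm hj]; ring
    · simp [hj, hk]
  have h2 := congrFun (eq_resolvent_mulVec hη (isHermitian_removeRow hA i) h) k
  rw [Matrix.mulVec_add, Matrix.mulVec_sub, Matrix.mulVec_smul, Matrix.mulVec_smul,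
    resolvent_removeRow_col hη hA] at h2
  simp only [Pi.add_apply, Pi.sub_apply, Pi.smul_apply, smul_eq_mul] at h2
  rw [h2]
  by_cases hj : j = i <;> by_cases hk : k = i <;> simp [hj, hk]

/-- The quadratic form `∑ⱼₖ xⱼ Rⱼₖ x̄ₖ` of the resolvent `R` without the `i`-th row in the `i`-th row
`x`. -/
noncomputable def schurForm {n : ℕ} (η : ℝ) (A : Matrix (Fin n) (Fin n) ℂ) (i : Fin n) : ℂ :=
  ∑ j, offRow A i j *
    (resolvent η (removeRow A i)).mulVec (fun l => star (offRow A i l)) j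

theorem resolvent_apply_self_mul {n : ℕ} {η : ℝ} (hη : 0 < η) {A : Matrix (Fin n) (Fin n) ℂ}
    (hA : A.IsHermitian) (i : Fin n) :
    resolvent η A i i * (A i i - η * Complex.I - schurForm η A i) = 1 := by
  have h := congrFun (shifted_mulVec_resolvent_col hη hA i) i
  simp only [shifted, Matrix.sub_mulVec, Matrix.smul_mulVec, Matrix.one_mulVec, Pi.sub_apply,
    Pi.smul_apply, smul_eq_mul, Pi.single_eq_same] at h
  have h1 : ∀ j, A i j * resolvent η A j i = (if j = i then A i i * resolvent η A i i else 0)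
      - resolvent η A i i * (offRow A i j *
        (resolvent η (removeRow A i)).mulVec (fun l => star (offRow A i l)) j) := by
    intro j
    by_cases hj : j = i
    · subst hj; simp [offRow]
    · rw [resolvent_col_eq hη hA i i j]
      simp [hj, offRow]
      ring
  have h2 : (A.mulVec fun j => resolvent η A j i) i
      = A i i * resolvent η A i i - resolvent η A i i * schurForm η A i := by
    rw [show (A.mulVec fun j => resolvent η A j i) i = ∑ j, A i j * resolvent η A j i from rfl,
      Finset.sum_congr rfl fun j _ => h1 j, Finset.sum_sub_distrib, Finset.sum_ite_eq', if_pos (Finset.mem_univ _),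
      ← Finset.mul_sum, schurForm]
  rw [h2] at h
  linear_combination h

/-- The error in the self-consistent equation for the normalized resolvent. -/
noncomputable def selfConsistencyError {n : ℕ} (η : ℝ) (A : Matrix (Fin n) (Fin n) ℂ)
    (σ : Fin n → ℝ) (i : Fin n) : ℂ :=
  1 - diagResolvent η A i
    - (η ^ 2)⁻¹ * diagResolvent η A i * ∑ j, σ j * diagResolvent η A j

/-- Inserting the Schur formula isolates four errors: the diagonal entry, the fluctuation of the
quadratic form, the passage from the reduced to the full resolvent, and the missing term `j = i`. -/
theorem selfConsistencyError_eq {n : ℕ} {η : ℝ} (hη : 0 < η) {A : Matrix (Fin n) (Fin n) ℂ}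
    (hA : A.IsHermitian) (σ : Fin n → ℝ) (i : Fin n) :
    selfConsistencyError η A σ i = resolvent η A i i *
      (A i i - (schurForm η A i - ∑ j, (if j = i then 0 else (σ j : ℂ)) *
          resolvent η (removeRow A i) j j)
        - ∑ j, (if j = i then 0 else (σ j : ℂ)) * (resolvent η A i j *
          (resolvent η (removeRow A i)).mulVec (fun l => star (offRow A i l)) j)
        + σ i * resolvent η A i i) := by
  have hη' : (η : ℂ) ≠ 0 := by exact_mod_cast hη.ne'
  have h1 : ∑ j, (σ j : ℂ) * resolvent η A j j
      = ∑ j, (if j = i then 0 else (σ j : ℂ)) * resolvent η (removeRow A i) j j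
        - ∑ j, (if j = i then 0 else (σ j : ℂ)) * (resolvent η A i j *
          (resolvent η (removeRow A i)).mulVec (fun l => star (offRow A i l)) j)
        + σ i * resolvent η A i i := by
    have : (σ i : ℂ) * resolvent η A i i
        = ∑ j, if j = i then (σ i : ℂ) * resolvent η A i i else 0 := by simp
    rw [this, ← Finset.sum_sub_distrib, ← Finset.sum_add_distrib]
    refine Finset.sum_congr rfl fun j _ => ?_
    by_cases hj : j = i
    · subst hj; simp
    · rw [resolvent_col_eq hη hA i j j]
      simp [hj]
      ring
  have h2 := resolvent_apply_self_mul hη hA i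
  have h3 : selfConsistencyError η A σ i = 1 + η * Complex.I * resolvent η A i i
      + resolvent η A i i * ∑ j, (σ j : ℂ) * resolvent η A j j := by
    have : ∑ j, (σ j : ℂ) * diagResolvent η A j
        = -(η * Complex.I) * ∑ j, (σ j : ℂ) * resolvent η A j j := by
      rw [Finset.mul_sum]
      exact Finset.sum_congr rfl fun j _ => by rw [diagResolvent]; ring
    rw [selfConsistencyError, this, diagResolvent]
    push_cast
    field_simp
    linear_combination (-(resolvent η A i i * ∑ j, (σ j : ℂ) * resolvent η A j j)) * Complex.I_sq
  rw [h3, h1]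
  linear_combination -h2

/-- For `η ≥ 1` the resolvents are contractions. Hence row `i` of `G` has `ℓ²` norm at most 1, and
the reduced resolvent applied to the row of `A` does not exceed that row; the cross sum is bounded
by `|uv| ≤ |u|² + |v|²`. Only the fluctuation of the quadratic form is left to probability. -/
theorem norm_selfConsistencyError_le {n : ℕ} {η : ℝ} (hη : 1 ≤ η) {A : Matrix (Fin n) (Fin n) ℂ}
    (hA : A.IsHermitian) {σ : Fin n → ℝ} {δ : ℝ} (hσ0 : ∀ j, 0 ≤ σ j) (hσ : ∀ j, σ j ≤ δ)
    (i : Fin n) :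
    ‖selfConsistencyError η A σ i‖ ≤ ‖A i i‖
      + ‖schurForm η A i - ∑ j, (if j = i then 0 else (σ j : ℂ)) *
          resolvent η (removeRow A i) j j‖
      + δ * (1 + ∑ j, ‖A i j‖ ^ 2) + δ := by
  have hη0 : 0 < η := by linarith
  have hδ : 0 ≤ δ := (hσ0 i).trans (hσ i)
  have hsq : ∀ t : ℝ, 0 ≤ t → t ≤ η ^ 2 * t := fun t ht => by
    nlinarith [mul_nonneg (sub_nonneg.mpr hη) ht, mul_nonneg (mul_nonneg (sub_nonneg.mpr hη)
      (sub_nonneg.mpr hη)) ht]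
  have hG : ‖resolvent η A i i‖ ≤ 1 := by
    have := norm_resolvent_apply_le hη0 hA i i
    nlinarith [norm_nonneg (resolvent η A i i)]
  set y := (resolvent η (removeRow A i)).mulVec (fun l => star (offRow A i l)) with hy
  have h1 : ∑ j, ‖resolvent η A i j‖ ^ 2 ≤ 1 :=
    (hsq _ (Finset.sum_nonneg fun _ _ => by positivity)).trans
      (sum_norm_sq_resolvent_row_le hη0 hA i)
  have h2 : ∑ j, ‖y j‖ ^ 2 ≤ ∑ j, ‖A i j‖ ^ 2 := by
    refine (hsq _ (Finset.sum_nonneg fun _ _ => by positivity)).trans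
      ((sum_norm_sq_resolvent_mulVec_le hη0 (isHermitian_removeRow hA i) _).trans ?_)
    refine Finset.sum_le_sum fun j _ => ?_
    rw [norm_star, offRow]
    split_ifs
    · simp
    · rfl
  have h3 : ‖∑ j, (if j = i then 0 else (σ j : ℂ)) * (resolvent η A i j * y j)‖
      ≤ δ * (1 + ∑ j, ‖A i j‖ ^ 2) := by
    calc _ ≤ ∑ j, δ * (‖resolvent η A i j‖ ^ 2 + ‖y j‖ ^ 2) := by
          refine norm_sum_le_of_le _ fun j _ => ?_
          rw [norm_mul, norm_mul]
          have : ‖(if j = i then 0 else (σ j : ℂ))‖ ≤ δ := by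
            split_ifs
            · simpa using hδ
            · simpa [abs_of_nonneg (hσ0 j)] using hσ j
          refine mul_le_mul this ?_ (by positivity) hδ
          nlinarith [sq_nonneg (‖resolvent η A i j‖ - ‖y j‖), sq_nonneg (‖resolvent η A i j‖),
            sq_nonneg ‖y j‖]
      _ ≤ _ := by
          rw [← Finset.mul_sum, Finset.sum_add_distrib]
          exact mul_le_mul_of_nonneg_left (add_le_add h1 h2) hδ
  have h4 : ‖(σ i : ℂ) * resolvent η A i i‖ ≤ δ := by
    rw [norm_mul, Complex.norm_real, Real.norm_of_nonneg (hσ0 i)]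
    nlinarith [norm_nonneg (resolvent η A i i), hσ0 i, hσ i]
  rw [selfConsistencyError_eq hη0 hA, norm_mul]
  refine (mul_le_of_le_one_left (norm_nonneg _) hG).trans ?_
  refine (norm_add_le _ _).trans (add_le_add ((norm_sub_le _ _).trans (add_le_add
    (norm_sub_le _ _) h3)) h4)

/-! ### Second moments of quadratic forms by orthogonality. -/

section Orthogonality

variable {Ω : Type*} {mΩ : MeasurableSpace Ω} {P : Measure Ω}

theorem memLp_top_mul {f g : Ω → ℂ} (hf : MemLp f ⊤ P) (hg : MemLp g ⊤ P) :
    MemLp (fun ω => f ω * g ω) ⊤ P :=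
  hg.mul hf

theorem memLp_top_of_norm_le {f : Ω → ℂ} (hf : Measurable f) {C : ℝ} (h : ∀ᵐ ω ∂P, ‖f ω‖ ≤ C) :
    MemLp f ⊤ P :=
  memLp_top_of_bound hf.aestronglyMeasurable C h

theorem integral_mul_eq_zero_of_indep {m' : MeasurableSpace Ω} (hm : m' ≤ mΩ) {x Y : Ω → ℂ}
    (hx : Measurable[mΩ] x) (hind : Indep (MeasurableSpace.comap x inferInstance) m' P)
    (hx0 : ∫ ω, x ω ∂P = 0) (hY : Measurable[m'] Y) : ∫ ω, x ω * Y ω ∂P = 0 := by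
  have h : IndepFun x Y P :=
    (IndepFun_iff_Indep _ _ _).mpr (indep_of_indep_of_le_right hind hY.comap_le)
  rw [h.integral_fun_mul_eq_mul_integral hx.aestronglyMeasurable
    (hY.mono hm le_rfl).aestronglyMeasurable, hx0, zero_mul]

variable [IsProbabilityMeasure P]

theorem integrable_of_memLp_top {E : Type*} [NormedAddCommGroup E] {f : Ω → E}
    (hf : MemLp f ⊤ P) : Integrable f P :=
  memLp_one_iff_integrable.mp (hf.mono_exponent le_top)

theorem integrable_norm_sq_of_memLp_top {f : Ω → ℂ} (hf : MemLp f ⊤ P) :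
    Integrable (fun ω => ‖f ω‖ ^ 2) P :=
  (hf.mono_exponent (p := 2) le_top).integrable_norm_pow (by norm_num)

theorem integral_norm_sq_sum_of_orthogonal {ι : Type*} [LinearOrder ι] (s : Finset ι)
    {Z : ι → Ω → ℂ} (hZ : ∀ k, MemLp (Z k) ⊤ P)
    (horth : ∀ k l, k < l → ∫ ω, Z l ω * star (Z k ω) ∂P = 0) :
    ∫ ω, ‖∑ k ∈ s, Z k ω‖ ^ 2 ∂P = ∑ k ∈ s, ∫ ω, ‖Z k ω‖ ^ 2 ∂P := by
  have hI : ∀ k l, Integrable (fun ω => Z l ω * star (Z k ω)) P := fun k l =>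
    integrable_of_memLp_top (memLp_top_mul (hZ l) (hZ k).star)
  have h0 : ∀ k l, k ≠ l → ∫ ω, Z l ω * star (Z k ω) ∂P = 0 := by
    intro k l hkl
    rcases lt_or_gt_of_ne hkl with h | h
    · exact horth k l h
    · have h1 := congrArg star (horth l k h)
      rw [star_zero] at h1
      rw [← h1, RCLike.star_def, ← integral_conj]
      refine integral_congr_ae (ae_of_all _ fun ω => ?_)
      simp [mul_comm]
  have hn : ∀ z : ℂ, ((‖z‖ ^ 2 : ℝ) : ℂ) = z * star z := fun z => by
    simp [Complex.mul_conj']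
  apply Complex.ofReal_injective
  rw [← integral_complex_ofReal, Complex.ofReal_sum]
  simp only [← integral_complex_ofReal, hn, star_sum, Finset.sum_mul_sum]
  rw [integral_finsetSum _ fun l _ => integrable_finsetSum _ fun k _ => hI k l]
  refine Finset.sum_congr rfl fun l hl => ?_
  rw [integral_finsetSum _ fun k _ => hI k l]
  exact Finset.sum_eq_single_of_mem l hl fun k _ hk => h0 k l hk

variable {n : ℕ} {ε : ℝ} {m' : Fin n → MeasurableSpace Ω} {R : Fin n → Fin n → Ω → ℂ}

/-- The largest index `k` occurs only in the factor `y k`, which integrates to zero against anything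
`m' k`-measurable, so the terms are orthogonal; the inner sums are orthogonal for the same reason.
Bounding `|y k|` by `ε` instead of using its variance lets the sum over `k` be absorbed by the `ℓ²`
norm of a row of `R`. -/
theorem integral_norm_sq_triangular_le {x y : Fin n → Ω → ℂ} (hm : ∀ k, m' k ≤ mΩ)
    (hx : ∀ k, Measurable (x k)) (hy : ∀ k, Measurable (y k))
    (hxε : ∀ k, ∀ᵐ ω ∂P, ‖x k ω‖ ≤ ε) (hyε : ∀ k, ∀ᵐ ω ∂P, ‖y k ω‖ ≤ ε)
    (hxm : ∀ k j, j ≠ k → Measurable[m' k] (x j)) (hym : ∀ k j, j ≠ k → Measurable[m' k] (y j))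
    (hx0 : ∀ k (Y : Ω → ℂ), Measurable[m' k] Y → ∫ ω, x k ω * Y ω ∂P = 0)
    (hy0 : ∀ k (Y : Ω → ℂ), Measurable[m' k] Y → ∫ ω, y k ω * Y ω ∂P = 0)
    (hRm : ∀ k i j, Measurable[m' k] (R i j)) (hR : ∀ ω i, ∑ j, ‖R i j ω‖ ^ 2 ≤ 1) :
    ∫ ω, ‖∑ k, y k ω * ∑ j ∈ Finset.Iio k, x j ω * R j k ω‖ ^ 2 ∂P
      ≤ ε ^ 2 * ∑ j, ∫ ω, ‖x j ω‖ ^ 2 ∂P := by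
  have hRM : ∀ i j, Measurable (R i j) := fun i j => (hRm i i j).mono (hm i) le_rfl
  have hR1 : ∀ i j ω, ‖R i j ω‖ ≤ 1 := fun i j ω => by
    have : ‖R i j ω‖ ^ 2 ≤ ∑ j, ‖R i j ω‖ ^ 2 :=
      Finset.single_le_sum (f := fun j => ‖R i j ω‖ ^ 2) (fun _ _ => by positivity)
        (Finset.mem_univ j)
    exact (sq_le_one_iff₀ (norm_nonneg _)).mp (this.trans (hR ω i))
  have hxL : ∀ k, MemLp (x k) ⊤ P := fun k => memLp_top_of_norm_le (hx k) (hxε k)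
  have hyL : ∀ k, MemLp (y k) ⊤ P := fun k => memLp_top_of_norm_le (hy k) (hyε k)
  have hRL : ∀ i j, MemLp (R i j) ⊤ P := fun i j =>
    memLp_top_of_norm_le (hRM i j) (ae_of_all _ (hR1 i j))
  have hxRL : ∀ j k, MemLp (fun ω => x j ω * R j k ω) ⊤ P := fun j k =>
    memLp_top_mul (hxL j) (hRL j k)
  have hVL : ∀ k, MemLp (fun ω => ∑ j ∈ Finset.Iio k, x j ω * R j k ω) ⊤ P := fun k =>
    memLp_finsetSum _ fun j _ => hxRL j k
  have hVm : ∀ l k, k ≤ l → Measurable[m' l] (fun ω => ∑ j ∈ Finset.Iio k, x j ω * R j k ω) := by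
    intro l k hkl
    refine Finset.measurable_fun_sum _ fun j hj => ?_
    exact (hxm l j ((Finset.mem_Iio.mp hj).trans_le hkl).ne).mul (hRm l j k)
  have hstar : ∀ l (Y : Ω → ℂ), Measurable[m' l] Y → Measurable[m' l] (fun ω => star (Y ω)) :=
    fun l Y hY => continuous_star.measurable.comp hY
  rw [integral_norm_sq_sum_of_orthogonal Finset.univ (fun k => memLp_top_mul (hyL k) (hVL k))]
  swap
  · intro k l hkl
    simp only [mul_assoc]
    exact hy0 l _ ((hVm l l le_rfl).mul (hstar l _ ((hym l k hkl.ne).mul (hVm l k hkl.le))))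
  have h1 : ∀ k, ∫ ω, ‖y k ω * ∑ j ∈ Finset.Iio k, x j ω * R j k ω‖ ^ 2 ∂P
      ≤ ε ^ 2 * ∑ j ∈ Finset.Iio k, ∫ ω, ‖x j ω * R j k ω‖ ^ 2 ∂P := by
    intro k
    rw [← integral_norm_sq_sum_of_orthogonal (Finset.Iio k) (fun j => hxRL j k),
      ← integral_const_mul]
    · refine integral_mono_ae (integrable_norm_sq_of_memLp_top (memLp_top_mul (hyL k) (hVL k)))
        ((integrable_norm_sq_of_memLp_top (hVL k)).const_mul _) ?_
      filter_upwards [hyε k] with ω hω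
      simp only [norm_mul, mul_pow]
      gcongr
    · intro j l hjl
      simp only [mul_assoc]
      exact hx0 l _ ((hRm l l k).mul (hstar l _ ((hxm l j hjl.ne).mul (hRm l j k))))
  refine (Finset.sum_le_sum fun k _ => h1 k).trans ?_
  rw [← Finset.mul_sum]
  refine mul_le_mul_of_nonneg_left ?_ (sq_nonneg ε)
  calc ∑ k, ∑ j ∈ Finset.Iio k, ∫ ω, ‖x j ω * R j k ω‖ ^ 2 ∂P
      ≤ ∑ k, ∑ j, ∫ ω, ‖x j ω * R j k ω‖ ^ 2 ∂P :=
        Finset.sum_le_sum fun k _ => Finset.sum_le_sum_of_subset_of_nonneg (Finset.subset_univ _)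
          fun j _ _ => integral_nonneg fun ω => by positivity
    _ = ∑ j, ∫ ω, ∑ k, ‖x j ω * R j k ω‖ ^ 2 ∂P := by
        rw [Finset.sum_comm]
        exact Finset.sum_congr rfl fun j _ =>
          (integral_finsetSum _ fun k _ => integrable_norm_sq_of_memLp_top (hxRL j k)).symm
    _ ≤ _ := by
        refine Finset.sum_le_sum fun j _ => integral_mono
          (integrable_finsetSum _ fun k _ => integrable_norm_sq_of_memLp_top (hxRL j k))
          (integrable_norm_sq_of_memLp_top (hxL j)) fun ω => ?_
        simp only [norm_mul, mul_pow, ← Finset.mul_sum]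
        exact mul_le_of_le_one_right (by positivity) (hR ω j)

/-- The centred squares are independent of everything else they meet, hence orthogonal. The variance
of `|x k|²` is at most `E|x k|⁴`, and `|x k|⁴ ≤ ε²|x k|²`. -/
theorem integral_norm_sq_diagonal_le {x : Fin n → Ω → ℂ} (hm : ∀ k, m' k ≤ mΩ)
    (hx : ∀ k, Measurable (x k)) (hxε : ∀ k, ∀ᵐ ω ∂P, ‖x k ω‖ ≤ ε)
    (hxm : ∀ k j, j ≠ k → Measurable[m' k] (x j))
    (hind : ∀ k, Indep (MeasurableSpace.comap (x k) inferInstance) (m' k) P)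
    (hRm : ∀ k i j, Measurable[m' k] (R i j)) (hR : ∀ ω i, ‖R i i ω‖ ≤ 1) :
    ∫ ω, ‖∑ k, ((‖x k ω‖ ^ 2 - ∫ ω', ‖x k ω'‖ ^ 2 ∂P : ℝ) : ℂ) * R k k ω‖ ^ 2 ∂P
      ≤ ε ^ 2 * ∑ j, ∫ ω, ‖x j ω‖ ^ 2 ∂P := by
  have hxL : ∀ k, MemLp (x k) ⊤ P := fun k => memLp_top_of_norm_le (hx k) (hxε k)
  have hxI := fun k => integrable_norm_sq_of_memLp_top (hxL k)
  set τ : Fin n → ℝ := fun k => ∫ ω', ‖x k ω'‖ ^ 2 ∂P with hτ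
  let d : Fin n → Ω → ℂ := fun k ω => ((‖x k ω‖ ^ 2 - τ k : ℝ) : ℂ)
  have hφ : ∀ k, Measurable fun z : ℂ => ((‖z‖ ^ 2 - τ k : ℝ) : ℂ) := fun k =>
    (by fun_prop : Continuous fun z : ℂ => ((‖z‖ ^ 2 - τ k : ℝ) : ℂ)).measurable
  have hdM : ∀ k, Measurable (d k) := fun k => (hφ k).comp (hx k)
  have hdm : ∀ k j, j ≠ k → Measurable[m' k] (d j) := fun k j hjk => (hφ j).comp (hxm k j hjk)
  have hdL : ∀ k, MemLp (d k) ⊤ P := fun k => by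
    refine memLp_top_of_norm_le (C := ε ^ 2 + |τ k|) (hdM k) ?_
    filter_upwards [hxε k] with ω hω
    rw [Complex.norm_real, Real.norm_eq_abs]
    refine (abs_sub _ _).trans (add_le_add ?_ le_rfl)
    rw [abs_of_nonneg (by positivity)]
    gcongr
  have hd0 : ∀ k, ∫ ω, d k ω ∂P = 0 := fun k => by
    rw [integral_complex_ofReal, integral_sub (hxI k) (integrable_const _)]
    simp [hτ]
  have hdind : ∀ k, Indep (MeasurableSpace.comap (d k) inferInstance) (m' k) P := fun k =>
    indep_of_indep_of_le_left (hind k) (by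
      have : Measurable[MeasurableSpace.comap (x k) inferInstance] (d k) :=
        (hφ k).comp (comap_measurable (x k))
      exact this.comap_le)
  have hRM : ∀ i j, Measurable (R i j) := fun i j => (hRm i i j).mono (hm i) le_rfl
  have hRL : ∀ i, MemLp (R i i) ⊤ P := fun i =>
    memLp_top_of_norm_le (hRM i i) (ae_of_all _ fun ω => hR ω i)
  have h1 : ∀ k, ∫ ω, ‖d k ω * R k k ω‖ ^ 2 ∂P ≤ ε ^ 2 * τ k := by
    intro k
    calc ∫ ω, ‖d k ω * R k k ω‖ ^ 2 ∂P
        ≤ ∫ ω, (ε ^ 2 * ‖x k ω‖ ^ 2 - 2 * τ k * ‖x k ω‖ ^ 2 + τ k ^ 2) ∂P := by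
          refine integral_mono_ae
            (integrable_norm_sq_of_memLp_top (memLp_top_mul (hdL k) (hRL k)))
            ((((hxI k).const_mul _).sub ((hxI k).const_mul _)).add (integrable_const _)) ?_
          filter_upwards [hxε k] with ω hω
          have hR2 : ‖R k k ω‖ ^ 2 ≤ 1 := (sq_le_one_iff₀ (norm_nonneg _)).mpr (hR ω k)
          have hx2 : ‖x k ω‖ ^ 2 ≤ ε ^ 2 := by gcongr
          have hdn : ‖d k ω‖ ^ 2 = (‖x k ω‖ ^ 2 - τ k) ^ 2 := by
            rw [Complex.norm_real, Real.norm_eq_abs, sq_abs]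
          rw [norm_mul, mul_pow, hdn]
          refine (mul_le_of_le_one_right (sq_nonneg _) hR2).trans ?_
          nlinarith [sq_nonneg ‖x k ω‖]
      _ = ε ^ 2 * τ k - τ k ^ 2 := by
          rw [integral_add (f := fun ω => ε ^ 2 * ‖x k ω‖ ^ 2 - 2 * τ k * ‖x k ω‖ ^ 2)
              (((hxI k).const_mul _).sub ((hxI k).const_mul _)) (integrable_const _),
            integral_sub ((hxI k).const_mul _) ((hxI k).const_mul _), integral_const_mul,
            integral_const_mul, integral_const, probReal_univ, one_smul]
          change ε ^ 2 * τ k - 2 * τ k * τ k + τ k ^ 2 = _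
          ring
      _ ≤ ε ^ 2 * τ k := by linarith [sq_nonneg (τ k)]
  have h2 := integral_norm_sq_sum_of_orthogonal Finset.univ (P := P)
    (Z := fun k ω => d k ω * R k k ω) (fun k => memLp_top_mul (hdL k) (hRL k)) (by
      intro k l hkl
      simp only [mul_assoc]
      exact integral_mul_eq_zero_of_indep (hm l) (hdM l) (hdind l) (hd0 l)
        ((hRm l l l).mul (continuous_star.measurable.comp
          ((hdm l k hkl.ne).mul (hRm l k k)))))
  rw [h2, Finset.mul_sum]
  exact Finset.sum_le_sum fun k _ => h1 k

end Orthogonality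

/-! ### Measurability of the resolvent and independence of the entries. -/

theorem measurable_det {Ω : Type*} [MeasurableSpace Ω] {n : ℕ}
    {A : Ω → Matrix (Fin n) (Fin n) ℂ} (hA : ∀ i j, Measurable fun ω => A ω i j) :
    Measurable fun ω => (A ω).det := by
  simp only [Matrix.det_apply']
  exact Finset.measurable_fun_sum _ fun σ _ =>
    (Finset.measurable_fun_prod _ fun i _ => hA _ _).const_mul _

/-- The entries are quotients of determinants. The `σ`-algebra is arbitrary, so this also applies to
the one that omits a single entry of the matrix. -/
theorem measurable_resolvent {Ω : Type*} [MeasurableSpace Ω] {n : ℕ}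
    {A : Ω → Matrix (Fin n) (Fin n) ℂ} (hA : ∀ i j, Measurable fun ω => A ω i j) (η : ℝ)
    (i j : Fin n) : Measurable fun ω => resolvent η (A ω) i j := by
  have hS : ∀ i j, Measurable fun ω => shifted η (A ω) i j := fun i j => by
    simp only [shifted, Matrix.sub_apply]
    exact (hA i j).sub_const _
  simp only [resolvent, Matrix.inv_def, Ring.inverse_eq_inv', Matrix.smul_apply, smul_eq_mul,
    Matrix.adjugate_apply]
  refine (measurable_det hS).inv.mul (measurable_det fun k l => ?_)
  simp only [Matrix.updateRow_apply]
  split_ifs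
  · exact measurable_const
  · exact hS k l

/-- The position on or above the diagonal that carries the `(i, j)` entry of a Hermitian matrix. -/
def upperIndex {n : ℕ} (i j : Fin n) : {p : Fin n × Fin n // p.1 ≤ p.2} :=
  ⟨(min i j, max i j), min_le_max⟩

theorem upperIndex_ne {n : ℕ} {i j k : Fin n} (h : j ≠ k) : upperIndex i j ≠ upperIndex i k := by
  intro he
  simp only [upperIndex, Subtype.mk.injEq, Prod.mk.injEq] at he
  apply h
  have h1 := he.1
  have h2 := he.2
  rcases le_total i j with hj | hj <;> rcases le_total i k with hk | hk <;>
    simp_all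

theorem upperIndex_ne_of_ne {n : ℕ} {i p q k : Fin n} (hp : p ≠ i) (hq : q ≠ i) :
    upperIndex p q ≠ upperIndex i k := by
  intro he
  simp only [upperIndex, Subtype.mk.injEq, Prod.mk.injEq] at he
  have h1 := he.1
  have h2 := he.2
  rcases le_total p q with hj | hj <;> rcases le_total i k with hk | hk <;>
    simp_all

section

variable {Ω : Type*} [mΩ : MeasurableSpace Ω] {n : ℕ} (X : Ω → Matrix (Fin n) (Fin n) ℂ)

/-- The `σ`-algebra generated by the entries of `X` off the positions `(i, k)` and `(k, i)`. -/
noncomputable abbrev sigmaOff (i k : Fin n) : MeasurableSpace Ω :=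
  ⨆ a ∈ ({upperIndex i k}ᶜ : Set {p : Fin n × Fin n // p.1 ≤ p.2}),
    MeasurableSpace.comap (fun ω => X ω a.1.1 a.1.2) inferInstance

variable {X}

omit mΩ in
theorem measurable_comap_upperIndex (hH : ∀ ω, (X ω).IsHermitian) (i j : Fin n) :
    Measurable[MeasurableSpace.comap (fun ω => X ω (upperIndex i j).1.1 (upperIndex i j).1.2)
      inferInstance] (fun ω => X ω i j) := by
  rcases le_total i j with h | h
  · have h0 : (upperIndex i j).1 = (i, j) := by simp [upperIndex, h]
    rw [h0]
    exact comap_measurable (fun ω => X ω i j)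
  · have h1 : (fun ω => X ω i j) = fun ω => star (X ω j i) :=
      funext fun ω => ((hH ω).apply i j).symm
    have h0 : (upperIndex i j).1 = (j, i) := by simp [upperIndex, h]
    rw [h0, h1]
    exact continuous_star.measurable.comp (comap_measurable (fun ω => X ω j i))

omit mΩ in
theorem measurable_sigmaOff (hH : ∀ ω, (X ω).IsHermitian) {i k p q : Fin n}
    (h : upperIndex p q ≠ upperIndex i k) : Measurable[sigmaOff X i k] (fun ω => X ω p q) :=
  (measurable_comap_upperIndex hH p q).mono
    (le_iSup₂_of_le (f := fun a (_ : a ∈ ({upperIndex i k}ᶜ : Set _)) =>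
      MeasurableSpace.comap (fun ω => X ω a.1.1 a.1.2) inferInstance) (upperIndex p q) h le_rfl)
    le_rfl

theorem sigmaOff_le (hX : ∀ i j, Measurable fun ω => X ω i j) (i k : Fin n) :
    sigmaOff X i k ≤ mΩ :=
  iSup₂_le fun a _ => (hX a.1.1 a.1.2).comap_le

omit mΩ in
theorem measurable_offRow {m : MeasurableSpace Ω} {i j : Fin n}
    (h : j ≠ i → Measurable[m] fun ω => X ω i j) : Measurable[m] fun ω => offRow (X ω) i j := by
  unfold offRow
  split_ifs with hj
  · exact measurable_const
  · exact h hj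

omit mΩ in
theorem measurable_removeRow_resolvent {m : MeasurableSpace Ω} {i : Fin n}
    (h : ∀ p q, p ≠ i → q ≠ i → Measurable[m] fun ω => X ω p q) (η : ℝ) (j k : Fin n) :
    Measurable[m] fun ω => resolvent η (removeRow (X ω) i) j k := by
  refine @measurable_resolvent _ m _ _ (fun p q => ?_) η j k
  simp only [removeRow, Matrix.of_apply]
  split_ifs with hpq
  · exact measurable_const
  · exact h p q (fun h => hpq (Or.inl h)) (fun h => hpq (Or.inr h))

variable {P : Measure Ω}

theorem indep_offRow_sigmaOff (hX : ∀ i j, Measurable fun ω => X ω i j)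
    (hH : ∀ ω, (X ω).IsHermitian)
    (hind : iIndepFun (fun (p : {p : Fin n × Fin n // p.1 ≤ p.2}) ω => X ω p.1.1 p.1.2) P)
    (i k : Fin n) :
    Indep (MeasurableSpace.comap (fun ω => offRow (X ω) i k) inferInstance) (sigmaOff X i k) P := by
  have h := indep_iSup_of_disjoint (fun a => (hX a.1.1 a.1.2).comap_le)
    ((iIndepFun_iff_iIndep _ _ _).mp hind)
    (S := {upperIndex i k}) (T := {upperIndex i k}ᶜ) disjoint_compl_right
  refine indep_of_indep_of_le_left h ?_
  simp only [Set.mem_singleton_iff, iSup_iSup_eq_left]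
  exact (measurable_offRow fun _ => measurable_comap_upperIndex hH i k).comap_le

/-- In each off-diagonal part the larger index is pulled out in front, the form needed for
orthogonality. -/
theorem schurForm_eq (η : ℝ) (A : Matrix (Fin n) (Fin n) ℂ) (i : Fin n) :
    schurForm η A i
      = (∑ k, star (offRow A i k) * ∑ j ∈ Finset.Iio k,
          offRow A i j * resolvent η (removeRow A i) j k)
      + (∑ k, offRow A i k * ∑ j ∈ Finset.Iio k,
          star (offRow A i j) * resolvent η (removeRow A i) k j)
      + ∑ k, ((‖offRow A i k‖ ^ 2 : ℝ) : ℂ) * resolvent η (removeRow A i) k k := by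
  set x := offRow A i
  set R := resolvent η (removeRow A i)
  have h1 : schurForm η A i = ∑ k, ∑ j, x j * R j k * star (x k) := by
    rw [schurForm, Finset.sum_comm]
    simp only [Matrix.mulVec, dotProduct, Finset.mul_sum, mul_assoc]
    rfl
  have h2 : ∀ k j, x j * R j k * star (x k)
      = (if j < k then x j * R j k * star (x k) else 0)
        + (if k < j then x j * R j k * star (x k) else 0)
        + (if j = k then x j * R j k * star (x k) else 0) := by
    intro k j
    rcases lt_trichotomy j k with h | h | h
    · simp [h, h.not_gt, h.ne]
    · simp [h]
    · simp [h, h.not_gt, h.ne']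
  rw [h1, Finset.sum_congr rfl fun k _ => Finset.sum_congr rfl fun j _ => h2 k j]
  simp only [Finset.sum_add_distrib]
  congr 1
  · congr 1
    · refine Finset.sum_congr rfl fun k _ => ?_
      rw [← Finset.sum_filter, Finset.filter_gt_eq_Iio, Finset.mul_sum]
      exact Finset.sum_congr rfl fun j _ => by ring
    · rw [Finset.sum_comm]
      refine Finset.sum_congr rfl fun k _ => ?_
      rw [← Finset.sum_filter, Finset.filter_gt_eq_Iio, Finset.mul_sum]
      exact Finset.sum_congr rfl fun j _ => by ring
  · refine Finset.sum_congr rfl fun k _ => ?_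
    rw [Finset.sum_ite_eq', if_pos (Finset.mem_univ k), Complex.ofReal_pow, ← Complex.mul_conj',
      RCLike.star_def]
    ring

theorem norm_add_three_sq_le (a b c : ℂ) :
    ‖a + b + c‖ ^ 2 ≤ 3 * (‖a‖ ^ 2 + ‖b‖ ^ 2 + ‖c‖ ^ 2) := by
  have h : ‖a + b + c‖ ≤ ‖a‖ + ‖b‖ + ‖c‖ := norm_add₃_le
  nlinarith [norm_nonneg (a + b + c), sq_nonneg (‖a‖ - ‖b‖), sq_nonneg (‖a‖ - ‖c‖),
    sq_nonneg (‖b‖ - ‖c‖)]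

theorem rowSum_nonneg (i : Fin n) : 0 ≤ rowSum P X i :=
  Finset.sum_nonneg fun _ _ => integral_nonneg fun _ => by positivity

end

/-! ### The mean error of the self-consistent equation. -/

section

variable {Ω : Type*} [mΩ : MeasurableSpace Ω] {P : Measure Ω} [IsProbabilityMeasure P]
  {n : ℕ} {X : Ω → Matrix (Fin n) (Fin n) ℂ}

theorem integral_norm_sq_le_sq {f : Ω → ℂ} {ε : ℝ} (hf : Measurable f)
    (h : ∀ᵐ ω ∂P, ‖f ω‖ ≤ ε) : ∫ ω, ‖f ω‖ ^ 2 ∂P ≤ ε ^ 2 := by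
  have h1 : ∫ ω, ‖f ω‖ ^ 2 ∂P ≤ ∫ _, ε ^ 2 ∂P := by
    refine integral_mono_ae (integrable_norm_sq_of_memLp_top (memLp_top_of_norm_le hf h))
      (integrable_const _) ?_
    filter_upwards [h] with ω hω
    gcongr
  simpa using h1

/-- The reduced resolvent does not involve row `i`, so it is measurable with respect to all entries
except any one entry of that row. Lower, upper and diagonal parts each contribute `ε²` times the row
sum; the 9 is `3 · 3`, from three parts and the convexity bound for a sum of three terms. -/
theorem integral_norm_sq_schurForm_sub_le (hX : ∀ i j, Measurable fun ω => X ω i j)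
    (hH : ∀ ω, (X ω).IsHermitian)
    (hind : iIndepFun (fun (p : {p : Fin n × Fin n // p.1 ≤ p.2}) ω => X ω p.1.1 p.1.2) P)
    {ε : ℝ} (hε : 0 ≤ ε) (hmean : ∀ i j, ∫ ω, X ω i j ∂P = 0)
    (hbdd : ∀ i j, ∀ᵐ ω ∂P, ‖X ω i j‖ ≤ ε) {η : ℝ} (hη : 1 ≤ η) (i : Fin n) :
    Integrable (fun ω => ‖schurForm η (X ω) i -
        ∑ j, (if j = i then 0 else ((∫ ω', ‖X ω' i j‖ ^ 2 ∂P : ℝ) : ℂ)) *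
          resolvent η (removeRow (X ω) i) j j‖ ^ 2) P ∧
    ∫ ω, ‖schurForm η (X ω) i -
        ∑ j, (if j = i then 0 else ((∫ ω', ‖X ω' i j‖ ^ 2 ∂P : ℝ) : ℂ)) *
          resolvent η (removeRow (X ω) i) j j‖ ^ 2 ∂P ≤ 9 * ε ^ 2 * rowSum P X i := by
  have hη0 : 0 < η := by linarith
  set x : Fin n → Ω → ℂ := fun j ω => offRow (X ω) i j with hxdef
  set R : Fin n → Fin n → Ω → ℂ := fun j k ω => resolvent η (removeRow (X ω) i) j k with hRdef
  have hxM : ∀ j, Measurable (x j) := fun j => measurable_offRow fun _ => hX i j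
  have hRM : ∀ j k, Measurable (R j k) := fun j k =>
    measurable_removeRow_resolvent (fun p q _ _ => hX p q) η j k
  have hxε : ∀ j, ∀ᵐ ω ∂P, ‖x j ω‖ ≤ ε := fun j => by
    filter_upwards [hbdd i j] with ω hω
    simp only [hxdef, offRow]
    split_ifs
    · simpa using hε
    · exact hω
  have hm := fun k => sigmaOff_le hX i k
  have hxm : ∀ k j, j ≠ k → Measurable[sigmaOff X i k] (x j) := fun k j hjk =>
    measurable_offRow fun _ => measurable_sigmaOff hH (upperIndex_ne hjk)
  have hRm : ∀ k p q, Measurable[sigmaOff X i k] (R p q) := fun k p q =>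
    measurable_removeRow_resolvent (fun a b ha hb =>
      measurable_sigmaOff hH (upperIndex_ne_of_ne ha hb)) η p q
  have hxind := fun k => indep_offRow_sigmaOff hX hH hind i k
  have hxmean : ∀ k, ∫ ω, x k ω ∂P = 0 := fun k => by
    simp only [hxdef, offRow]
    split_ifs
    · simp
    · exact hmean i k
  have hx0 : ∀ k (Y : Ω → ℂ), Measurable[sigmaOff X i k] Y → ∫ ω, x k ω * Y ω ∂P = 0 :=
    fun k Y hY => integral_mul_eq_zero_of_indep (hm k) (hxM k) (hxind k) (hxmean k) hY
  have hsM : ∀ j, Measurable fun ω => star (x j ω) := fun j =>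
    continuous_star.measurable.comp (hxM j)
  have hsε : ∀ j, ∀ᵐ ω ∂P, ‖star (x j ω)‖ ≤ ε := fun j => by simpa only [norm_star] using hxε j
  have hsm : ∀ k j, j ≠ k → Measurable[sigmaOff X i k] fun ω => star (x j ω) := fun k j hjk =>
    continuous_star.measurable.comp (hxm k j hjk)
  have hsmean : ∀ k, ∫ ω, star (x k ω) ∂P = 0 := fun k => by
    simp only [RCLike.star_def, integral_conj, hxmean k, map_zero]
  have hsind : ∀ k, Indep (MeasurableSpace.comap (fun ω => star (x k ω)) inferInstance)
      (sigmaOff X i k) P := fun k =>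
    indep_of_indep_of_le_left (hxind k)
      (continuous_star.measurable.comp (comap_measurable (x k))).comap_le
  have hs0 : ∀ k (Y : Ω → ℂ), Measurable[sigmaOff X i k] Y → ∫ ω, star (x k ω) * Y ω ∂P = 0 :=
    fun k Y hY => integral_mul_eq_zero_of_indep (hm k) (hsM k) (hsind k) (hsmean k) hY
  have hle1 : ∀ t : ℝ, 0 ≤ t → η ^ 2 * t ≤ 1 → t ≤ 1 := fun t ht h => by
    nlinarith [mul_nonneg (mul_nonneg (sub_nonneg.mpr hη) (by linarith : 0 ≤ η + 1)) ht]
  have hrow : ∀ ω p, ∑ q, ‖R p q ω‖ ^ 2 ≤ 1 := fun ω p =>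
    hle1 _ (Finset.sum_nonneg fun _ _ => by positivity)
      (sum_norm_sq_resolvent_row_le hη0 (isHermitian_removeRow (hH ω) i) p)
  have hcol : ∀ ω p, ∑ q, ‖R q p ω‖ ^ 2 ≤ 1 := fun ω p =>
    hle1 _ (Finset.sum_nonneg fun _ _ => by positivity)
      (sum_norm_sq_resolvent_col_le hη0 (isHermitian_removeRow (hH ω) i) p)
  have hdiag : ∀ ω p, ‖R p p ω‖ ≤ 1 := fun ω p => by
    have := norm_resolvent_apply_le hη0 (isHermitian_removeRow (hH ω) i) p p
    simp only [hRdef]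
    nlinarith [norm_nonneg (resolvent η (removeRow (X ω) i) p p)]
  let T₁ : Ω → ℂ := fun ω => ∑ k, star (x k ω) * ∑ j ∈ Finset.Iio k, x j ω * R j k ω
  let T₂ : Ω → ℂ := fun ω => ∑ k, x k ω * ∑ j ∈ Finset.Iio k, star (x j ω) * R k j ω
  let D : Ω → ℂ := fun ω => ∑ k, ((‖x k ω‖ ^ 2 - ∫ ω', ‖x k ω'‖ ^ 2 ∂P : ℝ) : ℂ) * R k k ω
  have hT : ∀ ω, schurForm η (X ω) i -
      ∑ j, (if j = i then 0 else ((∫ ω', ‖X ω' i j‖ ^ 2 ∂P : ℝ) : ℂ)) *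
        resolvent η (removeRow (X ω) i) j j = T₁ ω + T₂ ω + D ω := by
    intro ω
    have h1 : ∀ j, (if j = i then 0 else ((∫ ω', ‖X ω' i j‖ ^ 2 ∂P : ℝ) : ℂ))
        = ((∫ ω', ‖x j ω'‖ ^ 2 ∂P : ℝ) : ℂ) := fun j => by
      by_cases hj : j = i <;> simp [hxdef, offRow, hj]
    rw [schurForm_eq]
    simp only [h1, D, T₁, T₂, Complex.ofReal_sub, sub_mul, Finset.sum_sub_distrib]
    ring
  have hL : ∀ k, MemLp (x k) ⊤ P := fun k => memLp_top_of_norm_le (hxM k) (hxε k)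
  have hsL : ∀ k, MemLp (fun ω => star (x k ω)) ⊤ P := fun k =>
    memLp_top_of_norm_le (hsM k) (hsε k)
  have hRL : ∀ p q, MemLp (R p q) ⊤ P := fun p q =>
    memLp_top_of_norm_le (hRM p q) (C := 1) (ae_of_all _ fun ω => by
      have : ‖R p q ω‖ ^ 2 ≤ ∑ q, ‖R p q ω‖ ^ 2 :=
        Finset.single_le_sum (f := fun q => ‖R p q ω‖ ^ 2) (fun _ _ => by positivity)
          (Finset.mem_univ q)
      exact (sq_le_one_iff₀ (norm_nonneg _)).mp (this.trans (hrow ω p)))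
  have hT₁ : MemLp T₁ ⊤ P := memLp_finsetSum _ fun k _ => memLp_top_mul (hsL k)
    (memLp_finsetSum _ fun j _ => memLp_top_mul (hL j) (hRL j k))
  have hT₂ : MemLp T₂ ⊤ P := memLp_finsetSum _ fun k _ => memLp_top_mul (hL k)
    (memLp_finsetSum _ fun j _ => memLp_top_mul (hsL j) (hRL k j))
  have hD : MemLp D ⊤ P := by
    refine memLp_finsetSum _ fun k _ => memLp_top_mul ?_ (hRL k k)
    refine memLp_top_of_norm_le (C := ε ^ 2 + |∫ ω', ‖x k ω'‖ ^ 2 ∂P|) ?_ ?_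
    · exact Complex.measurable_ofReal.comp (((hxM k).norm.pow_const 2).sub_const _)
    · filter_upwards [hxε k] with ω hω
      rw [Complex.norm_real, Real.norm_eq_abs]
      refine (abs_sub _ _).trans (add_le_add ?_ le_rfl)
      rw [abs_of_nonneg (by positivity)]
      gcongr
  have hIall : Integrable (fun ω => ‖T₁ ω + T₂ ω + D ω‖ ^ 2) P :=
    integrable_norm_sq_of_memLp_top ((hT₁.add hT₂).add hD)
  simp only [hT]
  refine ⟨hIall, ?_⟩
  set S : ℝ := ∑ j, ∫ ω, ‖x j ω‖ ^ 2 ∂P with hS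
  have b1 : ∫ ω, ‖T₁ ω‖ ^ 2 ∂P ≤ ε ^ 2 * S :=
    integral_norm_sq_triangular_le hm hxM hsM hxε hsε hxm hsm hx0 hs0 hRm hrow
  -- Same estimate with `x` and its conjugate exchanged and `R` transposed, so the column bound
  -- replaces the row bound.
  have b2 : ∫ ω, ‖T₂ ω‖ ^ 2 ∂P ≤ ε ^ 2 * S := by
    have := integral_norm_sq_triangular_le (R := fun p q => R q p) hm hsM hxM hsε hxε hsm hxm hs0
      hx0 (fun k p q => hRm k q p) hcol
    simpa only [norm_star] using this
  have b3 : ∫ ω, ‖D ω‖ ^ 2 ∂P ≤ ε ^ 2 * S :=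
    integral_norm_sq_diagonal_le hm hxM hxε hxm hxind hRm hdiag
  have hSle : S ≤ rowSum P X i := by
    refine Finset.sum_le_sum fun j _ => ?_
    simp only [hxdef, offRow]
    split_ifs
    · simpa using integral_nonneg fun _ => by positivity
    · rfl
  have hI1 := integrable_norm_sq_of_memLp_top hT₁
  have hI2 := integrable_norm_sq_of_memLp_top hT₂
  have hI3 := integrable_norm_sq_of_memLp_top hD
  calc ∫ ω, ‖T₁ ω + T₂ ω + D ω‖ ^ 2 ∂P
      ≤ ∫ ω, 3 * (‖T₁ ω‖ ^ 2 + ‖T₂ ω‖ ^ 2 + ‖D ω‖ ^ 2) ∂P :=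
        integral_mono hIall (((hI1.add hI2).add hI3).const_mul 3)
          fun ω => norm_add_three_sq_le _ _ _
    _ = 3 * (∫ ω, ‖T₁ ω‖ ^ 2 ∂P + ∫ ω, ‖T₂ ω‖ ^ 2 ∂P + ∫ ω, ‖D ω‖ ^ 2 ∂P) := by
        rw [integral_const_mul, integral_add (f := fun ω => ‖T₁ ω‖ ^ 2 + ‖T₂ ω‖ ^ 2)
          (hI1.add hI2) hI3, integral_add hI1 hI2]
    _ ≤ 9 * ε ^ 2 * rowSum P X i := by
        nlinarith [mul_le_mul_of_nonneg_left hSle (sq_nonneg ε)]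

theorem measurable_diagResolvent (hX : ∀ i j, Measurable fun ω => X ω i j) (η : ℝ) (i : Fin n) :
    Measurable fun ω => diagResolvent η (X ω) i :=
  (measurable_resolvent hX η i i).const_mul _

omit [IsProbabilityMeasure P] in
theorem memLp_diagResolvent (hX : ∀ i j, Measurable fun ω => X ω i j)
    (hH : ∀ ω, (X ω).IsHermitian) {η : ℝ} (hη : 0 < η) (i : Fin n) :
    MemLp (fun ω => diagResolvent η (X ω) i) ⊤ P :=
  memLp_top_of_norm_le (measurable_diagResolvent hX η i)
    (ae_of_all _ fun ω => norm_diagResolvent_le hη (hH ω) i)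

theorem memLp_selfConsistencyError (hX : ∀ i j, Measurable fun ω => X ω i j)
    (hH : ∀ ω, (X ω).IsHermitian) {η : ℝ} (hη : 0 < η) (σ : Fin n → ℝ) (i : Fin n) :
    MemLp (fun ω => selfConsistencyError η (X ω) σ i) ⊤ P :=
  ((memLp_const 1).sub (memLp_diagResolvent hX hH hη i)).sub
    (memLp_top_mul ((memLp_diagResolvent hX hH hη i).const_mul _)
      (memLp_finsetSum _ fun j _ => (memLp_diagResolvent hX hH hη j).const_mul _))

theorem integral_norm_selfConsistencyError_le (hX : ∀ i j, Measurable fun ω => X ω i j)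
    (hH : ∀ ω, (X ω).IsHermitian)
    (hind : iIndepFun (fun (p : {p : Fin n × Fin n // p.1 ≤ p.2}) ω => X ω p.1.1 p.1.2) P)
    {ε : ℝ} (hε : 0 < ε) (hε1 : ε ≤ 1) (hmean : ∀ i j, ∫ ω, X ω i j ∂P = 0)
    (hbdd : ∀ i j, ∀ᵐ ω ∂P, ‖X ω i j‖ ≤ ε) {η : ℝ} (hη : 1 ≤ η) (i : Fin n) :
    ∫ ω, ‖selfConsistencyError η (X ω) (fun j => ∫ ω', ‖X ω' i j‖ ^ 2 ∂P) i‖ ∂P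
      ≤ 6 * ε * (1 + rowSum P X i) := by
  have hη0 : 0 < η := by linarith
  obtain ⟨hTI, hTle⟩ := integral_norm_sq_schurForm_sub_le hX hH hind hε.le hmean hbdd hη i
  set T : Ω → ℂ := fun ω => schurForm η (X ω) i -
        ∑ j, (if j = i then 0 else ((∫ ω', ‖X ω' i j‖ ^ 2 ∂P : ℝ) : ℂ)) *
          resolvent η (removeRow (X ω) i) j j with hT
  have hXI : ∀ j, Integrable (fun ω => ‖X ω i j‖ ^ 2) P := fun j =>
    integrable_norm_sq_of_memLp_top (memLp_top_of_norm_le (hX i j) (hbdd i j))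
  have hRI : Integrable (fun ω => ∑ j, ‖X ω i j‖ ^ 2) P := integrable_finsetSum _ fun j _ => hXI j
  have hs : ∫ ω, ∑ j, ‖X ω i j‖ ^ 2 ∂P = rowSum P X i := integral_finsetSum _ fun j _ => hXI j
  have hs0 := rowSum_nonneg (P := P) (X := X) i
  have hpt : ∀ᵐ ω ∂P, ‖selfConsistencyError η (X ω) (fun j => ∫ ω', ‖X ω' i j‖ ^ 2 ∂P) i‖
      ≤ (ε + ε / 2 + 2 * ε ^ 2) + (2 * ε)⁻¹ * ‖T ω‖ ^ 2 + ε ^ 2 * ∑ j, ‖X ω i j‖ ^ 2 := by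
    filter_upwards [hbdd i i] with ω hω
    have h1 := norm_selfConsistencyError_le hη (hH ω)
      (σ := fun j => ∫ ω', ‖X ω' i j‖ ^ 2 ∂P) (δ := ε ^ 2)
      (fun j => integral_nonneg fun _ => by positivity)
      (fun j => integral_norm_sq_le_sq (hX i j) (hbdd i j)) i
    -- Weighted AM-GM in place of Cauchy-Schwarz; with `E|T|²` of order `ε²` both terms are of order
    -- `ε`. This is where `ε > 0` is needed.
    have h2 : ‖T ω‖ ≤ ε / 2 + (2 * ε)⁻¹ * ‖T ω‖ ^ 2 := by
      have : 0 ≤ (2 * ε)⁻¹ * (‖T ω‖ - ε) ^ 2 := by positivity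
      have h3 : (2 * ε)⁻¹ * (‖T ω‖ - ε) ^ 2 = (2 * ε)⁻¹ * ‖T ω‖ ^ 2 - ‖T ω‖ + ε / 2 := by
        field_simp
        ring
      linarith
    have h4 : ‖schurForm η (X ω) i -
        ∑ j, (if j = i then 0 else ((∫ ω', ‖X ω' i j‖ ^ 2 ∂P : ℝ) : ℂ)) *
          resolvent η (removeRow (X ω) i) j j‖ = ‖T ω‖ := rfl
    rw [h4] at h1
    linarith
  have hI1 : Integrable (fun ω => (ε + ε / 2 + 2 * ε ^ 2) + (2 * ε)⁻¹ * ‖T ω‖ ^ 2) P :=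
    (integrable_const _).add (hTI.const_mul _)
  calc _ ≤ ∫ ω, ((ε + ε / 2 + 2 * ε ^ 2) + (2 * ε)⁻¹ * ‖T ω‖ ^ 2
          + ε ^ 2 * ∑ j, ‖X ω i j‖ ^ 2) ∂P :=
        integral_mono_ae (integrable_of_memLp_top
          (memLp_selfConsistencyError hX hH hη0 _ i)).norm (hI1.add (hRI.const_mul _)) hpt
    _ = (ε + ε / 2 + 2 * ε ^ 2) + (2 * ε)⁻¹ * ∫ ω, ‖T ω‖ ^ 2 ∂P + ε ^ 2 * rowSum P X i := by
        rw [integral_add hI1 (hRI.const_mul _), integral_add (integrable_const _)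
          (hTI.const_mul _), integral_const_mul, integral_const_mul, hs, integral_const,
          probReal_univ, one_smul]
    _ ≤ (ε + ε / 2 + 2 * ε ^ 2) + (2 * ε)⁻¹ * (9 * ε ^ 2 * rowSum P X i)
          + ε ^ 2 * rowSum P X i := by gcongr
    _ = ε * (3 / 2 + 2 * ε + (9 / 2 + ε) * rowSum P X i) := by field_simp; ring
    _ ≤ 6 * ε * (1 + rowSum P X i) := by
        have : 3 / 2 + 2 * ε + (9 / 2 + ε) * rowSum P X i ≤ 6 * (1 + rowSum P X i) := by nlinarith
        nlinarith

end

/-! ### Cauchy kernels determine weak convergence. -/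

/-- The normalized Cauchy kernel `-iη / (x - iη)`. -/
noncomputable def cauchyKernel (η x : ℝ) : ℂ := -(η * Complex.I) / ((x : ℂ) - η * Complex.I)

theorem sub_mul_I_ne_zero {η : ℝ} (hη : η ≠ 0) (x : ℝ) : (x : ℂ) - η * Complex.I ≠ 0 := fun h => by
  have := congrArg Complex.im h
  simp at this
  exact hη this

theorem norm_cauchyKernel_le (η x : ℝ) : ‖cauchyKernel η x‖ ≤ 1 := by
  rw [cauchyKernel, norm_div]
  refine div_le_one_of_le₀ ?_ (norm_nonneg _)
  have := Complex.abs_im_le_norm ((x : ℂ) - η * Complex.I)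
  simpa using this

theorem continuous_cauchyKernel {η : ℝ} (hη : η ≠ 0) : Continuous (cauchyKernel η) := by
  unfold cauchyKernel
  exact continuous_const.div (by fun_prop) (sub_mul_I_ne_zero hη)

theorem cauchyKernel_eq {η : ℝ} (hη : η ≠ 0) (x : ℝ) :
    cauchyKernel η x = ((η ^ 2 / (x ^ 2 + η ^ 2) : ℝ) : ℂ)
      - ((η * (x / (x ^ 2 + η ^ 2)) : ℝ) : ℂ) * Complex.I := by
  have h1 := sub_mul_I_ne_zero hη x
  have h2 : (x : ℂ) ^ 2 + (η : ℂ) ^ 2 ≠ 0 := by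
    have : 0 < x ^ 2 + η ^ 2 := by positivity
    exact_mod_cast this.ne'
  rw [cauchyKernel]
  push_cast
  field_simp
  linear_combination (-(η : ℂ) ^ 2 * x) * Complex.I_sq

theorem cauchyKernel_re {η : ℝ} (hη : η ≠ 0) (x : ℝ) :
    (cauchyKernel η x).re = η ^ 2 / (x ^ 2 + η ^ 2) := by
  rw [cauchyKernel_eq hη, Complex.sub_re, Complex.re_ofReal_mul, Complex.ofReal_re]
  simp

/-- Partial fractions: this is what makes the span of the kernels almost an algebra. -/
theorem cauchyKernel_mul {η ξ : ℝ} (hη : η ≠ 0) (hξ : ξ ≠ 0) (h : η ≠ ξ) (x : ℝ) :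
    cauchyKernel η x * cauchyKernel ξ x
      = ((η - ξ : ℝ) : ℂ)⁻¹ * (η * cauchyKernel ξ x - ξ * cauchyKernel η x) := by
  have h1 := sub_mul_I_ne_zero hη x
  have h2 := sub_mul_I_ne_zero hξ x
  have h3 : ((η - ξ : ℝ) : ℂ) ≠ 0 := by exact_mod_cast sub_ne_zero.mpr h
  rw [cauchyKernel, cauchyKernel, eq_inv_mul_iff_mul_eq₀ h3, div_mul_div_comm, mul_div_assoc',
    mul_div_assoc', mul_div_assoc', div_sub_div _ _ h2 h1,
    div_eq_div_iff (mul_ne_zero h1 h2) (mul_ne_zero h2 h1)]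
  push_cast
  ring

theorem cauchyKernel_sub {η ξ : ℝ} (hη : η ≠ 0) (hξ : ξ ≠ 0) (x : ℝ) :
    cauchyKernel ξ x - cauchyKernel η x
      = ((1 - η / ξ : ℝ) : ℂ) * (cauchyKernel ξ x * (1 - cauchyKernel η x)) := by
  have h1 := sub_mul_I_ne_zero hη x
  have h2 := sub_mul_I_ne_zero hξ x
  have h3 : (ξ : ℂ) ≠ 0 := by exact_mod_cast hξ
  have e1 : 1 - cauchyKernel η x = x / ((x : ℂ) - η * Complex.I) := by
    rw [cauchyKernel, eq_div_iff h1, sub_mul, div_mul_cancel₀ _ h1]; ring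
  have e2 : ((1 - η / ξ : ℝ) : ℂ) = (ξ - η) / ξ := by push_cast; rw [sub_div, div_self h3]
  rw [e1, e2, cauchyKernel, cauchyKernel, div_sub_div _ _ h2 h1, div_mul_div_comm,
    div_mul_div_comm, div_eq_div_iff (mul_ne_zero h2 h1) (mul_ne_zero h3 (mul_ne_zero h2 h1))]
  ring

theorem star_cauchyKernel (η x : ℝ) : star (cauchyKernel η x) = cauchyKernel (-η) x := by
  simp [cauchyKernel]

/-- The functions `1` and `x ↦ -iη / (x - iη)` with `|η| ≥ 2`. -/
def cauchySet : Set (BoundedContinuousFunction ℝ ℂ) :=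
  {f | f = 1 ∨ ∃ η : ℝ, 2 ≤ |η| ∧ ∀ x, f x = cauchyKernel η x}

/-- The function `x ↦ -iη / (x - iη)` as a bounded continuous function. -/
noncomputable def cauchyBounded (η : ℝ) (hη : 2 ≤ |η|) : BoundedContinuousFunction ℝ ℂ :=
  .ofNormedAddCommGroup (cauchyKernel η)
    (continuous_cauchyKernel (abs_pos.mp (by linarith))) 1 (norm_cauchyKernel_le η)

theorem cauchyBounded_mem {η : ℝ} (hη : 2 ≤ |η|) : cauchyBounded η hη ∈ cauchySet :=
  Or.inr ⟨η, hη, fun _ => rfl⟩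

theorem mul_mem_closure_span_cauchySet_of_ne {η ξ : ℝ} (hη : 2 ≤ |η|) (hξ : 2 ≤ |ξ|) (h : η ≠ ξ) :
    cauchyBounded η hη * cauchyBounded ξ hξ ∈ Submodule.span ℂ cauchySet := by
  have : cauchyBounded η hη * cauchyBounded ξ hξ = ((η - ξ : ℝ) : ℂ)⁻¹ •
      ((η : ℂ) • cauchyBounded ξ hξ - (ξ : ℂ) • cauchyBounded η hη) := by
    ext x
    exact cauchyKernel_mul (abs_pos.mp (by linarith)) (abs_pos.mp (by linarith)) h x
  rw [this]
  exact Submodule.smul_mem _ _ (Submodule.sub_mem _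
    (Submodule.smul_mem _ _ (Submodule.subset_span (cauchyBounded_mem hξ)))
    (Submodule.smul_mem _ _ (Submodule.subset_span (cauchyBounded_mem hη))))

theorem norm_cauchyBounded_sub_le {η ξ : ℝ} (hη : 2 ≤ |η|) (hξ : 2 ≤ |ξ|) :
    ‖cauchyBounded ξ hξ - cauchyBounded η hη‖ ≤ 2 * |1 - η / ξ| := by
  refine (BoundedContinuousFunction.norm_le (by positivity)).mpr fun x => ?_
  change ‖cauchyKernel ξ x - cauchyKernel η x‖ ≤ _
  rw [cauchyKernel_sub (abs_pos.mp (by linarith)) (abs_pos.mp (by linarith)), norm_mul, norm_mul,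
    Complex.norm_real, Real.norm_eq_abs, mul_comm (2 : ℝ)]
  have h1 := norm_cauchyKernel_le ξ x
  have h2 : ‖1 - cauchyKernel η x‖ ≤ 2 := by
    refine (norm_sub_le _ _).trans ?_
    rw [norm_one]
    linarith [norm_cauchyKernel_le η x]
  gcongr
  nlinarith [norm_nonneg (cauchyKernel ξ x), norm_nonneg (1 - cauchyKernel η x)]

theorem mul_mem_closure_span_cauchySet {f g : BoundedContinuousFunction ℝ ℂ}
    (hf : f ∈ cauchySet) (hg : g ∈ cauchySet) :
    f * g ∈ (Submodule.span ℂ cauchySet).topologicalClosure := by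
  have hsub := Submodule.le_topologicalClosure (Submodule.span ℂ cauchySet)
  rcases hf with rfl | ⟨η, hη, hf⟩
  · rw [one_mul]; exact hsub (Submodule.subset_span hg)
  rcases hg with rfl | ⟨ξ, hξ, hg⟩
  · rw [mul_one]; exact hsub (Submodule.subset_span (Or.inr ⟨η, hη, hf⟩))
  have hf' : f = cauchyBounded η hη := by ext x; exact hf x
  have hg' : g = cauchyBounded ξ hξ := by ext x; exact hg x
  rw [hf', hg']
  by_cases h : η = ξ
  · subst h
    have hη0 : η ≠ 0 := abs_pos.mp (by linarith)
    -- The square of a kernel is a uniform limit of products with distinct parameters; `t k`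
    -- approaches `η` from outside, so `|t k| ≥ 2` persists.
    let t : ℕ → ℝ := fun k => η * (1 + 1 / ((k : ℝ) + 1))
    have hpos : ∀ k : ℕ, 0 < 1 / ((k : ℝ) + 1) := fun k => by positivity
    have ht : ∀ k, 2 ≤ |t k| := fun k => by
      rw [abs_mul, abs_of_pos (by linarith [hpos k] : 0 < 1 + 1 / ((k : ℝ) + 1))]
      nlinarith [hpos k]
    have hlim : Tendsto (fun k => cauchyBounded (t k) (ht k)) atTop (𝓝 (cauchyBounded η hη)) := by
      rw [tendsto_iff_norm_sub_tendsto_zero]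
      refine squeeze_zero (fun _ => norm_nonneg _)
        (fun k => norm_cauchyBounded_sub_le hη (ht k)) ?_
      have h1 : Tendsto (fun k : ℕ => 1 / ((k : ℝ) + 1)) atTop (𝓝 0) :=
        tendsto_one_div_add_atTop_nhds_zero_nat
      have h2 : Tendsto (fun k : ℕ => 2 * |1 - η / t k|) atTop
          (𝓝 (2 * |1 - η / (η * (1 + 0))|)) :=
        ((tendsto_const_nhds.sub (tendsto_const_nhds.div
          ((h1.const_add 1).const_mul η) (by simpa using hη0))).abs).const_mul 2
      simpa [hη0] using h2
    refine mem_closure_of_tendsto (hlim.const_mul (cauchyBounded η hη))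
      (Eventually.of_forall fun k => ?_)
    refine mul_mem_closure_span_cauchySet_of_ne hη (ht k) fun h => ?_
    have : η * (1 / ((k : ℝ) + 1)) = 0 := by
      have : t k = η + η * (1 / ((k : ℝ) + 1)) := by simp only [t]; ring
      linarith
    rcases mul_eq_zero.mp this with h | h
    · exact hη0 h
    · exact (hpos k).ne' h
  · exact hsub (mul_mem_closure_span_cauchySet_of_ne hη hξ h)

/-- The closed star subalgebra of the bounded continuous functions spanned by the Cauchy kernels. -/
noncomputable def cauchyAlgebra : StarSubalgebra ℂ (BoundedContinuousFunction ℝ ℂ) where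
  carrier := (Submodule.span ℂ cauchySet).topologicalClosure
  mul_mem' {f g} hf hg := by
    have h0 : ∀ f ∈ Submodule.span ℂ cauchySet, ∀ g ∈ Submodule.span ℂ cauchySet,
        f * g ∈ (Submodule.span ℂ cauchySet).topologicalClosure := by
      intro f hf g hg
      induction hf, hg using Submodule.span_induction₂ with
      | mem_mem f g hf hg => exact mul_mem_closure_span_cauchySet hf hg
      | zero_left g _ => rw [zero_mul]; exact Submodule.zero_mem _
      | zero_right f _ => rw [mul_zero]; exact Submodule.zero_mem _
      | add_left _ _ _ _ _ _ h1 h2 => rw [add_mul]; exact Submodule.add_mem _ h1 h2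
      | add_right _ _ _ _ _ _ h1 h2 => rw [mul_add]; exact Submodule.add_mem _ h1 h2
      | smul_left r _ _ _ _ h => rw [smul_mul_assoc]; exact Submodule.smul_mem _ _ h
      | smul_right r _ _ _ _ h => rw [mul_smul_comm]; exact Submodule.smul_mem _ _ h
    have h1 := map_mem_closure₂ continuous_mul hf hg h0
    exact (Submodule.isClosed_topologicalClosure _).closure_subset h1
  one_mem' := Submodule.le_topologicalClosure _ (Submodule.subset_span (Or.inl rfl))
  add_mem' hf hg := Submodule.add_mem _ hf hg
  zero_mem' := Submodule.zero_mem _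
  algebraMap_mem' r := by
    rw [Algebra.algebraMap_eq_smul_one]
    exact Submodule.smul_mem _ _
      (Submodule.le_topologicalClosure _ (Submodule.subset_span (Or.inl rfl)))
  star_mem' {f} hf := by
    refine map_mem_closure continuous_star hf fun f hf => ?_
    induction hf using Submodule.span_induction with
    | mem f hf =>
      refine Submodule.subset_span ?_
      rcases hf with rfl | ⟨η, hη, hf⟩
      · exact Or.inl (star_one _)
      · refine Or.inr ⟨-η, by rwa [abs_neg], fun x => ?_⟩
        rw [← star_cauchyKernel, ← hf x]
        rfl
    | zero => rw [star_zero]; exact Submodule.zero_mem _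
    | add _ _ _ _ h1 h2 => rw [star_add]; exact Submodule.add_mem _ h1 h2
    | smul r _ _ h => rw [star_smul]; exact Submodule.smul_mem _ _ h

theorem separatesPoints_cauchyAlgebra :
    (cauchyAlgebra.map (BoundedContinuousFunction.toContinuousMapStarₐ ℂ)).SeparatesPoints := by
  intro x y hxy
  have h2 : (2 : ℝ) ≤ |(2 : ℝ)| := by norm_num
  refine ⟨cauchyBounded 2 h2, ⟨_, ⟨cauchyBounded 2 h2, Submodule.le_topologicalClosure _
    (Submodule.subset_span (cauchyBounded_mem h2)), rfl⟩, rfl⟩, fun h => hxy ?_⟩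
  change cauchyKernel 2 x = cauchyKernel 2 y at h
  have hx := sub_mul_I_ne_zero (two_ne_zero : (2 : ℝ) ≠ 0) x
  have hy := sub_mul_I_ne_zero (two_ne_zero : (2 : ℝ) ≠ 0) y
  rw [cauchyKernel, cauchyKernel, div_eq_div_iff hx hy] at h
  have hne : -(((2 : ℝ) : ℂ) * Complex.I) ≠ 0 := by simp
  have := mul_left_cancel₀ hne h
  have := congrArg Complex.re this
  simpa using this.symm

theorem integrable_cauchyKernel (μ : Measure ℝ) [IsFiniteMeasure μ] {η : ℝ} (hη : η ≠ 0) :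
    Integrable (cauchyKernel η) μ :=
  .of_bound (continuous_cauchyKernel hη).aestronglyMeasurable 1
    (ae_of_all _ (norm_cauchyKernel_le η))

theorem tendsto_integral_of_mem_cauchyAlgebra {μ : ℕ → ProbabilityMeasure ℝ}
    {μ₀ : ProbabilityMeasure ℝ}
    (h : ∀ η : ℝ, 2 ≤ η → Tendsto (fun k => ∫ x, cauchyKernel η x ∂(μ k : Measure ℝ)) atTop
      (𝓝 (∫ x, cauchyKernel η x ∂(μ₀ : Measure ℝ))))
    {g : BoundedContinuousFunction ℝ ℂ} (hg : g ∈ cauchyAlgebra) :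
    Tendsto (fun k => ∫ x, g x ∂(μ k : Measure ℝ)) atTop (𝓝 (∫ x, g x ∂(μ₀ : Measure ℝ))) := by
  have hspan : ∀ f ∈ Submodule.span ℂ cauchySet,
      Tendsto (fun k => ∫ x, f x ∂(μ k : Measure ℝ)) atTop (𝓝 (∫ x, f x ∂(μ₀ : Measure ℝ))) := by
    intro f hf
    induction hf using Submodule.span_induction with
    | mem f hf =>
      rcases hf with rfl | ⟨η, hη, hf⟩
      · simp
      · simp only [hf]
        rcases le_abs.mp hη with hη | hη
        · exact h η hη
        · have hs : ∀ ν : Measure ℝ,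
              star (∫ x, cauchyKernel (-η) x ∂ν) = ∫ x, cauchyKernel η x ∂ν := fun ν => by
            rw [RCLike.star_def, ← integral_conj]
            refine integral_congr_ae (ae_of_all _ fun x => ?_)
            simpa using star_cauchyKernel (-η) x
          have := (continuous_star.tendsto _).comp (h (-η) hη)
          simpa only [Function.comp_def, hs] using this
    | zero => simp
    | add f g _ _ h1 h2 =>
      have := h1.add h2
      simpa only [BoundedContinuousFunction.add_apply, ← integral_add (f.integrable _)
        (g.integrable _)] using this
    | smul r f _ h1 =>
      have := h1.const_mul r
      simpa only [BoundedContinuousFunction.smul_apply, smul_eq_mul, integral_const_mul] using this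
  rw [Metric.tendsto_atTop]
  intro δ hδ
  obtain ⟨f, hf, hfg⟩ := Metric.mem_closure_iff.mp
    (show g ∈ closure (Submodule.span ℂ cauchySet : Set _) from hg) (δ / 3) (by positivity)
  obtain ⟨N, hN⟩ := Metric.tendsto_atTop.mp (hspan f hf) (δ / 3) (by positivity)
  refine ⟨N, fun k hk => ?_⟩
  have hb : ∀ ν : ProbabilityMeasure ℝ,
      dist (∫ x, g x ∂(ν : Measure ℝ)) (∫ x, f x ∂(ν : Measure ℝ)) ≤ dist g f := by
    intro ν
    rw [dist_eq_norm, ← integral_sub (g.integrable _) (f.integrable _)]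
    refine (norm_integral_le_of_norm_le_const (C := dist g f) (ae_of_all _ fun x => ?_)).trans ?_
    · rw [← dist_eq_norm]; exact BoundedContinuousFunction.dist_coe_le_dist x
    · simp
  have h1 := hb (μ k)
  have h2 := hb μ₀
  have h3 := hN k hk
  have h4 := dist_triangle4_right (∫ x, g x ∂(μ k : Measure ℝ)) (∫ x, g x ∂(μ₀ : Measure ℝ))
    (∫ x, f x ∂(μ k : Measure ℝ)) (∫ x, f x ∂(μ₀ : Measure ℝ))
  linarith

/-- Markov's inequality: `1 - Re` of the kernel is `x²/(x² + r²)`, which is at least `1/2` where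
`|x| > r`. -/
theorem measure_norm_gt_le (μ : ProbabilityMeasure ℝ) {r : ℝ} (hr : 0 < r) :
    (μ : Measure ℝ) {x | r < ‖x‖}
      ≤ ENNReal.ofReal (2 * (1 - (∫ x, cauchyKernel r x ∂(μ : Measure ℝ)).re)) := by
  have hI := integrable_cauchyKernel (μ : Measure ℝ) hr.ne'
  have hIre : Integrable (fun x => (cauchyKernel r x).re) (μ : Measure ℝ) := hI.re
  have hre : (∫ x, cauchyKernel r x ∂(μ : Measure ℝ)).re
      = ∫ x, (cauchyKernel r x).re ∂(μ : Measure ℝ) := (integral_re hI).symm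
  have h1 : 2 * (1 - (∫ x, cauchyKernel r x ∂(μ : Measure ℝ)).re)
      = ∫ x, 2 * (1 - (cauchyKernel r x).re) ∂(μ : Measure ℝ) := by
    rw [integral_const_mul, integral_sub (integrable_const _) hIre, hre]
    simp
  have hS : MeasurableSet {x : ℝ | r < ‖x‖} := measurableSet_lt measurable_const measurable_norm
  rw [h1, ← ofReal_measureReal (measure_ne_top _ _), ← integral_indicator_one hS]
  refine ENNReal.ofReal_le_ofReal (integral_mono ((integrable_const 1).indicator hS)
    (((integrable_const 1).sub hIre).const_mul 2) fun x => ?_)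
  have hpos : 0 < x ^ 2 + r ^ 2 := by positivity
  simp only [cauchyKernel_re hr.ne']
  by_cases hx : r < ‖x‖
  · rw [Set.indicator_of_mem (show x ∈ {x : ℝ | r < ‖x‖} from hx), Pi.one_apply]
    have hx2 : r ^ 2 ≤ x ^ 2 := by
      rw [← sq_abs x, ← Real.norm_eq_abs]
      exact pow_le_pow_left₀ hr.le (le_of_lt hx) 2
    have : r ^ 2 / (x ^ 2 + r ^ 2) ≤ 1 / 2 := by
      rw [div_le_div_iff₀ hpos (by norm_num)]; linarith
    linarith
  · rw [Set.indicator_of_notMem (show x ∉ {x : ℝ | r < ‖x‖} from hx)]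
    have : r ^ 2 / (x ^ 2 + r ^ 2) ≤ 1 := by
      rw [div_le_one hpos]; nlinarith [sq_nonneg x]
    linarith

theorem tendsto_integral_cauchyKernel_atTop (μ : Measure ℝ) [IsProbabilityMeasure μ] :
    Tendsto (fun r : ℝ => (∫ x, cauchyKernel r x ∂μ).re) atTop (𝓝 1) := by
  have h1 : Tendsto (fun r : ℝ => ∫ x, cauchyKernel r x ∂μ) atTop (𝓝 (∫ _, (1 : ℂ) ∂μ)) := by
    refine tendsto_integral_filter_of_dominated_convergence (fun _ => (1 : ℝ)) ?_ ?_
      (integrable_const _) ?_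
    · filter_upwards [eventually_gt_atTop 0] with r hr
      exact (continuous_cauchyKernel hr.ne').aestronglyMeasurable
    · exact Eventually.of_forall fun r => ae_of_all _ (norm_cauchyKernel_le r)
    · refine ae_of_all _ fun x => ?_
      have h2 : Tendsto (fun r : ℝ => (1 + Complex.I * ((x / r : ℝ) : ℂ))⁻¹) atTop
          (𝓝 ((1 + Complex.I * ((0 : ℝ) : ℂ))⁻¹)) := by
        refine Tendsto.inv₀ ?_ (by simp)
        exact (((Complex.continuous_ofReal.tendsto 0).comp
          (tendsto_const_nhds.div_atTop tendsto_id)).const_mul _).const_add _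
      have h3 : (1 + Complex.I * ((0 : ℝ) : ℂ))⁻¹ = 1 := by simp
      rw [h3] at h2
      refine h2.congr' ?_
      filter_upwards [eventually_gt_atTop 0] with r hr
      have h4 := sub_mul_I_ne_zero hr.ne' x
      have h5 : (r : ℂ) ≠ 0 := by exact_mod_cast hr.ne'
      rw [cauchyKernel, eq_div_iff h4]
      have h6 : (x : ℂ) - r * Complex.I
          = -(r * Complex.I) * (1 + Complex.I * ((x / r : ℝ) : ℂ)) := by
        push_cast
        field_simp
        linear_combination (x : ℂ) * Complex.I_sq
      have h7 : 1 + Complex.I * ((x / r : ℝ) : ℂ) ≠ 0 := fun h => h4 (by rw [h6, h, mul_zero])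
      rw [h6, mul_comm, mul_assoc, mul_inv_cancel₀ h7, mul_one]
  have h2 := (Complex.continuous_re.tendsto _).comp h1
  simpa [Function.comp_def] using h2

/-- For fixed `r` the tail bounds converge to that of the limit law, which vanishes as `r → ∞` by
dominated convergence. -/
theorem isTightMeasureSet_of_tendsto_cauchyKernel {μ : ℕ → ProbabilityMeasure ℝ}
    {μ₀ : ProbabilityMeasure ℝ}
    (h : ∀ η : ℝ, 2 ≤ η → Tendsto (fun k => ∫ x, cauchyKernel η x ∂(μ k : Measure ℝ)) atTop
      (𝓝 (∫ x, cauchyKernel η x ∂(μ₀ : Measure ℝ)))) :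
    IsTightMeasureSet (Set.range fun k => (μ k : Measure ℝ)) := by
  refine isTightMeasureSet_range_of_tendsto_limsup_measure_norm_gt ?_
  have h1 : Tendsto (fun r : ℝ => ENNReal.ofReal
      (2 * (1 - (∫ x, cauchyKernel r x ∂(μ₀ : Measure ℝ)).re))) atTop (𝓝 0) := by
    have := ((tendsto_integral_cauchyKernel_atTop (μ₀ : Measure ℝ)).const_sub 1).const_mul 2
    simpa using ENNReal.tendsto_ofReal this
  refine tendsto_of_tendsto_of_tendsto_of_le_of_le' tendsto_const_nhds h1
    (Eventually.of_forall fun _ => zero_le) ?_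
  filter_upwards [eventually_ge_atTop 2] with r hr
  have h2 : Tendsto (fun k => ENNReal.ofReal
      (2 * (1 - (∫ x, cauchyKernel r x ∂(μ k : Measure ℝ)).re))) atTop (𝓝 (ENNReal.ofReal
      (2 * (1 - (∫ x, cauchyKernel r x ∂(μ₀ : Measure ℝ)).re)))) :=
    ENNReal.tendsto_ofReal
      ((((Complex.continuous_re.tendsto _).comp (h r hr)).const_sub 1).const_mul 2)
  rw [← h2.limsup_eq]
  exact limsup_le_limsup (Eventually.of_forall fun k => measure_norm_gt_le (μ k) (by linarith))

/-- Weak convergence follows from the convergence of the Stieltjes transforms on the imaginary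
axis away from the origin. -/
theorem tendsto_of_tendsto_cauchyKernel {μ : ℕ → ProbabilityMeasure ℝ} {μ₀ : ProbabilityMeasure ℝ}
    (h : ∀ η : ℝ, 2 ≤ η → Tendsto (fun k => ∫ x, cauchyKernel η x ∂(μ k : Measure ℝ)) atTop
      (𝓝 (∫ x, cauchyKernel η x ∂(μ₀ : Measure ℝ)))) :
    Tendsto μ atTop (𝓝 μ₀) :=
  ProbabilityMeasure.tendsto_of_tight_of_separatesPoints ℂ
    (isTightMeasureSet_of_tendsto_cauchyKernel h) separatesPoints_cauchyAlgebra
    fun _ hg => tendsto_integral_of_mem_cauchyAlgebra h hg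

/-! ### The Stieltjes transform of the semicircle law. -/

theorem integral_semicircle (f : ℝ → ℝ) :
    ∫ x, f x ∂(semicircle : Measure ℝ)
      = ∫ x in (-2 : ℝ)..2, √(4 - x ^ 2) / (2 * Real.pi) * f x := by
  have hc : Continuous semicircleDensity := by unfold semicircleDensity; fun_prop
  have h0 : ∀ x, 0 ≤ semicircleDensity x := fun x => by unfold semicircleDensity; positivity
  have hz : ∀ x ∉ Set.Ioc (-2 : ℝ) 2, semicircleDensity x * f x = 0 := fun x hx => by
    have : 4 - x ^ 2 ≤ 0 := by
      by_contra! h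
      exact hx ⟨by nlinarith, by nlinarith⟩
    simp [semicircleDensity, this]
  change ∫ x, f x ∂(volume.withDensity fun x => ENNReal.ofReal (semicircleDensity x)) = _
  rw [integral_withDensity_eq_integral_toReal_smul hc.measurable.ennreal_ofReal
    (ae_of_all _ fun _ => ENNReal.ofReal_lt_top)]
  simp only [ENNReal.toReal_ofReal (h0 _), smul_eq_mul]
  rw [← setIntegral_eq_integral_of_forall_compl_eq_zero (s := Set.Ioc (-2 : ℝ) 2) hz,
    ← intervalIntegral.integral_of_le (by norm_num)]
  refine intervalIntegral.integral_congr fun x hx => ?_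
  rw [Set.uIcc_of_le (by norm_num)] at hx
  have h1 : 0 ≤ 4 - x ^ 2 := by nlinarith [hx.1, hx.2]
  simp only [semicircleDensity, max_eq_left h1]

/-- An explicit primitive, continuous up to the endpoints, where both arcsines take the values
`±π/2`. The derivative simplifies because one minus the square of the first argument is the perfect
square `(ηr/(2q))²`. -/
theorem hasDerivAt_arcsin_primitive {η : ℝ} (hη : 0 < η) {x : ℝ} (hx : x ∈ Set.Ioo (-2 : ℝ) 2) :
    HasDerivAt (fun x => √(η ^ 2 + 4) / η *
        Real.arcsin (√(η ^ 2 + 4) / 2 * (x / √(x ^ 2 + η ^ 2))) - Real.arcsin (x / 2))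
      (√(4 - x ^ 2) / (x ^ 2 + η ^ 2)) x := by
  set c := √(η ^ 2 + 4) with hc
  set q := √(x ^ 2 + η ^ 2) with hq
  set r := √(4 - x ^ 2) with hr
  have h4 : 0 < 4 - x ^ 2 := by nlinarith [hx.1, hx.2]
  have hqp : 0 < x ^ 2 + η ^ 2 := by positivity
  have hc2 : c ^ 2 = η ^ 2 + 4 := Real.sq_sqrt (by positivity)
  have hq2 : q ^ 2 = x ^ 2 + η ^ 2 := Real.sq_sqrt hqp.le
  have hr2 : r ^ 2 = 4 - x ^ 2 := Real.sq_sqrt h4.le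
  have hq0 : 0 < q := Real.sqrt_pos.mpr hqp
  have hr0 : 0 < r := Real.sqrt_pos.mpr h4
  have d1 : HasDerivAt (fun x : ℝ => √(x ^ 2 + η ^ 2)) (x / q) x := by
    have := (((hasDerivAt_id x).pow 2).add_const (η ^ 2)).sqrt hqp.ne'
    refine this.congr_deriv ?_
    simp only [id, ← hq, Pi.pow_apply]
    field_simp
    simp
  have d2 : HasDerivAt (fun x : ℝ => c / 2 * (x / √(x ^ 2 + η ^ 2))) (c / 2 * (η ^ 2 / q ^ 3)) x := by
    have := ((hasDerivAt_id x).div d1 hq0.ne').const_mul (c / 2)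
    refine this.congr_deriv ?_
    simp only [id, ← hq]
    congr 1
    field_simp
    linarith
  set u := c / 2 * (x / q) with hu
  have hu2 : 1 - u ^ 2 = (η * r / (2 * q)) ^ 2 := by
    rw [hu]
    field_simp
    rw [hc2, hr2, hq2]
    ring
  have hpos : 0 < η * r / (2 * q) := by positivity
  have hu1 : 0 < 1 - u ^ 2 := by rw [hu2]; positivity
  have d3 : HasDerivAt (fun x : ℝ => Real.arcsin (c / 2 * (x / √(x ^ 2 + η ^ 2))))
      (1 / (η * r / (2 * q)) * (c / 2 * (η ^ 2 / q ^ 3))) x := by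
    have h := Real.hasDerivAt_arcsin (x := u) (fun h => by rw [h] at hu1; norm_num at hu1)
      (fun h => by rw [h] at hu1; norm_num at hu1)
    rw [hu2, Real.sqrt_sq hpos.le] at h
    exact h.comp x d2
  have d4 : HasDerivAt (fun x : ℝ => Real.arcsin (x / 2)) (1 / r) x := by
    have h := Real.hasDerivAt_arcsin (x := x / 2) (by linarith [hx.1]) (by linarith [hx.2])
    have h5 : 1 - (x / 2) ^ 2 = (r / 2) ^ 2 := by rw [div_pow, div_pow, hr2]; ring
    rw [h5, Real.sqrt_sq (by positivity)] at h
    refine (h.comp x ((hasDerivAt_id x).div_const 2)).congr_deriv ?_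
    field_simp
  refine ((d3.const_mul (c / η)).sub d4).congr_deriv ?_
  rw [← hq2]
  field_simp
  rw [hc2, hr2, hq2]
  ring

theorem integral_sqrt_div_sq_add_sq {η : ℝ} (hη : 0 < η) :
    ∫ x in (-2 : ℝ)..2, √(4 - x ^ 2) / (x ^ 2 + η ^ 2)
      = Real.pi * (√(η ^ 2 + 4) / η - 1) := by
  have hpos : ∀ x : ℝ, 0 < x ^ 2 + η ^ 2 := fun x => by positivity
  have hcont : Continuous fun x : ℝ => √(4 - x ^ 2) / (x ^ 2 + η ^ 2) :=
    Continuous.div (by fun_prop) (by fun_prop) fun x => (hpos x).ne'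
  have hF : Continuous fun x : ℝ => √(η ^ 2 + 4) / η *
      Real.arcsin (√(η ^ 2 + 4) / 2 * (x / √(x ^ 2 + η ^ 2))) - Real.arcsin (x / 2) := by
    have : Continuous fun x : ℝ => x / √(x ^ 2 + η ^ 2) :=
      continuous_id.div (by fun_prop) fun x => (Real.sqrt_pos.mpr (hpos x)).ne'
    fun_prop
  rw [intervalIntegral.integral_eq_sub_of_hasDerivAt_of_le (by norm_num) hF.continuousOn
    (fun x hx => hasDerivAt_arcsin_primitive hη hx) (hcont.intervalIntegrable _ _)]
  have hc0 : √(η ^ 2 + 4) ≠ 0 := (Real.sqrt_pos.mpr (by positivity)).ne'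
  have e1 : (2 : ℝ) ^ 2 + η ^ 2 = η ^ 2 + 4 := by ring
  have e2 : (-2 : ℝ) ^ 2 + η ^ 2 = η ^ 2 + 4 := by ring
  have e3 : √(η ^ 2 + 4) / 2 * (2 / √(η ^ 2 + 4)) = 1 := by field_simp
  have e4 : √(η ^ 2 + 4) / 2 * (-2 / √(η ^ 2 + 4)) = -1 := by field_simp
  rw [e1, e2, e3, e4]
  norm_num
  ring

/-- The normalized Stieltjes transform `η (√(η² + 4) - η) / 2` of the semicircle distribution. -/
noncomputable def semicircleTransform (η : ℝ) : ℝ := η * (√(η ^ 2 + 4) - η) / 2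

theorem semicircleTransform_eq {η : ℝ} (hη : 0 < η) :
    semicircleTransform η = 1 - (η ^ 2)⁻¹ * semicircleTransform η ^ 2 := by
  have hc2 : √(η ^ 2 + 4) ^ 2 = η ^ 2 + 4 := Real.sq_sqrt (by positivity)
  rw [semicircleTransform]
  field_simp
  nlinarith

theorem semicircleTransform_nonneg {η : ℝ} (hη : 0 < η) : 0 ≤ semicircleTransform η := by
  have : η ≤ √(η ^ 2 + 4) := Real.le_sqrt_of_sq_le (by linarith)
  exact div_nonneg (mul_nonneg hη.le (by linarith)) (by norm_num)

theorem semicircleTransform_le_one {η : ℝ} (hη : 0 < η) : semicircleTransform η ≤ 1 := by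
  rw [semicircleTransform_eq hη]
  have : 0 ≤ (η ^ 2)⁻¹ * semicircleTransform η ^ 2 := by positivity
  linarith

theorem integral_cauchyKernel_semicircle {η : ℝ} (hη : 0 < η) :
    ∫ x, cauchyKernel η x ∂(semicircle : Measure ℝ) = (semicircleTransform η : ℂ) := by
  have hI := integrable_cauchyKernel (semicircle : Measure ℝ) hη.ne'
  have hre : (∫ x, cauchyKernel η x ∂(semicircle : Measure ℝ)).re
      = ∫ x, (cauchyKernel η x).re ∂(semicircle : Measure ℝ) := (integral_re hI).symm
  have him : (∫ x, cauchyKernel η x ∂(semicircle : Measure ℝ)).im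
      = ∫ x, (cauchyKernel η x).im ∂(semicircle : Measure ℝ) := (integral_im hI).symm
  have hima : ∀ x, (cauchyKernel η x).im = -(η * (x / (x ^ 2 + η ^ 2))) := fun x => by
    rw [cauchyKernel_eq hη.ne']
    simp only [Complex.sub_im, Complex.ofReal_im, Complex.im_ofReal_mul, Complex.I_im]
    ring
  apply Complex.ext
  · rw [hre, Complex.ofReal_re, integral_semicircle]
    have : ∀ x : ℝ, √(4 - x ^ 2) / (2 * Real.pi) * (cauchyKernel η x).re
        = η ^ 2 / (2 * Real.pi) * (√(4 - x ^ 2) / (x ^ 2 + η ^ 2)) := fun x => by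
      rw [cauchyKernel_re hη.ne']
      ring
    simp only [this]
    rw [intervalIntegral.integral_const_mul, integral_sqrt_div_sq_add_sq hη, semicircleTransform]
    have := Real.pi_ne_zero
    field_simp
  · rw [him, Complex.ofReal_im, integral_semicircle]
    have h1 := intervalIntegral.integral_comp_neg (a := -2) (b := 2)
      fun x : ℝ => √(4 - x ^ 2) / (2 * Real.pi) * (cauchyKernel η x).im
    have h2 : ∀ x : ℝ, √(4 - (-x) ^ 2) / (2 * Real.pi) * (cauchyKernel η (-x)).im
        = -(√(4 - x ^ 2) / (2 * Real.pi) * (cauchyKernel η x).im) := fun x => by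
      rw [hima, hima, neg_sq]
      ring
    simp only [h2, intervalIntegral.integral_neg, neg_neg] at h1
    linarith

/-! ### The mean spectral distribution through the resolvent trace. -/

theorem isProbabilityMeasure_meanSpectral {Ω : Type*} [MeasurableSpace Ω] (P : Measure Ω)
    [IsProbabilityMeasure P] {n : ℕ} (hn : n ≠ 0) {X : Ω → Matrix (Fin n) (Fin n) ℂ}
    (hX : ∀ i j, Measurable fun ω => X ω i j) (hH : ∀ ω, (X ω).IsHermitian) :
    IsProbabilityMeasure (meanSpectral P X hH : Measure ℝ) := by
  have := fun ω => isProbabilityMeasure_empiricalSpectral hn (hH ω)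
  refine ⟨?_⟩
  rw [meanSpectral_apply P hX hH MeasurableSet.univ]
  simp

theorem integral_cauchyKernel_meanSpectral {Ω : Type*} [MeasurableSpace Ω] (P : Measure Ω)
    [IsProbabilityMeasure P] {n : ℕ} {X : Ω → Matrix (Fin n) (Fin n) ℂ}
    (hX : ∀ i j, Measurable fun ω => X ω i j) (hH : ∀ ω, (X ω).IsHermitian) {η : ℝ} (hη : 0 < η) :
    ∫ x, cauchyKernel η x ∂(meanSpectral P X hH : Measure ℝ)
      = ∫ ω, ((n : ℝ)⁻¹ : ℝ) * ∑ i, diagResolvent η (X ω) i ∂P := by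
  -- Viewing the mean distribution as a composition of kernels gives Fubini for complex-valued
  -- integrands.
  let κ : Kernel Ω ℝ := ⟨fun ω => empiricalSpectral (hH ω), measurable_empiricalSpectral hX hH⟩
  have hbind : (meanSpectral P X hH : Measure ℝ) = (κ ∘ₖ Kernel.const Unit P) () := by
    rw [← Measure.comp_eq_comp_const_apply]
    rfl
  have hI := integrable_cauchyKernel (meanSpectral P X hH : Measure ℝ) hη.ne'
  rw [hbind] at hI ⊢
  rw [Kernel.integral_comp hI, Kernel.const_apply]
  refine integral_congr_ae (ae_of_all _ fun ω => ?_)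
  change ∫ x, cauchyKernel η x ∂(empiricalSpectral (hH ω)) = _
  beta_reduce
  rw [empiricalSpectral, integral_smul_measure, integral_finsetSum_measure fun i _ =>
    integrable_cauchyKernel _ hη.ne', sum_diagResolvent hη (hH ω)]
  simp only [integral_dirac]
  rw [ENNReal.toReal_inv, ENNReal.toReal_natCast, Complex.real_smul]
  rfl

/-! ### The margin condition as uniform integrability. -/

section UniformIntegrability

variable {s : ∀ n : ℕ, Fin n → ℝ}

/-- If uniformity failed, bad sets of density at most `1/(k+1)` would exist at sizes `φ k` growing
with `k`. Completed by empty sets at the other sizes, they form a sequence of vanishing density that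
violates the hypothesis. -/
theorem exists_forall_small_finset_average_le
    (hs : ∀ J : ∀ n, Finset (Fin n), Tendsto (fun n : ℕ => ((J n).card : ℝ) / n) atTop (𝓝 0) →
      Tendsto (fun n : ℕ => (1 / (n : ℝ)) * ∑ i ∈ J n, s n i) atTop (𝓝 0)) {γ : ℝ} (hγ : 0 < γ) :
    ∃ k : ℕ, ∀ᶠ n in atTop, ∀ J : Finset (Fin n), J.card * (k + 1) ≤ n →
      (1 / (n : ℝ)) * ∑ i ∈ J, s n i ≤ γ := by
  classical
  by_contra! hcon
  let Q : ℕ → ℕ → Prop := fun k n => ∃ J : Finset (Fin n), J.card * (k + 1) ≤ n ∧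
      γ < (1 / (n : ℝ)) * ∑ i ∈ J, s n i
  have hQ : ∀ k, ∃ᶠ n in atTop, Q k n := fun k => by
    refine (hcon k).mono fun n hn => ?_
    exact hn
  obtain ⟨φ, hφ, hφQ⟩ := extraction_forall_of_frequently hQ
  let J : ∀ n, Finset (Fin n) := fun n =>
    if h : ∃ k, φ k = n ∧ Q k n then h.choose_spec.2.choose else ∅
  have hJ : ∀ k, (J (φ k)).card * (k + 1) ≤ φ k ∧
      γ < (1 / (φ k : ℝ)) * ∑ i ∈ J (φ k), s (φ k) i := by
    intro k
    have h : ∃ l, φ l = φ k ∧ Q l (φ k) := ⟨k, rfl, hφQ k⟩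
    -- Injectivity of `φ` ensures that the set chosen at size `φ k` is the one for level `k`.
    have hk : h.choose = k := hφ.injective h.choose_spec.1
    have h1 := h.choose_spec.2.choose_spec
    have h2 : (J (φ k)).card * (h.choose + 1) ≤ φ k ∧
        γ < (1 / (φ k : ℝ)) * ∑ i ∈ J (φ k), s (φ k) i := by
      simpa only [J, dif_pos h] using h1
    rwa [hk] at h2
  have hcard : Tendsto (fun n : ℕ => ((J n).card : ℝ) / n) atTop (𝓝 0) := by
    rw [Metric.tendsto_atTop]
    intro δ hδ
    obtain ⟨m, hm⟩ := exists_nat_one_div_lt hδ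
    refine ⟨φ m + 1, fun n hn => ?_⟩
    rw [Real.dist_0_eq_abs, abs_of_nonneg (by positivity)]
    by_cases h : ∃ k, φ k = n ∧ Q k n
    · obtain ⟨k, rfl, -⟩ := h
      have hmk : m < k := hφ.lt_iff_lt.mp hn
      refine lt_of_le_of_lt ?_ hm
      have h1 : ((J (φ k)).card : ℝ) * (k + 1) ≤ φ k := by exact_mod_cast (hJ k).1
      have h2 : (0 : ℝ) < φ k := by exact_mod_cast (Nat.zero_le _).trans_lt hn
      have h3 : (m : ℝ) ≤ k := by exact_mod_cast hmk.le
      rw [div_le_div_iff₀ h2 (by positivity)]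
      nlinarith [(Nat.cast_nonneg (J (φ k)).card : (0 : ℝ) ≤ _)]
    · simpa only [J, dif_neg h, Finset.card_empty, Nat.cast_zero, zero_div] using hδ
  have hlim := (hs J hcard).comp hφ.tendsto_atTop
  have : γ ≤ 0 := ge_of_tendsto hlim (Eventually.of_forall fun k => (hJ k).2.le)
  linarith

/-- If the rows above `K` were too numerous for the uniform bound, `⌊n/(k+1)⌋` of them would already
have a normalized sum exceeding `γ`. -/
theorem exists_threshold_average_le
    (hs : ∀ J : ∀ n, Finset (Fin n), Tendsto (fun n : ℕ => ((J n).card : ℝ) / n) atTop (𝓝 0) →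
      Tendsto (fun n : ℕ => (1 / (n : ℝ)) * ∑ i ∈ J n, s n i) atTop (𝓝 0)) {γ : ℝ} (hγ : 0 < γ) :
    ∃ K : ℝ, 1 ≤ K ∧ ∀ᶠ n : ℕ in atTop,
      (1 / (n : ℝ)) * ∑ i with ¬ s n i ≤ K, s n i ≤ γ := by
  obtain ⟨k, hk⟩ := exists_forall_small_finset_average_le hs hγ
  -- For `n ≥ k + 1` one has `n ≤ 2(k+1)⌊n/(k+1)⌋`, so a threshold above `2γ(k+1)` forces the
  -- contradiction; the `+ 1` makes it strict and gives `K ≥ 1`.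
  refine ⟨2 * γ * (k + 1) + 1, by nlinarith [(Nat.cast_nonneg k : (0 : ℝ) ≤ k)], ?_⟩
  filter_upwards [hk, eventually_ge_atTop (k + 1)] with n hn hnk
  set K : ℝ := 2 * γ * (k + 1) + 1 with hK
  set H : Finset (Fin n) := {i | ¬ s n i ≤ K} with hH
  by_cases hc : H.card * (k + 1) ≤ n
  · exact hn H hc
  exfalso
  have hm1 : n / (k + 1) ≤ H.card := Nat.div_le_of_le_mul (by rw [mul_comm]; omega)
  obtain ⟨J, hJH, hJ⟩ := Finset.exists_subset_card_eq hm1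
  have h1 := hn J (by rw [hJ]; exact Nat.div_mul_le_self n (k + 1))
  have hm0 : 1 ≤ n / (k + 1) := (Nat.one_le_div_iff (by omega)).mpr hnk
  have h2 : (J.card : ℝ) * K ≤ ∑ i ∈ J, s n i := by
    rw [← nsmul_eq_mul]
    refine Finset.card_nsmul_le_sum _ _ _ fun i hi => ?_
    exact (not_le.mp (Finset.mem_filter.mp (hJH hi)).2).le
  have hn0 : (0 : ℝ) < n := by exact_mod_cast (by omega : 0 < n)
  have h3 : (n : ℝ) ≤ 2 * J.card * (k + 1) := by
    have h4 : n < (n / (k + 1) + 1) * (k + 1) := by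
      rw [mul_comm]; exact Nat.lt_mul_div_succ n (by omega)
    have h5 : n ≤ 2 * J.card * (k + 1) := by rw [hJ]; nlinarith
    exact_mod_cast h5
  have h4 : ∑ i ∈ J, s n i ≤ γ * n := by
    rw [one_div, inv_mul_le_iff₀ hn0] at h1
    linarith
  have h5 : (0 : ℝ) < J.card := by exact_mod_cast (by omega : 0 < J.card)
  nlinarith

end UniformIntegrability

/-! ### Self-consistent equation: stability and first-order bounds. -/

section Deterministic

variable {n : ℕ} {σ : Fin n → Fin n → ℝ} {a e : Fin n → ℂ} {θ : ℝ}

/-- Subtracting the equations for `a_i` and `A` bounds `x = ∑|a_i - A|` by `θ(2x + 3ρ) + E`, where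
`ρ = ∑|s_i - 1|` and `E = ∑|e_i|`. With `θ ≤ 1/4` half of `x` is absorbed. -/
theorem sum_norm_sub_le (hσ0 : ∀ i j, 0 ≤ σ i j) (hσs : ∀ i j, σ i j = σ j i)
    (ha : ∀ i, ‖a i‖ ≤ 1) (hθ : 0 ≤ θ) (hθ1 : θ ≤ 1 / 4)
    (he : ∀ i, e i = 1 - a i - θ * a i * ∑ j, σ i j * a j)
    {A : ℝ} (hA0 : 0 ≤ A) (hA1 : A ≤ 1) (hA : A = 1 - θ * A ^ 2) :
    ∑ i, ‖a i - A‖ ≤ 3 / 2 * ∑ i, |∑ j, σ i j - 1| + 2 * ∑ i, ‖e i‖ := by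
  have hAn : ‖(A : ℂ)‖ ≤ 1 := by simpa [abs_of_nonneg hA0] using hA1
  have haA : ∀ i, ‖a i - A‖ ≤ 2 := fun i => (norm_sub_le _ _).trans (by linarith [ha i])
  have h1 : ∀ i, ‖a i - A‖ ≤ θ * (∑ j, σ i j * ‖a j - A‖ + |∑ j, σ i j - 1| + ‖a i - A‖)
      + ‖e i‖ := by
    intro i
    have hA' : (A : ℂ) = 1 - θ * A ^ 2 := by exact_mod_cast hA
    have hb : ∑ j, (σ i j : ℂ) * a j - A
        = ∑ j, (σ i j : ℂ) * (a j - A) + ((∑ j, σ i j - 1 : ℝ) : ℂ) * A := by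
      push_cast
      rw [sub_mul, one_mul, Finset.sum_mul, add_sub_assoc', ← Finset.sum_add_distrib]
      congr 1
      exact Finset.sum_congr rfl fun j _ => by ring
    have heq : a i - A = -(θ * (a i * (∑ j, (σ i j : ℂ) * (a j - A)
        + ((∑ j, σ i j - 1 : ℝ) : ℂ) * A) + A * (a i - A))) - e i := by
      rw [← hb, he i]
      linear_combination -hA'
    have hn1 : ‖∑ j, (σ i j : ℂ) * (a j - A)‖ ≤ ∑ j, σ i j * ‖a j - A‖ :=
      (norm_sum_le _ _).trans_eq (Finset.sum_congr rfl fun j _ => by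
        rw [norm_mul, Complex.norm_real, Real.norm_of_nonneg (hσ0 i j)])
    have hn2 : ‖((∑ j, σ i j - 1 : ℝ) : ℂ) * A‖ ≤ |∑ j, σ i j - 1| := by
      rw [norm_mul, Complex.norm_real, Real.norm_eq_abs]
      exact mul_le_of_le_one_right (abs_nonneg _) hAn
    have hn3 : ‖a i * (∑ j, (σ i j : ℂ) * (a j - A) + ((∑ j, σ i j - 1 : ℝ) : ℂ) * A)
        + A * (a i - A)‖ ≤ ∑ j, σ i j * ‖a j - A‖ + |∑ j, σ i j - 1| + ‖a i - A‖ := by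
      refine (norm_add_le _ _).trans (add_le_add ?_ ?_)
      · rw [norm_mul]
        refine (mul_le_of_le_one_left (norm_nonneg _) (ha i)).trans ?_
        exact (norm_add_le _ _).trans (add_le_add hn1 hn2)
      · rw [norm_mul]
        exact mul_le_of_le_one_left (norm_nonneg _) hAn
    calc ‖a i - A‖ = ‖-(θ * (a i * (∑ j, (σ i j : ℂ) * (a j - A)
          + ((∑ j, σ i j - 1 : ℝ) : ℂ) * A) + A * (a i - A))) - e i‖ := by rw [← heq]
      _ ≤ _ := by
        refine (norm_sub_le _ _).trans (add_le_add ?_ le_rfl)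
        rw [norm_neg, norm_mul, Complex.norm_real, Real.norm_of_nonneg hθ]
        exact mul_le_mul_of_nonneg_left hn3 hθ
  -- By symmetry the column sums are the row sums; the excess `s_j - 1` is paid for with `|a_j - A|
  -- ≤ 2`.
  have h2 : ∑ i, ∑ j, σ i j * ‖a j - A‖ ≤ ∑ j, ‖a j - A‖ + 2 * ∑ j, |∑ i, σ j i - 1| := by
    rw [Finset.sum_comm, Finset.mul_sum, ← Finset.sum_add_distrib]
    refine Finset.sum_le_sum fun j _ => ?_
    rw [← Finset.sum_mul, Finset.sum_congr rfl fun i _ => hσs i j]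
    have h3 := le_abs_self (∑ i, σ j i - 1)
    have h4 := abs_nonneg (∑ i, σ j i - 1)
    nlinarith [haA j, norm_nonneg (a j - A)]
  have h3 := Finset.sum_le_sum fun i (_ : i ∈ Finset.univ) => h1 i
  rw [Finset.sum_add_distrib, ← Finset.mul_sum, Finset.sum_add_distrib,
    Finset.sum_add_distrib] at h3
  have h4 : 0 ≤ ∑ i, ‖a i - A‖ := Finset.sum_nonneg fun _ _ => norm_nonneg _
  have h5 : 0 ≤ ∑ i, |∑ j, σ i j - 1| := Finset.sum_nonneg fun _ _ => abs_nonneg _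
  have h6 : θ * (∑ i, ∑ j, σ i j * ‖a j - A‖ + ∑ i, |∑ j, σ i j - 1| + ∑ i, ‖a i - A‖)
      ≤ 1 / 4 * (2 * ∑ i, ‖a i - A‖ + 3 * ∑ i, |∑ j, σ i j - 1|) := by
    refine mul_le_mul hθ1 (by linarith) ?_ (by norm_num)
    have : 0 ≤ ∑ i, ∑ j, σ i j * ‖a j - A‖ := Finset.sum_nonneg fun i _ =>
      Finset.sum_nonneg fun j _ => mul_nonneg (hσ0 i j) (norm_nonneg _)
    linarith
  linarith

theorem re_one_sub_mul_nonneg {z w : ℂ} (hz : ‖z‖ ≤ 1) (hw : ‖w‖ ≤ 1) : 0 ≤ (1 - z * w).re := by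
  have h1 : (z * w).re ≤ ‖z * w‖ := Complex.re_le_norm _
  rw [norm_mul] at h1
  rw [Complex.sub_re, Complex.one_re]
  nlinarith [norm_nonneg z, norm_nonneg w]

/-- The summed self-consistent equation. The left side is a sum of nonnegative terms when `|a_i| ≤
1`, so bounds on it become bounds relating the row sums to the trace alone. -/
theorem sum_mul_re_one_sub_mul (hθ : 0 < θ)
    (he : ∀ i, e i = 1 - a i - θ * a i * ∑ j, σ i j * a j) :
    ∑ i, ∑ j, σ i j * (1 - a i * a j).re
      = ∑ i, ∑ j, σ i j - θ⁻¹ * (n - (∑ i, a i).re - (∑ i, e i).re) := by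
  have h1 : ∀ i, ∑ j, σ i j * (1 - a i * a j).re
      = ∑ j, σ i j - θ⁻¹ * (1 - (a i).re - (e i).re) := by
    intro i
    have h2 : ∑ j, σ i j * (1 - a i * a j).re
        = ∑ j, σ i j - (a i * ∑ j, (σ i j : ℂ) * a j).re := by
      rw [Finset.mul_sum, Complex.re_sum, ← Finset.sum_sub_distrib]
      refine Finset.sum_congr rfl fun j _ => ?_
      rw [mul_left_comm, Complex.re_ofReal_mul, Complex.sub_re, Complex.one_re]
      ring
    have h3 : θ * (a i * ∑ j, (σ i j : ℂ) * a j).re = 1 - (a i).re - (e i).re := by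
      rw [← Complex.re_ofReal_mul, ← Complex.one_re, ← Complex.sub_re, ← Complex.sub_re]
      congr 1
      rw [he i]
      ring
    rw [h2, ← h3, inv_mul_cancel_left₀ hθ.ne']
  simp only [h1, Finset.sum_sub_distrib, ← Finset.mul_sum, Complex.re_sum]
  simp

theorem le_sum_mul_re_add (hσ0 : ∀ i j, 0 ≤ σ i j) (ha : ∀ i, ‖a i‖ ≤ 1) (hθ : 0 < θ)
    (he : ∀ i, e i = 1 - a i - θ * a i * ∑ j, σ i j * a j) :
    θ⁻¹ * n - ∑ i, ∑ j, σ i j ≤ θ⁻¹ * (∑ i, a i).re + θ⁻¹ * ∑ i, ‖e i‖ := by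
  have h1 : 0 ≤ ∑ i, ∑ j, σ i j * (1 - a i * a j).re := Finset.sum_nonneg fun i _ =>
    Finset.sum_nonneg fun j _ => mul_nonneg (hσ0 i j) (re_one_sub_mul_nonneg (ha i) (ha j))
  rw [sum_mul_re_one_sub_mul hθ he] at h1
  have h2 : (∑ i, e i).re ≤ ∑ i, ‖e i‖ := (Complex.re_le_norm _).trans (norm_sum_le _ _)
  have h3 := mul_le_mul_of_nonneg_left h2 (inv_pos.mpr hθ).le
  linarith

theorem norm_one_sub_le (ha : ∀ i, ‖a i‖ ≤ 1) (hσ0 : ∀ i j, 0 ≤ σ i j) (hθ : 0 < θ)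
    (he : ∀ i, e i = 1 - a i - θ * a i * ∑ j, σ i j * a j) (i : Fin n) :
    ‖1 - a i‖ ≤ θ * ∑ j, σ i j + ‖e i‖ := by
  have h1 : 1 - a i = θ * (a i * ∑ j, (σ i j : ℂ) * a j) + e i := by rw [he i]; ring
  have h2 : ‖∑ j, (σ i j : ℂ) * a j‖ ≤ ∑ j, σ i j := norm_sum_le_of_le _ fun j _ => by
    rw [norm_mul, Complex.norm_real, Real.norm_of_nonneg (hσ0 i j)]
    exact mul_le_of_le_one_right (hσ0 i j) (ha j)
  rw [h1]
  refine (norm_add_le _ _).trans (add_le_add ?_ le_rfl)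
  rw [norm_mul, norm_mul, Complex.norm_real, Real.norm_of_nonneg hθ.le]
  exact mul_le_mul_of_nonneg_left
    ((mul_le_of_le_one_left (norm_nonneg _) (ha i)).trans h2) hθ.le

/-- Here `Re(1 - a_i a_j) ≤ |1 - a_i| + |1 - a_j|`, and symmetry reduces to `2 ∑ s_i |1 - a_i|`.
Rows with `s_i > K` use `|1 - a_i| ≤ 2`, the others `|1 - a_i| ≤ θ s_i + |e_i|`. -/
theorem sum_le_of_threshold (hσ0 : ∀ i j, 0 ≤ σ i j) (hσs : ∀ i j, σ i j = σ j i)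
    (ha : ∀ i, ‖a i‖ ≤ 1) (hθ : 0 < θ)
    (he : ∀ i, e i = 1 - a i - θ * a i * ∑ j, σ i j * a j) {K : ℝ} (hK : 0 ≤ K) :
    ∑ i, ∑ j, σ i j - θ⁻¹ * n - 4 * (∑ i with ¬ ∑ j, σ i j ≤ K, ∑ j, σ i j)
        - 2 * K * θ * ∑ i, ∑ j, σ i j
      ≤ -θ⁻¹ * (∑ i, a i).re + (θ⁻¹ + 2 * K) * ∑ i, ‖e i‖ := by
  have hs0 : ∀ i, 0 ≤ ∑ j, σ i j := fun i => Finset.sum_nonneg fun j _ => hσ0 i j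
  have h1 : ∑ i, ∑ j, σ i j * (1 - a i * a j).re ≤ 2 * ∑ i, (∑ j, σ i j) * ‖1 - a i‖ := by
    have h2 : ∀ i j, σ i j * (1 - a i * a j).re
        ≤ σ i j * ‖1 - a i‖ + σ j i * ‖1 - a j‖ := by
      intro i j
      rw [hσs j i, ← mul_add]
      refine mul_le_mul_of_nonneg_left ((Complex.re_le_norm _).trans ?_) (hσ0 i j)
      have : 1 - a i * a j = (1 - a i) + a i * (1 - a j) := by ring
      rw [this]
      refine (norm_add_le _ _).trans (add_le_add le_rfl ?_)
      rw [norm_mul]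
      exact mul_le_of_le_one_left (norm_nonneg _) (ha i)
    refine (Finset.sum_le_sum fun i _ => Finset.sum_le_sum fun j _ => h2 i j).trans_eq ?_
    simp only [Finset.sum_add_distrib]
    rw [Finset.sum_comm (f := fun i j => σ j i * ‖1 - a j‖)]
    simp only [← Finset.sum_mul]
    ring
  have h3 : ∑ i, (∑ j, σ i j) * ‖1 - a i‖ ≤ 2 * (∑ i with ¬ ∑ j, σ i j ≤ K, ∑ j, σ i j)
      + K * (θ * ∑ i, ∑ j, σ i j + ∑ i, ‖e i‖) := by
    rw [Finset.sum_filter, Finset.mul_sum, Finset.mul_sum, ← Finset.sum_add_distrib,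
      Finset.mul_sum, ← Finset.sum_add_distrib]
    refine Finset.sum_le_sum fun i _ => ?_
    have h4 := norm_one_sub_le ha hσ0 hθ he i
    have h5 : ‖1 - a i‖ ≤ 2 := (norm_sub_le _ _).trans (by rw [norm_one]; linarith [ha i])
    have h6 : 0 ≤ θ * ∑ j, σ i j + ‖e i‖ := add_nonneg (mul_nonneg hθ.le (hs0 i)) (norm_nonneg _)
    by_cases hi : ∑ j, σ i j ≤ K
    · rw [if_neg (not_not.mpr hi), mul_zero, zero_add]
      exact mul_le_mul hi h4 (norm_nonneg _) hK
    · rw [if_pos hi]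
      nlinarith [hs0 i, mul_nonneg hK h6]
  rw [sum_mul_re_one_sub_mul hθ he] at h1
  have h2 : -(∑ i, e i).re ≤ ∑ i, ‖e i‖ :=
    (neg_le_abs _).trans ((Complex.abs_re_le_norm _).trans (norm_sum_le _ _))
  have h4 := mul_le_mul_of_nonneg_left h2 (inv_pos.mpr hθ).le
  linarith

end Deterministic

/-! ### Self-consistent equation: the second-order bound. -/

section Deterministic

variable {n : ℕ} {σ : Fin n → Fin n → ℝ} {a e : Fin n → ℂ} {θ : ℝ}

/-- The row sums of the variance profile `σ` restricted to the rows and columns in `B`. -/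
def restrictedSum (σ : Fin n → Fin n → ℝ) (B : Finset (Fin n)) (i : Fin n) : ℝ :=
  if i ∈ B then ∑ j ∈ B, σ i j else 0

theorem restrictedSum_of_mem {B : Finset (Fin n)} {i : Fin n} (hi : i ∈ B) :
    restrictedSum σ B i = ∑ j ∈ B, σ i j := if_pos hi

theorem sum_restrictedSum_eq (σ : Fin n → Fin n → ℝ) (B : Finset (Fin n)) (f : ℝ → ℝ)
    (hf : f 0 = 0) : ∑ i, f (restrictedSum σ B i) = ∑ i ∈ B, f (∑ j ∈ B, σ i j) := by
  rw [← Finset.sum_subset (Finset.subset_univ B) fun i _ hi => by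
    rw [restrictedSum, if_neg hi, hf]]
  exact Finset.sum_congr rfl fun i hi => by rw [restrictedSum_of_mem hi]

/-- On `B`, `1 - a_i` has real part at least `θ y_i` up to order `θ²` and the errors `e`, where
`y_i` is the restricted row sum, and `|1 - a_i|²` is of order `θ²`. Thus `∑ σ_ij Re(1 - a_i a_j)` is
at least `2θ ∑ y_i²` up to order `θ²`; the bound `K` on the row sums makes the remainders explicit.
-/
theorem sum_sq_restrictedSum_le (hσ0 : ∀ i j, 0 ≤ σ i j) (hσs : ∀ i j, σ i j = σ j i)
    (ha : ∀ i, ‖a i‖ ≤ 1) (ha0 : ∀ i, 0 ≤ (a i).re) (hθ : 0 < θ) (hθ1 : θ ≤ 1)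
    (he : ∀ i, e i = 1 - a i - θ * a i * ∑ j, σ i j * a j) {K : ℝ} (hK : 1 ≤ K)
    {B : Finset (Fin n)} (hB : ∀ i ∈ B, ∑ j, σ i j ≤ K) :
    2 * θ * ∑ i, restrictedSum σ B i ^ 2 - ∑ i, ∑ j, σ i j + θ⁻¹ * n - 5 * θ ^ 2 * K ^ 3 * n
      ≤ θ⁻¹ * (∑ i, a i).re + (θ⁻¹ + 9 * K ^ 2) * ∑ i, ‖e i‖ := by
  have hK0 : 0 < K := by linarith
  let y : Fin n → ℝ := fun i => ∑ j ∈ B, σ i j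
  let d : Fin n → ℝ := fun i => ‖1 - a i‖
  have hd0 : ∀ i, 0 ≤ d i := fun i => norm_nonneg _
  have hy0 : ∀ i, 0 ≤ y i := fun i => Finset.sum_nonneg fun j _ => hσ0 i j
  have hys : ∀ i, y i ≤ ∑ j, σ i j := fun i =>
    Finset.sum_le_sum_of_subset_of_nonneg (Finset.subset_univ B) fun j _ _ => hσ0 i j
  have hyK : ∀ i ∈ B, y i ≤ K := fun i hi => (hys i).trans (hB i hi)
  have hd2 : ∀ i, d i ≤ 2 := fun i =>
    (norm_sub_le _ _).trans (by rw [norm_one]; linarith [ha i])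
  have hdK : ∀ i ∈ B, d i ≤ θ * K + ‖e i‖ := fun i hi =>
    (norm_one_sub_le ha hσ0 hθ he i).trans
      (add_le_add (mul_le_mul_of_nonneg_left (hB i hi) hθ.le) le_rfl)
  have hre : ∀ i ∈ B, θ * y i - θ * ∑ j ∈ B, σ i j * d j - θ * K * d i - ‖e i‖
      ≤ (1 - a i).re := by
    intro i hi
    set b : ℂ := ∑ j, (σ i j : ℂ) * a j with hb
    have h1 : 1 - a i = ((θ : ℝ) : ℂ) * (b - (1 - a i) * b) + e i := by rw [he i]; ring
    have h2 : ‖b‖ ≤ K := by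
      refine (norm_sum_le_of_le _ fun j _ => ?_).trans (hB i hi)
      rw [norm_mul, Complex.norm_real, Real.norm_of_nonneg (hσ0 i j)]
      exact mul_le_of_le_one_right (hσ0 i j) (ha j)
    have h3 : y i - ∑ j ∈ B, σ i j * d j ≤ b.re := by
      rw [hb, Complex.re_sum, ← Finset.sum_sub_distrib]
      -- Columns outside `B` may be dropped because `Re a_j ≥ 0`.
      have h4 : ∑ j ∈ B, ((σ i j : ℂ) * a j).re ≤ ∑ j, ((σ i j : ℂ) * a j).re :=
        Finset.sum_le_sum_of_subset_of_nonneg (Finset.subset_univ B) fun j _ _ => by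
          rw [Complex.re_ofReal_mul]; exact mul_nonneg (hσ0 i j) (ha0 j)
      refine le_trans (Finset.sum_le_sum fun j _ => ?_) h4
      have h5 : (1 - a j).re ≤ d j := Complex.re_le_norm _
      rw [Complex.sub_re, Complex.one_re] at h5
      rw [Complex.re_ofReal_mul]
      nlinarith [hσ0 i j]
    have h4 : ((1 - a i) * b).re ≤ K * d i := by
      refine (Complex.re_le_norm _).trans ?_
      rw [norm_mul, mul_comm]
      exact mul_le_mul_of_nonneg_right h2 (hd0 i)
    have h5 : -‖e i‖ ≤ (e i).re := by
      have := (neg_le_abs _).trans (Complex.abs_re_le_norm (e i))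
      linarith
    have h6 : (1 - a i).re = θ * (b.re - ((1 - a i) * b).re) + (e i).re := by
      conv_lhs => rw [h1]
      rw [Complex.add_re, Complex.re_ofReal_mul, Complex.sub_re]
    rw [h6]
    nlinarith
  -- Expand `1 - zw = (1 - z) + (1 - w) - (1 - z)(1 - w)` and apply AM-GM to the product; the result
  -- is symmetric in `i` and `j`, so it sums to row expressions.
  have hpair : ∀ i j, σ i j * (1 - a i).re + σ j i * (1 - a j).re
      - (σ i j * d i ^ 2 + σ j i * d j ^ 2) / 2 ≤ σ i j * (1 - a i * a j).re := by
    intro i j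
    have h1 : (1 - a i * a j).re
        = (1 - a i).re + (1 - a j).re - ((1 - a i) * (1 - a j)).re := by
      rw [show 1 - a i * a j = (1 - a i) + (1 - a j) - (1 - a i) * (1 - a j) by ring]
      simp only [Complex.sub_re, Complex.add_re]
    have h2 : ((1 - a i) * (1 - a j)).re ≤ d i * d j := by
      refine (Complex.re_le_norm _).trans ?_
      rw [norm_mul]
    rw [hσs j i, h1]
    nlinarith [hσ0 i j, mul_nonneg (hσ0 i j) (sq_nonneg (d i - d j)),
      mul_nonneg (hσ0 i j) (sub_nonneg.mpr h2)]
  have hlow : 2 * ∑ i ∈ B, y i * (1 - a i).re - ∑ i ∈ B, y i * d i ^ 2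
      ≤ ∑ i, ∑ j, σ i j * (1 - a i * a j).re := by
    have hnn : ∀ i j, 0 ≤ σ i j * (1 - a i * a j).re := fun i j =>
      mul_nonneg (hσ0 i j) (re_one_sub_mul_nonneg (ha i) (ha j))
    calc 2 * ∑ i ∈ B, y i * (1 - a i).re - ∑ i ∈ B, y i * d i ^ 2
        = ∑ i ∈ B, ∑ j ∈ B, (σ i j * (1 - a i).re + σ j i * (1 - a j).re
            - (σ i j * d i ^ 2 + σ j i * d j ^ 2) / 2) := by
          simp only [Finset.sum_sub_distrib, ← Finset.sum_div, Finset.sum_add_distrib]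
          rw [Finset.sum_comm (f := fun i j => σ j i * (1 - a j).re),
            Finset.sum_comm (f := fun i j => σ j i * d j ^ 2)]
          simp only [← Finset.sum_mul, y]
          ring
      _ ≤ ∑ i ∈ B, ∑ j ∈ B, σ i j * (1 - a i * a j).re :=
          Finset.sum_le_sum fun i _ => Finset.sum_le_sum fun j _ => hpair i j
      _ ≤ ∑ i ∈ B, ∑ j, σ i j * (1 - a i * a j).re :=
          Finset.sum_le_sum fun i _ => Finset.sum_le_sum_of_subset_of_nonneg
            (Finset.subset_univ B) fun j _ _ => hnn i j
      _ ≤ _ := Finset.sum_le_sum_of_subset_of_nonneg (Finset.subset_univ B)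
          fun i _ _ => Finset.sum_nonneg fun j _ => hnn i j
  have hcross : ∑ i ∈ B, y i * ∑ j ∈ B, σ i j * d j ≤ ∑ i ∈ B, K ^ 2 * d i := by
    calc ∑ i ∈ B, y i * ∑ j ∈ B, σ i j * d j ≤ ∑ i ∈ B, K * ∑ j ∈ B, σ i j * d j :=
          Finset.sum_le_sum fun i hi => mul_le_mul_of_nonneg_right (hyK i hi)
            (Finset.sum_nonneg fun j _ => mul_nonneg (hσ0 i j) (hd0 j))
      _ = ∑ j ∈ B, K * (y j * d j) := by
          rw [← Finset.mul_sum, Finset.sum_comm, Finset.mul_sum]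
          refine Finset.sum_congr rfl fun j _ => ?_
          rw [← Finset.sum_mul, Finset.sum_congr rfl fun i _ => hσs i j]
      _ ≤ ∑ i ∈ B, K ^ 2 * d i := Finset.sum_le_sum fun i hi => by
          nlinarith [mul_nonneg hK0.le (mul_nonneg (sub_nonneg.mpr (hyK i hi)) (hd0 i))]
  have hterm : ∀ i ∈ B, 2 * θ * y i ^ 2 - 2 * θ * (y i * ∑ j ∈ B, σ i j * d j)
      - 3 * θ * K ^ 2 * d i - 4 * K * ‖e i‖ ≤ 2 * (y i * (1 - a i).re) - y i * d i ^ 2 := by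
    intro i hi
    have h1 := mul_le_mul_of_nonneg_left (hre i hi) (hy0 i)
    have h2 : y i * d i ^ 2 ≤ θ * K ^ 2 * d i + 2 * K * ‖e i‖ := by
      have h3 : d i ^ 2 ≤ θ * K * d i + 2 * ‖e i‖ := by
        nlinarith [mul_le_mul_of_nonneg_right (hdK i hi) (hd0 i),
          mul_le_mul_of_nonneg_right (hd2 i) (norm_nonneg (e i))]
      have h4 := mul_le_mul (hyK i hi) h3 (sq_nonneg _) hK0.le
      nlinarith
    have h3 : y i * (θ * K * d i) ≤ θ * K ^ 2 * d i := by
      have := mul_le_mul_of_nonneg_right (hyK i hi)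
        (mul_nonneg (mul_nonneg hθ.le hK0.le) (hd0 i))
      nlinarith
    have h4 : y i * ‖e i‖ ≤ K * ‖e i‖ := mul_le_mul_of_nonneg_right (hyK i hi) (norm_nonneg _)
    nlinarith
  have hsum := Finset.sum_le_sum hterm
  simp only [Finset.sum_sub_distrib, ← Finset.mul_sum] at hsum hcross
  have hdsum : ∑ i ∈ B, d i ≤ θ * K * n + ∑ i, ‖e i‖ := by
    calc ∑ i ∈ B, d i ≤ ∑ i ∈ B, (θ * K + ‖e i‖) := Finset.sum_le_sum hdK
      _ ≤ ∑ i, (θ * K + ‖e i‖) := Finset.sum_le_sum_of_subset_of_nonneg (Finset.subset_univ B)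
          fun i _ _ => by positivity
      _ = θ * K * n + ∑ i, ‖e i‖ := by
          rw [Finset.sum_add_distrib, Finset.sum_const, Finset.card_univ, Fintype.card_fin,
            nsmul_eq_mul]
          ring
  have hesum : ∑ i ∈ B, ‖e i‖ ≤ ∑ i, ‖e i‖ :=
    Finset.sum_le_sum_of_subset_of_nonneg (Finset.subset_univ B) fun i _ _ => norm_nonneg _
  have he0 : 0 ≤ ∑ i, ‖e i‖ := Finset.sum_nonneg fun i _ => norm_nonneg _
  rw [sum_mul_re_one_sub_mul hθ he] at hlow
  have hee : (∑ i, e i).re ≤ ∑ i, ‖e i‖ := (Complex.re_le_norm _).trans (norm_sum_le _ _)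
  have hee' := mul_le_mul_of_nonneg_left hee (inv_pos.mpr hθ).le
  have hYsum : ∑ i, restrictedSum σ B i ^ 2 = ∑ i ∈ B, y i ^ 2 :=
    sum_restrictedSum_eq σ B (fun t => t ^ 2) (by norm_num)
  rw [hYsum]
  have hc2 := mul_le_mul_of_nonneg_left hcross (by positivity : 0 ≤ 2 * θ)
  -- The 5 collects `2θK²` from the cross terms and `3θK²` from the individual terms.
  have hd5 := mul_le_mul_of_nonneg_left hdsum (by positivity : 0 ≤ 5 * θ * K ^ 2)
  have he4 := mul_le_mul_of_nonneg_left hesum (by positivity : 0 ≤ 4 * K)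
  have hfin : (5 * θ * K ^ 2 + 4 * K) * ∑ i, ‖e i‖ ≤ 9 * K ^ 2 * ∑ i, ‖e i‖ := by
    refine mul_le_mul_of_nonneg_right ?_ he0
    nlinarith
  linarith

theorem sum_sub_restrictedSum_le (hσ0 : ∀ i j, 0 ≤ σ i j) (hσs : ∀ i j, σ i j = σ j i)
    (B : Finset (Fin n)) :
    ∑ i, (∑ j, σ i j - restrictedSum σ B i) ≤ 2 * ∑ i ∈ Bᶜ, ∑ j, σ i j := by
  have h1 : ∀ i, ∑ j, σ i j - restrictedSum σ B i
      ≤ (if i ∈ Bᶜ then ∑ j, σ i j else 0) + ∑ j ∈ Bᶜ, σ i j := by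
    intro i
    have h0 : 0 ≤ ∑ j ∈ Bᶜ, σ i j := Finset.sum_nonneg fun j _ => hσ0 i j
    by_cases hi : i ∈ B
    · rw [restrictedSum_of_mem hi, if_neg (by simpa using hi),
        ← Finset.sum_add_sum_compl B (fun j => σ i j)]
      linarith
    · rw [restrictedSum, if_neg hi, if_pos (Finset.mem_compl.mpr hi)]
      linarith
  refine (Finset.sum_le_sum fun i _ => h1 i).trans_eq ?_
  have h2 : ∑ i, ∑ j ∈ Bᶜ, σ i j = ∑ i ∈ Bᶜ, ∑ j, σ i j := by
    rw [Finset.sum_comm]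
    exact Finset.sum_congr rfl fun j _ => Finset.sum_congr rfl fun i _ => hσs i j
  rw [Finset.sum_add_distrib, ← Finset.sum_filter, Finset.filter_univ_mem, h2]
  ring

theorem restrictedSum_le (hσ0 : ∀ i j, 0 ≤ σ i j) (B : Finset (Fin n)) (i : Fin n) :
    restrictedSum σ B i ≤ ∑ j, σ i j := by
  rw [restrictedSum]
  split_ifs
  · exact Finset.sum_le_sum_of_subset_of_nonneg (Finset.subset_univ B) fun j _ _ => hσ0 i j
  · exact Finset.sum_nonneg fun j _ => hσ0 i j

/-- Discarding the rows and columns outside `B` costs at most twice the mass of the rows outside, by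
symmetry. For the restricted sums `y`, `|y - 1| ≤ c/2 + (y - 1)²/(2c)` reduces the claim to first
and second moments. -/
theorem sum_abs_sub_one_le (hσ0 : ∀ i j, 0 ≤ σ i j) (hσs : ∀ i j, σ i j = σ j i)
    (B : Finset (Fin n)) {c : ℝ} (hc : 0 < c) :
    ∑ i, |∑ j, σ i j - 1| ≤ 2 * ∑ i ∈ Bᶜ, ∑ j, σ i j + c / 2 * n
      + (2 * c)⁻¹ * (∑ i, restrictedSum σ B i ^ 2 - 2 * ∑ i, ∑ j, σ i j
        + 4 * ∑ i ∈ Bᶜ, ∑ j, σ i j + n) := by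
  have h1 : ∀ i, |∑ j, σ i j - 1| ≤ (∑ j, σ i j - restrictedSum σ B i) + c / 2
      + (2 * c)⁻¹ * (restrictedSum σ B i ^ 2 - 2 * restrictedSum σ B i + 1) := by
    intro i
    set y := restrictedSum σ B i
    have h2 : |∑ j, σ i j - 1| ≤ (∑ j, σ i j - y) + |y - 1| := by
      have : ∑ j, σ i j - 1 = (∑ j, σ i j - y) + (y - 1) := by ring
      rw [this]
      refine (abs_add_le _ _).trans (add_le_add (abs_of_nonneg ?_).le le_rfl)
      exact sub_nonneg.mpr (restrictedSum_le hσ0 B i)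
    have h3 : |y - 1| ≤ c / 2 + (2 * c)⁻¹ * (y ^ 2 - 2 * y + 1) := by
      have h4 : 0 ≤ (2 * c)⁻¹ * (|y - 1| - c) ^ 2 := by positivity
      have h5 : (2 * c)⁻¹ * (|y - 1| - c) ^ 2
          = (2 * c)⁻¹ * (y ^ 2 - 2 * y + 1) - |y - 1| + c / 2 := by
        rw [sub_sq, sq_abs]
        field_simp
        ring
      linarith
    linarith
  refine (Finset.sum_le_sum fun i _ => h1 i).trans ?_
  have h2 := sum_sub_restrictedSum_le hσ0 hσs B
  have h3 : ∑ i : Fin n, (1 : ℝ) = n := by simp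
  have h4 : ∑ i : Fin n, c / 2 = c / 2 * n := by simp [mul_comm]
  have h5 : ∑ i, (restrictedSum σ B i ^ 2 - 2 * restrictedSum σ B i + 1)
      ≤ ∑ i, restrictedSum σ B i ^ 2 - 2 * ∑ i, ∑ j, σ i j + 4 * ∑ i ∈ Bᶜ, ∑ j, σ i j + n := by
    rw [Finset.sum_add_distrib, Finset.sum_sub_distrib, ← Finset.mul_sum, h3]
    rw [Finset.sum_sub_distrib] at h2
    linarith
  rw [Finset.sum_add_distrib, Finset.sum_add_distrib, ← Finset.mul_sum, h4]
  have h6 := mul_le_mul_of_nonneg_left h5 (by positivity : 0 ≤ (2 * c)⁻¹)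
  linarith

end Deterministic

/-! ### Passage to the limit, first in `n` and then in `η`. -/

theorem sq_mul_one_sub_semicircleTransform {η : ℝ} (hη : 0 < η) :
    η ^ 2 * (1 - semicircleTransform η) = semicircleTransform η ^ 2 := by
  have h := semicircleTransform_eq hη
  have h1 : 1 - semicircleTransform η = (η ^ 2)⁻¹ * semicircleTransform η ^ 2 := by linarith
  rw [h1, mul_inv_cancel_left₀ (by positivity)]

theorem one_sub_le_semicircleTransform_sq {η : ℝ} (hη : 0 < η) :
    1 - 2 * (η ^ 2)⁻¹ ≤ semicircleTransform η ^ 2 := by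
  have h := semicircleTransform_eq hη
  have h0 := semicircleTransform_nonneg hη
  have h1 := semicircleTransform_le_one hη
  have h2 : 0 < (η ^ 2)⁻¹ := by positivity
  have h3 : semicircleTransform η ^ 2 ≤ 1 := (sq_le_one_iff₀ h0).mpr h1
  have h4 : 1 - (η ^ 2)⁻¹ ≤ semicircleTransform η := by nlinarith
  nlinarith [sq_nonneg (1 - semicircleTransform η)]

theorem exists_one_le_inv_sq_mul_le (C : ℝ) {γ : ℝ} (hγ : 0 < γ) :
    ∃ η : ℝ, 1 ≤ η ∧ C * (η ^ 2)⁻¹ ≤ γ := by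
  have h1 : Tendsto (fun η : ℝ => C * (η ^ 2)⁻¹) atTop (𝓝 (C * 0)) :=
    ((tendsto_pow_atTop two_ne_zero).inv_tendsto_atTop).const_mul C
  rw [mul_zero] at h1
  obtain ⟨η, h2, h3⟩ := ((h1.eventually_le_const hγ).and (eventually_ge_atTop 1)).exists
  exact ⟨η, h3, h2⟩

section Limits

variable {m ρ δ : ℕ → ℝ} {β τ Y : ℝ → ℕ → ℝ}

/-- For fixed `η`, the main terms of both bounds tend to `A²`, which lies in `[1 - 2/η², 1]`. The
threshold `K` is chosen first to make the tail small, then `η` large depending on `K` and the a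
priori bound `M`. -/
theorem tendsto_average_of_bounds {M : ℝ} (hM : ∀ᶠ n in atTop, m n ≤ M)
    (hδ : Tendsto δ atTop (𝓝 0))
    (hβ : ∀ η : ℝ, 1 ≤ η → Tendsto (β η) atTop (𝓝 (semicircleTransform η)))
    (hτ : ∀ γ : ℝ, 0 < γ → ∃ K : ℝ, 1 ≤ K ∧ ∀ᶠ n in atTop, τ K n ≤ γ)
    (h1 : ∀ η : ℝ, 1 ≤ η → ∀ᶠ n in atTop, η ^ 2 * (1 - β η n - δ n) ≤ m n)
    (h2 : ∀ η K : ℝ, 1 ≤ η → 1 ≤ K → ∀ᶠ n in atTop,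
      m n ≤ η ^ 2 * (1 - β η n + δ n) + 4 * τ K n + 2 * K * ((η ^ 2)⁻¹ * m n + δ n)) :
    Tendsto m atTop (𝓝 1) := by
  rw [Metric.tendsto_nhds]
  intro γ' hγ'
  obtain ⟨γ, hγ, hγγ⟩ : ∃ γ : ℝ, 0 < γ ∧ 10 * γ = γ' := ⟨γ' / 10, by positivity, by ring⟩
  obtain ⟨K, hK, hKτ⟩ := hτ γ hγ
  obtain ⟨η, hη, hηγ⟩ := exists_one_le_inv_sq_mul_le (2 * K * |M| + 2) hγ
  have hη0 : 0 < η := by linarith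
  have hθ : 0 < (η ^ 2)⁻¹ := by positivity
  have hlow := one_sub_le_semicircleTransform_sq hη0
  have hup : semicircleTransform η ^ 2 ≤ 1 :=
    (sq_le_one_iff₀ (semicircleTransform_nonneg hη0)).mpr (semicircleTransform_le_one hη0)
  have t1 : Tendsto (fun n => η ^ 2 * (1 - β η n - δ n)) atTop
      (𝓝 (semicircleTransform η ^ 2)) := by
    have := (((hβ η hη).const_sub 1).sub hδ).const_mul (η ^ 2)
    rwa [sub_zero, sq_mul_one_sub_semicircleTransform hη0] at this
  have t2 : Tendsto (fun n => η ^ 2 * (1 - β η n + δ n) + 2 * K * δ n) atTop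
      (𝓝 (semicircleTransform η ^ 2)) := by
    have := ((((hβ η hη).const_sub 1).add hδ).const_mul (η ^ 2)).add (hδ.const_mul (2 * K))
    rwa [add_zero, mul_zero, add_zero, sq_mul_one_sub_semicircleTransform hη0] at this
  filter_upwards [hM, hKτ, h1 η hη, h2 η K hη hK, t1.eventually_const_le (sub_lt_self _ hγ),
    t2.eventually_le_const (lt_add_of_pos_right _ hγ)] with n e1 e2 e3 e4 e5 e6
  have e7 : 2 * K * ((η ^ 2)⁻¹ * m n) ≤ 2 * K * |M| * (η ^ 2)⁻¹ := by
    have : (η ^ 2)⁻¹ * m n ≤ (η ^ 2)⁻¹ * |M| :=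
      mul_le_mul_of_nonneg_left (e1.trans (le_abs_self M)) hθ.le
    nlinarith
  have e8 : 0 ≤ 2 * K * |M| * (η ^ 2)⁻¹ := by positivity
  rw [Real.dist_eq, abs_lt]
  constructor <;> nlinarith

/-- Multiplying by `η²/2` turns the leading term into `η²(1 - A²)/2 ≤ 1` and leaves a remainder of
order `K³/η²`. -/
theorem eventually_average_sq_le_of_bounds (hm : Tendsto m atTop (𝓝 1))
    (hδ : Tendsto δ atTop (𝓝 0))
    (hβ : ∀ η : ℝ, 1 ≤ η → Tendsto (β η) atTop (𝓝 (semicircleTransform η)))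
    {K : ℝ} (h3 : ∀ η : ℝ, 1 ≤ η → ∀ᶠ n in atTop,
      2 * (η ^ 2)⁻¹ * Y K n ≤ m n - η ^ 2 * (1 - β η n) + (η ^ 2 + 9 * K ^ 2) * δ n
        + 5 * (η ^ 2)⁻¹ ^ 2 * K ^ 3) {γ : ℝ} (hγ : 0 < γ) :
    ∀ᶠ n in atTop, Y K n ≤ 1 + γ := by
  obtain ⟨η, hη, hηγ⟩ := exists_one_le_inv_sq_mul_le (5 * K ^ 3) hγ
  have hη0 : 0 < η := by linarith
  have hlow := one_sub_le_semicircleTransform_sq hη0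
  have t1 : Tendsto (fun n => η ^ 2 / 2 * (m n - η ^ 2 * (1 - β η n)
      + (η ^ 2 + 9 * K ^ 2) * δ n)) atTop
      (𝓝 (η ^ 2 / 2 * (1 - semicircleTransform η ^ 2))) := by
    have := ((hm.sub (((hβ η hη).const_sub 1).const_mul (η ^ 2))).add
      (hδ.const_mul (η ^ 2 + 9 * K ^ 2))).const_mul (η ^ 2 / 2)
    rwa [mul_zero, add_zero, sq_mul_one_sub_semicircleTransform hη0] at this
  have hlim : η ^ 2 / 2 * (1 - semicircleTransform η ^ 2) ≤ 1 := by
    calc η ^ 2 / 2 * (1 - semicircleTransform η ^ 2) ≤ η ^ 2 / 2 * (2 * (η ^ 2)⁻¹) :=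
          mul_le_mul_of_nonneg_left (by linarith) (by positivity)
      _ = 1 := by field_simp
  filter_upwards [h3 η hη, t1.eventually_le_const
    (show η ^ 2 / 2 * (1 - semicircleTransform η ^ 2) < 1 + γ / 2 by linarith)] with n e1 e2
  have e3 := mul_le_mul_of_nonneg_left e1 (by positivity : 0 ≤ η ^ 2 / 2)
  have e4 : η ^ 2 / 2 * (2 * (η ^ 2)⁻¹ * Y K n) = Y K n := by field_simp
  have e5 : η ^ 2 / 2 * (5 * (η ^ 2)⁻¹ ^ 2 * K ^ 3) = 5 * K ^ 3 * (η ^ 2)⁻¹ / 2 := by field_simp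
  rw [e4, mul_add, e5] at e3
  linarith

theorem tendsto_deviation_of_bounds (hm : Tendsto m atTop (𝓝 1)) (hρ0 : ∀ n, 0 ≤ ρ n)
    (hτ : ∀ γ : ℝ, 0 < γ → ∃ K : ℝ, 1 ≤ K ∧ ∀ᶠ n in atTop, τ K n ≤ γ)
    (hY : ∀ K γ : ℝ, 1 ≤ K → 0 < γ → ∀ᶠ n in atTop, Y K n ≤ 1 + γ)
    (h5 : ∀ K c : ℝ, 0 < c → ∀ᶠ n in atTop,
      ρ n ≤ 2 * τ K n + c / 2 + (2 * c)⁻¹ * (Y K n - 2 * m n + 4 * τ K n + 1)) :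
    Tendsto ρ atTop (𝓝 0) := by
  rw [Metric.tendsto_nhds]
  intro γ hγ
  -- With `c = γ`, the bracket is at most `(1 + t) - 2(1 - t) + 4t + 1 = 7t ≤ γ²/4`, so the three
  -- terms add up to at most `γ/4 + γ/2 + γ/8 < γ`.
  obtain ⟨t, ht, ht1, ht2⟩ : ∃ t : ℝ, 0 < t ∧ t ≤ γ / 8 ∧ t ≤ γ ^ 2 / 28 :=
    ⟨min (γ / 8) (γ ^ 2 / 28), lt_min (by positivity) (by positivity), min_le_left _ _,
      min_le_right _ _⟩
  obtain ⟨K, hK, hKτ⟩ := hτ t ht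
  filter_upwards [hKτ, hY K t hK ht, h5 K γ hγ,
    hm.eventually_const_le (sub_lt_self 1 ht)] with n e1 e2 e3 e4
  have e5 : (2 * γ)⁻¹ * (Y K n - 2 * m n + 4 * τ K n + 1) ≤ (2 * γ)⁻¹ * (7 * (γ ^ 2 / 28)) :=
    mul_le_mul_of_nonneg_left (by linarith) (by positivity)
  have e6 : (2 * γ)⁻¹ * (7 * (γ ^ 2 / 28)) = γ / 8 := by field_simp; norm_num
  rw [Real.dist_0_eq_abs, abs_of_nonneg (hρ0 n)]
  linarith

end Limits

/-! ### Expectations of the deterministic inequalities. -/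

section RandomMatrix

variable {Ω : Type*} [mΩ : MeasurableSpace Ω] {P : Measure Ω} [IsProbabilityMeasure P]
  {n : ℕ} {X : Ω → Matrix (Fin n) (Fin n) ℂ}

/-- The variance profile `E|x_ij|²` of a random matrix. -/
noncomputable def varProfile (P : Measure Ω) (X : Ω → Matrix (Fin n) (Fin n) ℂ)
    (i j : Fin n) : ℝ :=
  ∫ ω, ‖X ω i j‖ ^ 2 ∂P

omit [IsProbabilityMeasure P] in
theorem varProfile_nonneg (i j : Fin n) : 0 ≤ varProfile P X i j :=
  integral_nonneg fun _ => by positivity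

omit [IsProbabilityMeasure P] in
theorem varProfile_comm (hH : ∀ ω, (X ω).IsHermitian) (i j : Fin n) :
    varProfile P X i j = varProfile P X j i := by
  refine integral_congr_ae (ae_of_all _ fun ω => ?_)
  simp only [← (hH ω).apply i j, norm_star]

omit [IsProbabilityMeasure P] in
theorem sum_varProfile (i : Fin n) : ∑ j, varProfile P X i j = rowSum P X i := rfl

theorem sum_integral_norm_selfConsistencyError_le (hX : ∀ i j, Measurable fun ω => X ω i j)
    (hH : ∀ ω, (X ω).IsHermitian)
    (hind : iIndepFun (fun (p : {p : Fin n × Fin n // p.1 ≤ p.2}) ω => X ω p.1.1 p.1.2) P)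
    {ε : ℝ} (hε : 0 < ε) (hε1 : ε ≤ 1) (hmean : ∀ i j, ∫ ω, X ω i j ∂P = 0)
    (hbdd : ∀ i j, ∀ᵐ ω ∂P, ‖X ω i j‖ ≤ ε) {η : ℝ} (hη : 1 ≤ η) :
    ∑ i, ∫ ω, ‖selfConsistencyError η (X ω) (varProfile P X i) i‖ ∂P
      ≤ 6 * ε * (n + ∑ i, rowSum P X i) := by
  refine (Finset.sum_le_sum fun i _ =>
    integral_norm_selfConsistencyError_le hX hH hind hε hε1 hmean hbdd hη i).trans_eq ?_
  rw [← Finset.mul_sum, Finset.sum_add_distrib]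
  simp

/-- Common transfer for the necessity bounds: each is pointwise linear in `Re ∑ a_i` and `∑|e_i|`,
whose normalized expectations are respectively the Cauchy integral and a quantity of order `ε`. -/
theorem le_of_forall_le_diagResolvent (hX : ∀ i j, Measurable fun ω => X ω i j)
    (hH : ∀ ω, (X ω).IsHermitian)
    (hind : iIndepFun (fun (p : {p : Fin n × Fin n // p.1 ≤ p.2}) ω => X ω p.1.1 p.1.2) P)
    {ε : ℝ} (hε : 0 < ε) (hε1 : ε ≤ 1) (hmean : ∀ i j, ∫ ω, X ω i j ∂P = 0)
    (hbdd : ∀ i j, ∀ᵐ ω ∂P, ‖X ω i j‖ ≤ ε) {η : ℝ} (hη : 1 ≤ η) (hn : 0 < n) {c p q : ℝ}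
    (hq : 0 ≤ q) (h : ∀ ω, c ≤ p * (∑ i, diagResolvent η (X ω) i).re
      + q * ∑ i, ‖selfConsistencyError η (X ω) (varProfile P X i) i‖) :
    1 / (n : ℝ) * c ≤ p * (∫ x, cauchyKernel η x ∂(meanSpectral P X hH : Measure ℝ)).re
      + q * (6 * ε * (1 + 1 / (n : ℝ) * ∑ i, rowSum P X i)) := by
  have hη0 : 0 < η := by linarith
  have hn0 : (0 : ℝ) < n := by exact_mod_cast hn
  have hI1 : Integrable (fun ω => ∑ i, diagResolvent η (X ω) i) P :=
    integrable_finsetSum _ fun i _ => integrable_of_memLp_top (memLp_diagResolvent hX hH hη0 i)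
  have hI2 : ∀ i, Integrable
      (fun ω => ‖selfConsistencyError η (X ω) (varProfile P X i) i‖) P := fun i =>
    (integrable_of_memLp_top (memLp_selfConsistencyError hX hH hη0 _ i)).norm
  have hI3 : Integrable (fun ω => (∑ i, diagResolvent η (X ω) i).re) P := hI1.re
  have h1 : c ≤ ∫ ω, (p * (∑ i, diagResolvent η (X ω) i).re
      + q * ∑ i, ‖selfConsistencyError η (X ω) (varProfile P X i) i‖) ∂P := by
    have := integral_mono (μ := P) (integrable_const c)
      ((hI3.const_mul p).add ((integrable_finsetSum Finset.univ fun i _ => hI2 i).const_mul q)) h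
    simpa using this
  rw [integral_add (hI3.const_mul p) ((integrable_finsetSum _ fun i _ => hI2 i).const_mul q),
    integral_const_mul, integral_const_mul, integral_finsetSum _ fun i _ => hI2 i] at h1
  have h2 := sum_integral_norm_selfConsistencyError_le hX hH hind hε hε1 hmean hbdd hη
  have h3 : ∫ ω, (∑ i, diagResolvent η (X ω) i).re ∂P
      = n * (∫ x, cauchyKernel η x ∂(meanSpectral P X hH : Measure ℝ)).re := by
    rw [integral_cauchyKernel_meanSpectral P hX hH hη0, integral_const_mul, Complex.re_ofReal_mul,
      mul_inv_cancel_left₀ hn0.ne']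
    exact integral_re hI1
  rw [h3] at h1
  have h4 := h1.trans (add_le_add le_rfl (mul_le_mul_of_nonneg_left h2 hq))
  have h5 := mul_le_mul_of_nonneg_left h4 (by positivity : 0 ≤ 1 / (n : ℝ))
  refine h5.trans_eq ?_
  field_simp

end RandomMatrix

section RandomMatrix

variable {Ω : Type*} [mΩ : MeasurableSpace Ω] {P : Measure Ω} [IsProbabilityMeasure P]
  {n : ℕ} {X : Ω → Matrix (Fin n) (Fin n) ℂ}

theorem norm_integral_cauchyKernel_meanSpectral_sub_le
    (hX : ∀ i j, Measurable fun ω => X ω i j) (hH : ∀ ω, (X ω).IsHermitian)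
    (hind : iIndepFun (fun (p : {p : Fin n × Fin n // p.1 ≤ p.2}) ω => X ω p.1.1 p.1.2) P)
    {ε : ℝ} (hε : 0 < ε) (hε1 : ε ≤ 1) (hmean : ∀ i j, ∫ ω, X ω i j ∂P = 0)
    (hbdd : ∀ i j, ∀ᵐ ω ∂P, ‖X ω i j‖ ≤ ε) {η : ℝ} (hη : 2 ≤ η) (hn : 0 < n) :
    ‖∫ x, cauchyKernel η x ∂(meanSpectral P X hH : Measure ℝ) - semicircleTransform η‖
      ≤ 3 / 2 * (1 / (n : ℝ) * ∑ i, |rowSum P X i - 1|)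
        + 2 * (6 * ε * (1 + 1 / (n : ℝ) * ∑ i, rowSum P X i)) := by
  have hη0 : 0 < η := by linarith
  have hn0 : (0 : ℝ) < n := by exact_mod_cast hn
  have hθ1 : (η ^ 2)⁻¹ ≤ 1 / 4 := by
    rw [inv_eq_one_div]
    exact one_div_le_one_div_of_le (by norm_num) (by nlinarith)
  have hpt : ∀ ω, ∑ i, ‖diagResolvent η (X ω) i - semicircleTransform η‖
      ≤ 3 / 2 * ∑ i, |rowSum P X i - 1|
        + 2 * ∑ i, ‖selfConsistencyError η (X ω) (varProfile P X i) i‖ := fun ω =>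
    sum_norm_sub_le (θ := (η ^ 2)⁻¹) varProfile_nonneg (varProfile_comm hH)
      (norm_diagResolvent_le hη0 (hH ω)) (by positivity) hθ1
      (fun i => by rw [selfConsistencyError])
      (semicircleTransform_nonneg hη0) (semicircleTransform_le_one hη0)
      (semicircleTransform_eq hη0)
  have hI1 : ∀ i, Integrable (fun ω => diagResolvent η (X ω) i) P := fun i =>
    integrable_of_memLp_top (memLp_diagResolvent hX hH hη0 i)
  have hI2 : ∀ i, Integrable
      (fun ω => ‖selfConsistencyError η (X ω) (varProfile P X i) i‖) P := fun i =>
    (integrable_of_memLp_top (memLp_selfConsistencyError hX hH hη0 _ i)).norm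
  have hI3 : Integrable (fun ω => ∑ i, ‖diagResolvent η (X ω) i - semicircleTransform η‖) P :=
    integrable_finsetSum _ fun i _ => ((hI1 i).sub (integrable_const _)).norm
  have h1 : ∫ x, cauchyKernel η x ∂(meanSpectral P X hH : Measure ℝ) - semicircleTransform η
      = ((n : ℝ)⁻¹ : ℝ) * ∫ ω, ∑ i, (diagResolvent η (X ω) i - semicircleTransform η) ∂P := by
    simp only [Finset.sum_sub_distrib]
    rw [integral_sub (integrable_finsetSum _ fun i _ => hI1 i) (integrable_const _),
      integral_cauchyKernel_meanSpectral P hX hH hη0, integral_const_mul, mul_sub]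
    congr 1
    have : (n : ℂ) ≠ 0 := by exact_mod_cast hn0.ne'
    simp [this]
  rw [h1, norm_mul, Complex.norm_real, Real.norm_of_nonneg (by positivity)]
  have h2 : ‖∫ ω, ∑ i, (diagResolvent η (X ω) i - semicircleTransform η) ∂P‖
      ≤ 3 / 2 * ∑ i, |rowSum P X i - 1| + 2 * (6 * ε * (n + ∑ i, rowSum P X i)) := by
    calc _ ≤ ∫ ω, ∑ i, ‖diagResolvent η (X ω) i - semicircleTransform η‖ ∂P :=
          (norm_integral_le_integral_norm _).trans (integral_mono
            (integrable_finsetSum _ fun i _ => (hI1 i).sub (integrable_const _)).norm hI3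
            fun ω => norm_sum_le _ _)
      _ ≤ ∫ ω, (3 / 2 * ∑ i, |rowSum P X i - 1|
            + 2 * ∑ i, ‖selfConsistencyError η (X ω) (varProfile P X i) i‖) ∂P :=
          integral_mono hI3 ((integrable_const _).add
            ((integrable_finsetSum _ fun i _ => hI2 i).const_mul 2)) hpt
      _ = 3 / 2 * ∑ i, |rowSum P X i - 1|
            + 2 * ∑ i, ∫ ω, ‖selfConsistencyError η (X ω) (varProfile P X i) i‖ ∂P := by
          rw [integral_add (integrable_const _)
            ((integrable_finsetSum _ fun i _ => hI2 i).const_mul 2), integral_const,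
            probReal_univ, one_smul, integral_const_mul, integral_finsetSum _ fun i _ => hI2 i]
      _ ≤ _ := by
          have := sum_integral_norm_selfConsistencyError_le hX hH hind hε hε1 hmean hbdd
            (by linarith : 1 ≤ η)
          linarith
  refine (mul_le_mul_of_nonneg_left h2 (by positivity)).trans_eq ?_
  field_simp

variable (P X) in
/-- The normalized sum of the variances over the rows with row sum above `K`. -/
noncomputable def tailSum (K : ℝ) : ℝ :=
  1 / (n : ℝ) * ∑ i with ¬ rowSum P X i ≤ K, rowSum P X i

variable (P X) in
/-- The normalized sum of the squared row sums over the rows and columns with row sum at most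
`K`. -/
noncomputable def truncatedSquareSum (K : ℝ) : ℝ :=
  1 / (n : ℝ) * ∑ i, restrictedSum (varProfile P X) {i | rowSum P X i ≤ K} i ^ 2

omit [IsProbabilityMeasure P] in
theorem average_rowSum_le (hn : 0 < n) {K : ℝ} (hK : 0 ≤ K) :
    1 / (n : ℝ) * ∑ i, rowSum P X i ≤ K + tailSum P X K := by
  have hn0 : (0 : ℝ) < n := by exact_mod_cast hn
  have h1 : ∑ i, rowSum P X i ≤ n * K + ∑ i with ¬ rowSum P X i ≤ K, rowSum P X i := by
    rw [Finset.sum_filter]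
    have h2 : ∑ _i : Fin n, K = n * K := by simp
    rw [← h2, ← Finset.sum_add_distrib]
    refine Finset.sum_le_sum fun i _ => ?_
    split_ifs with h
    · linarith
    · linarith
  rw [tailSum]
  refine (mul_le_mul_of_nonneg_left h1 (by positivity)).trans_eq ?_
  field_simp

omit [IsProbabilityMeasure P] in
theorem average_abs_rowSum_sub_one_le (hH : ∀ ω, (X ω).IsHermitian) (hn : 0 < n) (K : ℝ) {c : ℝ}
    (hc : 0 < c) :
    1 / (n : ℝ) * ∑ i, |rowSum P X i - 1| ≤ 2 * tailSum P X K + c / 2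
      + (2 * c)⁻¹ * (truncatedSquareSum P X K - 2 * (1 / (n : ℝ) * ∑ i, rowSum P X i)
        + 4 * tailSum P X K + 1) := by
  have hn0 : (0 : ℝ) < n := by exact_mod_cast hn
  have h1 := sum_abs_sub_one_le varProfile_nonneg (varProfile_comm (P := P) hH)
    {i | rowSum P X i ≤ K} hc
  simp only [sum_varProfile, Finset.compl_filter] at h1
  rw [tailSum, truncatedSquareSum]
  refine (mul_le_mul_of_nonneg_left h1 (by positivity : 0 ≤ 1 / (n : ℝ))).trans_eq ?_
  field_simp

theorem average_bounds (hX : ∀ i j, Measurable fun ω => X ω i j)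
    (hH : ∀ ω, (X ω).IsHermitian)
    (hind : iIndepFun (fun (p : {p : Fin n × Fin n // p.1 ≤ p.2}) ω => X ω p.1.1 p.1.2) P)
    {ε : ℝ} (hε : 0 < ε) (hε1 : ε ≤ 1) (hmean : ∀ i j, ∫ ω, X ω i j ∂P = 0)
    (hbdd : ∀ i j, ∀ᵐ ω ∂P, ‖X ω i j‖ ≤ ε) {η : ℝ} (hη : 1 ≤ η) (hn : 0 < n)
    {m δ β : ℝ} (hm : m = 1 / (n : ℝ) * ∑ i, rowSum P X i) (hδ : δ = 6 * ε * (1 + m))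
    (hβ : β = (∫ x, cauchyKernel η x ∂(meanSpectral P X hH : Measure ℝ)).re)
    {K : ℝ} (hK : 1 ≤ K) :
    η ^ 2 * (1 - β - δ) ≤ m ∧
    m ≤ η ^ 2 * (1 - β + δ) + 4 * tailSum P X K + 2 * K * ((η ^ 2)⁻¹ * m + δ) ∧
    2 * (η ^ 2)⁻¹ * truncatedSquareSum P X K ≤ m - η ^ 2 * (1 - β)
      + (η ^ 2 + 9 * K ^ 2) * δ + 5 * (η ^ 2)⁻¹ ^ 2 * K ^ 3 := by
  have hη0 : 0 < η := by linarith
  have hK0 : 0 < K := by linarith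
  have hn0 : (0 : ℝ) < n := by exact_mod_cast hn
  have hθ : 0 < (η ^ 2)⁻¹ := by positivity
  have hθ1 : (η ^ 2)⁻¹ ≤ 1 := inv_le_one_of_one_le₀ (by nlinarith)
  have he : ∀ ω i, selfConsistencyError η (X ω) (varProfile P X i) i
      = 1 - diagResolvent η (X ω) i - (((η ^ 2)⁻¹ : ℝ) : ℂ) * diagResolvent η (X ω) i
        * ∑ j, varProfile P X i j * diagResolvent η (X ω) j := fun ω i => by
    rw [selfConsistencyError]
  have hσ0 := varProfile_nonneg (P := P) (X := X)
  have hσs := varProfile_comm (P := P) hH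
  have ha := fun ω => norm_diagResolvent_le hη0 (hH ω)
  have e1 := le_of_forall_le_diagResolvent hX hH hind hε hε1 hmean hbdd hη hn (by positivity)
    fun ω => le_sum_mul_re_add hσ0 (ha ω) hθ (he ω)
  have e2 := le_of_forall_le_diagResolvent hX hH hind hε hε1 hmean hbdd hη hn (by positivity)
    fun ω => sum_le_of_threshold hσ0 hσs (ha ω) hθ (he ω) hK0.le
  have e3 := le_of_forall_le_diagResolvent hX hH hind hε hε1 hmean hbdd hη hn (by positivity)
    fun ω => sum_sq_restrictedSum_le hσ0 hσs (ha ω) (diagResolvent_re_nonneg hη0 (hH ω)) hθ hθ1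
      (he ω) hK (B := {i | rowSum P X i ≤ K}) fun i hi => (Finset.mem_filter.mp hi).2
  simp only [sum_varProfile, inv_inv, ← hm, ← hβ, ← hδ] at e1 e2 e3
  have hninv : 1 / (n : ℝ) * n = 1 := by field_simp
  refine ⟨?_, ?_, ?_⟩
  · have : 1 / (n : ℝ) * (η ^ 2 * n - ∑ i, rowSum P X i) = η ^ 2 - m := by
      rw [hm, mul_sub]
      linear_combination η ^ 2 * hninv
    linarith
  · have : 1 / (n : ℝ) * (∑ i, rowSum P X i - η ^ 2 * n
        - 4 * (∑ i with ¬ rowSum P X i ≤ K, rowSum P X i)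
        - 2 * K * (η ^ 2)⁻¹ * ∑ i, rowSum P X i)
        = m - η ^ 2 - 4 * tailSum P X K - 2 * K * (η ^ 2)⁻¹ * m := by
      rw [hm, tailSum]
      linear_combination -η ^ 2 * hninv
    have e2' := this.symm.trans_le e2
    linear_combination e2'
  · have : 1 / (n : ℝ) * (2 * (η ^ 2)⁻¹ *
        ∑ i, restrictedSum (varProfile P X) {i | rowSum P X i ≤ K} i ^ 2
        - ∑ i, rowSum P X i + η ^ 2 * n - 5 * (η ^ 2)⁻¹ ^ 2 * K ^ 3 * n)
        = 2 * (η ^ 2)⁻¹ * truncatedSquareSum P X K - m + η ^ 2 - 5 * (η ^ 2)⁻¹ ^ 2 * K ^ 3 := by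
      rw [hm, truncatedSquareSum]
      linear_combination (η ^ 2 - 5 * (η ^ 2)⁻¹ ^ 2 * K ^ 3) * hninv
    linarith

end RandomMatrix

/-! ### Asymptotics of the ensemble and the equivalence. -/

section Ensemble

variable {Ω : ℕ → Type*} [∀ n, MeasurableSpace (Ω n)] {P : ∀ n, Measure (Ω n)}
  [∀ n, IsProbabilityMeasure (P n)] {W : ∀ n, Ω n → Matrix (Fin n) (Fin n) ℂ}

omit [∀ n, IsProbabilityMeasure (P n)] in
theorem lindebergCondition_of_bounded {ε : ℕ → ℝ} (hε : Tendsto ε atTop (𝓝 0))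
    (hbdd : ∀ n i j, ∀ᵐ ω ∂(P n), ‖W n ω i j‖ ≤ ε n) : LindebergCondition P W := by
  intro δ hδ
  refine tendsto_const_nhds.congr' ?_
  filter_upwards [hε.eventually_lt_const hδ] with n hn
  refine (mul_eq_zero_of_right _ ?_).symm
  refine Finset.sum_eq_zero fun i _ => Finset.sum_eq_zero fun j _ => ?_
  refine setIntegral_measure_zero _ ?_
  refine measure_mono_null (fun ω (hω : δ < ‖W n ω i j‖) => ?_) (ae_iff.mp (hbdd n i j))
  exact not_le.mpr (hn.trans hω)

theorem tendsto_meanSpectral_of_tendsto_cauchyKernel (hW : IsHermitianWignerEnsemble P W)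
    (h : ∀ η : ℝ, 2 ≤ η → Tendsto (fun n => ∫ x, cauchyKernel η x
      ∂(meanSpectral (P n) (W n) (hW.isHermitian n) : Measure ℝ)) atTop
      (𝓝 (semicircleTransform η : ℂ))) :
    Tendsto (fun n => meanSpectral (P n) (W n) (hW.isHermitian n)) atTop
      (𝓝 semicircle.toFiniteMeasure) := by
  -- The index is shifted because the mean spectral distribution for `n = 0` is the zero measure.
  let ν : ℕ → ProbabilityMeasure ℝ := fun k =>
    ⟨meanSpectral (P (k + 1)) (W (k + 1)) (hW.isHermitian (k + 1)),
      isProbabilityMeasure_meanSpectral _ k.succ_ne_zero (hW.measurable _) _⟩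
  have hν : Tendsto ν atTop (𝓝 semicircle) := by
    refine tendsto_of_tendsto_cauchyKernel fun η hη => ?_
    rw [integral_cauchyKernel_semicircle (by linarith)]
    exact (h η hη).comp (tendsto_add_atTop_nat 1)
  rw [ProbabilityMeasure.tendsto_nhds_iff_toFiniteMeasure_tendsto_nhds] at hν
  exact (tendsto_add_atTop_iff_nat 1).mp hν

theorem tendsto_integral_cauchyKernel_of_tendsto {μ : ℕ → FiniteMeasure ℝ}
    (h : Tendsto μ atTop (𝓝 semicircle.toFiniteMeasure)) {η : ℝ} (hη : 0 < η) :
    Tendsto (fun n => (∫ x, cauchyKernel η x ∂(μ n : Measure ℝ)).re) atTop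
      (𝓝 (semicircleTransform η)) := by
  have h1 := (FiniteMeasure.tendsto_iff_forall_integral_rclike_tendsto ℂ).mp h
    (.ofNormedAddCommGroup (cauchyKernel η) (continuous_cauchyKernel hη.ne') 1
      (norm_cauchyKernel_le η))
  have h2 := (Complex.continuous_re.tendsto _).comp h1
  have h3 : (∫ x, cauchyKernel η x ∂(semicircle.toFiniteMeasure : Measure ℝ)).re
      = semicircleTransform η := by
    change (∫ x, cauchyKernel η x ∂(semicircle : Measure ℝ)).re = _
    rw [integral_cauchyKernel_semicircle hη, Complex.ofReal_re]
  rw [← h3]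
  exact h2

theorem tendsto_six_mul_mul {ε m : ℕ → ℝ} (hε : Tendsto ε atTop (𝓝 0)) (hε0 : ∀ n, 0 ≤ ε n)
    (hm0 : ∀ n, 0 ≤ m n) {M : ℝ} (hM : ∀ᶠ n in atTop, m n ≤ M) :
    Tendsto (fun n => 6 * ε n * (1 + m n)) atTop (𝓝 0) := by
  have h1 : Tendsto (fun n => 6 * ε n * (1 + M)) atTop (𝓝 0) := by
    simpa using (hε.const_mul 6).mul_const (1 + M)
  refine squeeze_zero' (Eventually.of_forall fun n => ?_) ?_ h1
  · have := hε0 n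
    have := hm0 n
    positivity
  · filter_upwards [hM] with n hn
    exact mul_le_mul_of_nonneg_left (by linarith) (mul_nonneg (by norm_num) (hε0 n))

omit [∀ n, IsProbabilityMeasure (P n)] in
theorem average_rowSum_nonneg (n : ℕ) : 0 ≤ 1 / (n : ℝ) * ∑ i, rowSum (P n) (W n) i :=
  mul_nonneg (by positivity) (Finset.sum_nonneg fun i _ => rowSum_nonneg i)

theorem tendsto_meanSpectral_of_rowCondition (hW : IsHermitianWignerEnsemble P W)
    {ε : ℕ → ℝ} (hε : Tendsto ε atTop (𝓝 0)) (hε0 : ∀ n, 0 < ε n)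
    (hmean : ∀ n i j, ∫ ω, W n ω i j ∂(P n) = 0)
    (hbdd : ∀ n i j, ∀ᵐ ω ∂(P n), ‖W n ω i j‖ ≤ ε n) (hrow : RowCondition P W) :
    Tendsto (fun n => meanSpectral (P n) (W n) (hW.isHermitian n)) atTop
      (𝓝 semicircle.toFiniteMeasure) := by
  refine tendsto_meanSpectral_of_tendsto_cauchyKernel hW fun η hη => ?_
  have hM : ∀ᶠ n : ℕ in atTop, 1 / (n : ℝ) * ∑ i, rowSum (P n) (W n) i ≤ 2 := by
    filter_upwards [hrow.eventually_le_const one_pos, eventually_gt_atTop 0] with n hn hn0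
    have hn1 : (0 : ℝ) < n := by exact_mod_cast hn0
    have h1 : ∑ i, rowSum (P n) (W n) i ≤ n + ∑ i, |rowSum (P n) (W n) i - 1| := by
      have h2 : ∑ _i : Fin n, (1 : ℝ) = n := by simp
      rw [← h2, ← Finset.sum_add_distrib]
      exact Finset.sum_le_sum fun i _ => by linarith [le_abs_self (rowSum (P n) (W n) i - 1)]
    have h3 := mul_le_mul_of_nonneg_left h1 (by positivity : 0 ≤ 1 / (n : ℝ))
    rw [mul_add, one_div_mul_cancel hn1.ne'] at h3
    linarith
  have hδ := tendsto_six_mul_mul hε (fun n => (hε0 n).le) average_rowSum_nonneg hM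
  rw [tendsto_iff_norm_sub_tendsto_zero]
  have hlim := (hrow.const_mul (3 / 2)).add (hδ.const_mul 2)
  rw [mul_zero, mul_zero, add_zero] at hlim
  refine squeeze_zero' (Eventually.of_forall fun _ => norm_nonneg _) ?_ hlim
  filter_upwards [hε.eventually_le_const one_pos, eventually_gt_atTop 0] with n hn1 hn0
  exact norm_integral_cauchyKernel_meanSpectral_sub_le (hW.measurable n) (hW.isHermitian n)
    (hW.indep n) (hε0 n) hn1 (hmean n) (hbdd n) hη hn0

theorem rowCondition_of_tendsto_meanSpectral (hW : IsHermitianWignerEnsemble P W)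
    {ε : ℕ → ℝ} (hε : Tendsto ε atTop (𝓝 0)) (hε0 : ∀ n, 0 < ε n)
    (hmean : ∀ n i j, ∫ ω, W n ω i j ∂(P n) = 0)
    (hbdd : ∀ n i j, ∀ᵐ ω ∂(P n), ‖W n ω i j‖ ≤ ε n) (hmargin : MarginCondition P W)
    (h : Tendsto (fun n => meanSpectral (P n) (W n) (hW.isHermitian n)) atTop
      (𝓝 semicircle.toFiniteMeasure)) : RowCondition P W := by
  have hτ : ∀ γ : ℝ, 0 < γ → ∃ K : ℝ, 1 ≤ K ∧ ∀ᶠ n in atTop, tailSum (P n) (W n) K ≤ γ :=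
    fun γ hγ => exists_threshold_average_le (s := fun n => rowSum (P n) (W n)) hmargin hγ
  -- Uniform integrability at one fixed level already bounds the average row sum, which makes the
  -- mean error tend to zero.
  obtain ⟨K₁, hK₁, hτ₁⟩ := hτ 1 one_pos
  have hM : ∀ᶠ n : ℕ in atTop, 1 / (n : ℝ) * ∑ i, rowSum (P n) (W n) i ≤ K₁ + 1 := by
    filter_upwards [hτ₁, eventually_gt_atTop 0] with n hn hn0
    exact (average_rowSum_le hn0 (K := K₁) (by linarith)).trans (by linarith)
  have hδ := tendsto_six_mul_mul hε (fun n => (hε0 n).le) average_rowSum_nonneg hM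
  have hβ : ∀ η : ℝ, 1 ≤ η → Tendsto (fun n => (∫ x, cauchyKernel η x
      ∂(meanSpectral (P n) (W n) (hW.isHermitian n) : Measure ℝ)).re) atTop
      (𝓝 (semicircleTransform η)) := fun η hη =>
    tendsto_integral_cauchyKernel_of_tendsto h (by linarith)
  have hbounds := fun (η K : ℝ) (hη : 1 ≤ η) (hK : 1 ≤ K) =>
    ((hε.eventually_le_const one_pos).and (eventually_gt_atTop 0)).mono fun n hn =>
      average_bounds (hW.measurable n) (hW.isHermitian n) (hW.indep n) (hε0 n) hn.1 (hmean n)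
        (hbdd n) hη hn.2 rfl rfl rfl hK
  have hm := tendsto_average_of_bounds
    (β := fun η n => (∫ x, cauchyKernel η x
      ∂(meanSpectral (P n) (W n) (hW.isHermitian n) : Measure ℝ)).re)
    (τ := fun K n => tailSum (P n) (W n) K) hM hδ hβ hτ
    (fun η hη => (hbounds η 1 hη le_rfl).mono fun n hn => hn.1)
    (fun η K hη hK => (hbounds η K hη hK).mono fun n hn => hn.2.1)
  refine tendsto_deviation_of_bounds (τ := fun K n => tailSum (P n) (W n) K)
    (Y := fun K n => truncatedSquareSum (P n) (W n) K) hm (fun n => ?_) hτ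
    (fun K γ hK hγ => ?_) (fun K c hc => ?_)
  · exact mul_nonneg (by positivity) (Finset.sum_nonneg fun i _ => abs_nonneg _)
  · exact eventually_average_sq_le_of_bounds
      (Y := fun K n => truncatedSquareSum (P n) (W n) K) hm hδ hβ
      (fun η hη => (hbounds η K hη hK).mono fun n hn => hn.2.2) hγ
  · filter_upwards [eventually_gt_atTop 0] with n hn
    exact average_abs_rowSum_sub_one_le (hW.isHermitian n) hn K hc

end Ensemble

end SemicircleLaw

theorem mainTheorem4 {Ω : ℕ → Type*} [∀ n, MeasurableSpace (Ω n)]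
    (P : ∀ n, Measure (Ω n)) [∀ n, IsProbabilityMeasure (P n)]
    (W : ∀ n, Ω n → Matrix (Fin n) (Fin n) ℂ)
    (hW : SemicircleLaw.IsHermitianWignerEnsemble P W)
    (ε : ℕ → ℝ) (hε_one : ε 1 ≤ 1) (hε_anti : AntitoneOn ε (Set.Ici 1))
    (hε_lim : Tendsto ε atTop (𝓝 0))
    (h_mean : ∀ n i j, ∫ ω, W n ω i j ∂(P n) = 0)
    (h_bdd : ∀ n i j, ∀ᵐ ω ∂(P n), ‖W n ω i j‖ ≤ ε n)
    (h_margin : SemicircleLaw.MarginCondition P W) :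
    (Tendsto (fun n => SemicircleLaw.meanSpectral (P n) (W n) (hW.isHermitian n)) atTop
        (𝓝 SemicircleLaw.semicircle.toFiniteMeasure) ↔
      SemicircleLaw.RowCondition P W) ∧
    SemicircleLaw.LindebergCondition P W := by
  -- The enlarged bound is strictly positive, as the weighted AM-GM step requires, while `ε n` may
  -- vanish.
  have hlim : Tendsto (fun n : ℕ => |ε n| + 1 / ((n : ℝ) + 1)) atTop (𝓝 0) := by
    simpa using hε_lim.abs.add tendsto_one_div_add_atTop_nhds_zero_nat
  have hpos : ∀ n : ℕ, 0 < |ε n| + 1 / ((n : ℝ) + 1) := fun n => by positivity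
  have hbdd : ∀ n i j, ∀ᵐ ω ∂(P n), ‖W n ω i j‖ ≤ |ε n| + 1 / ((n : ℝ) + 1) := fun n i j => by
    have h1 : 0 < 1 / ((n : ℝ) + 1) := by positivity
    filter_upwards [h_bdd n i j] with ω hω
    linarith [le_abs_self (ε n)]
  exact ⟨⟨SemicircleLaw.rowCondition_of_tendsto_meanSpectral hW hlim hpos h_mean hbdd h_margin,
    SemicircleLaw.tendsto_meanSpectral_of_rowCondition hW hlim hpos h_mean hbdd⟩,
    SemicircleLaw.lindebergCondition_of_bounded hε_lim h_bdd⟩
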